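/- Let $k$ be a finite field with $q$ elements, of characteristic $p\ge 5$, let $K$ be the function field of a smooth, proper, geometrically connected curve over $k$, let $E/K$ be an elliptic curve with nonconstant $j$-invariant ($j(E)\notin k$), and let $f\in K^\times$ be a non-square. Put $K_f=K(\sqrt f)$, and let $E_f$ be the quadratic twist of $E$ by $f$: if $E: y^2=x^3+ax+b$, then $E_f:y^2=x^3+f^2ax+f^3b$. For a place $v$ of $K$ let $k_v$ be the residue field and $d_v=[k_v:k]$. Define formal power series in $\mathbb Z[[T]]$ as products over all places of $K$: $$L(T,E_f/K)=\prod_v L_v(T^{d_v},E_f/K)^{-1},\qquad L(T,\chi)=\prod_v L_v(T^{d_v},\chi)^{-1}.$$ Here $L_v(T^{d_v},E_f/K)$ is $1-a_vT^{d_v}+q^{d_v}T^{2d_v}$ with $a_v=1+q^{d_v}-\#E_{f,v}(k_v)$ if $E_f$ has good reduction $E_{f,v}$ at $v$, and it is $1-T^{d_v}$, $1+T^{d_v}$, $1$ if $E_f$ has split multiplicative, nonsplit multiplicative, additive reduction at $v$, respectively; and $L_v(T^{d_v},\chi)$ is $1-T^{d_v}$, $1+T^{d_v}$, $1$ if $v$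 is split, inert, ramified in $K_f$, respectively ($\chi$ is the quadratic character of $K_f/K$). With respect to the reduction of $E$, let $M^{\rm sp}_{\rm unr}$, $M^{\rm ns}_{\rm unr}$, $A_{\rm unr}$ be the sets of places unramified in $K_f$ at which $E$ has split multiplicative, nonsplit multiplicative, additive reduction. Let $A_{\rm ram}^{\rm sp}$, $A_{\rm ram}^{\rm ns}$, $A_{\rm ram}^{\rm gd}$ be the sets of places $v$ ramified in $K_f$ at which $E/K$ has additive reduction and such that, at the place of $K_f$ above $v$, the base change of $E$ to $K_f$ has split multiplicative, nonsplit multiplicative, good reduction, respectively. For $v$ unramified in $K_f$ let $\alpha_v=1$ if $v$ is inert and $\alpha_v=-1$ if $v$ is split. **Theorem.** The set of places of bad reduction of $E$ is finite, and the two Euler products above converge in $\mathbb Z[[T]]$ (coefficientwise). If $E(K)$ contains a subgroup of order $N\ge 2$ with $N$ coprime to $q$, then $$L(T,E_f/K)\equiv L(T,\chi)\,L(qT,\chi)\cdot R(T)\cdot\gamma_{\rm ram}\pmod N$$ in $\mathbb Z[[T]]$. If $N\ge 5$, then $\gamma_{\rm ram}=1$ and $$R(T)=\prod_{v\in M^{\rm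 sp}_{\rm unr}}(1+\alpha_vq^{d_v}T^{d_v})\prod_{v\in M^{\rm ns}_{\rm unr}}\frac{(1+\alpha_vT^{d_v})(1+\alpha_vq^{d_v}T^{d_v})}{1-\alpha_vT^{d_v}}.$$ If $N\in\{2,3,4\}$, then $R(T)$ is this same product multiplied by $\prod_{v\in A_{\rm unr}}(1+\alpha_vT^{d_v})(1+\alpha_vq^{d_v}T^{d_v})$, and $$\gamma_{\rm ram}=\prod_{v\in A_{\rm ram}^{\rm sp}}(1-T^{d_v})^{-1}\prod_{v\in A_{\rm ram}^{\rm ns}}(1+T^{d_v})^{-1}\prod_{v\in A_{\rm ram}^{\rm gd}}(1-T^{d_v})^{-1}(1-q^{d_v}T^{d_v})^{-1}.$$ Moreover, for $N\in\{2,3,4\}$ the Kodaira symbol of $E$ at a place that contributes an additive factor is as follows. If $v\in A_{\rm unr}$, it is $III$, $III^*$ or $I_n^*$ ($n\ge0$) when $N=2$; $IV$ or $IV^*$ when $N=3$; and $I_n^*$ ($n\ge 0$) when $N=4$. If $v\in A_{\rm ram}^{\rm sp}\cup A_{\rm ram}^{\rm ns}\cup A_{\rm ram}^{\rm gd}$,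 it is $I_n^*$ ($n\ge0$). -/

import Mathlib

open scoped PowerSeries.WithPiTopology

noncomputable section

namespace EllTwist

/-! ### Function fields of curves, places, degrees -/

/-- `K` is the function field of a smooth, proper, geometrically connected curve over the
(finite, hence perfect) field `k`: it is a finite extension of `k(t)` for some `t` transcendental
over `k`, and `k` is algebraically closed in `K`. -/
structure IsCurveFunctionField (k K : Type*) [Field k] [Field K] [Algebra k K] : Prop where
  exists_finite : ∃ t : K, Transcendental k t ∧
    FiniteDimensional (IntermediateField.adjoin k {t}) K
  constants : ∀ x : K, IsAlgebraic k x → x ∈ (algebraMap k K).range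

/-- A place of `K / k` (for the function field of a curve, the same thing as a closed point of
the curve): a discrete valuation ring of `K` containing `k`, with fraction field `K`. -/
@[ext]
structure Place (k K : Type*) [Field k] [Field K] [Algebra k K] where
  ring : ValuationSubring K
  algebraMap_mem : ∀ c : k, algebraMap k K c ∈ ring
  isDVR : IsDiscreteValuationRing ring

section Places

variable {k K L : Type*} [Field k] [Field K] [Field L] [Algebra k K] [Algebra k L] [Algebra K L]

instance (v : Place k K) : IsDiscreteValuationRing v.ring := v.isDVR

instance (v : Place k K) : Algebra k v.ring :=
  ((algebraMap k K).codRestrict v.ring v.algebraMap_mem).toAlgebra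

/-- The residue field `k_v`. -/
abbrev Place.residueField (v : Place k K) : Type _ := IsLocalRing.ResidueField v.ring

/-- The degree `d_v = [k_v : k]`. -/
def Place.deg (v : Place k K) : ℕ := Module.finrank k v.residueField

/-- The place `w` of `L` lies over the place `v` of `K`. -/
def Place.LiesOver (w : Place k L) (v : Place k K) : Prop :=
  w.ring.comap (algebraMap K L) = v.ring

/-- For `w` over `v`: the ramification index is at least `2`, that is, the maximal ideal
of `v` is contained in the square of the maximal ideal of `w`. -/
def Place.RamifiedOver (w : Place k L) (v : Place k K) : Prop :=
  ∀ x : v.ring, x ∈ IsLocalRing.maximalIdeal v.ring →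
    ∀ y : w.ring, (y : L) = algebraMap K L (x : K) → y ∈ IsLocalRing.maximalIdeal w.ring ^ 2

variable (L)

/-- `v` is ramified in the quadratic extension `L / K`. -/
def Place.IsRamified (v : Place k K) : Prop :=
  ∃ w : Place k L, w.LiesOver v ∧ w.RamifiedOver v

/-- `v` splits in the quadratic extension `L / K`: there are exactly two places above it. -/
def Place.IsSplit (v : Place k K) : Prop :=
  {w : Place k L | w.LiesOver v}.ncard = 2

/-- `v` is inert in the quadratic extension `L / K`: there is exactly one place above it, and it
is unramified over `v`. -/
def Place.IsInert (v : Place k K) : Prop :=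
  (∃! w : Place k L, w.LiesOver v) ∧ ¬ v.IsRamified L

/-- `v` is split or inert in `L / K`. -/
def Place.IsUnramified (v : Place k K) : Prop := v.IsSplit L ∨ v.IsInert L

end Places

/-! ### Quadratic twists -/

/-- The quadratic twist of `W` by `f`, in characteristic different from `2, 3`: if `W` is brought
to the form `y² = x³ + a x + b`, with `a = - c₄ / 48` and `b = - c₆ / 864`, this is
`y² = x³ + f² a x + f³ b`. -/
def quadraticTwist {K : Type*} [Field K] (W : WeierstrassCurve K) (f : K) : WeierstrassCurve K where
  a₁ := 0
  a₂ := 0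
  a₃ := 0
  a₄ := f ^ 2 * (-W.c₄ / 48)
  a₆ := f ^ 3 * (-W.c₆ / 864)

/-- The twist of `y² = x³ + a x + b` by `f` is `y² = x³ + f² a x + f³ b`. -/
theorem quadraticTwist_short {K : Type*} [Field K] (h2 : (2 : K) ≠ 0) (h3 : (3 : K) ≠ 0)
    (a b f : K) :
    quadraticTwist ⟨0, 0, 0, a, b⟩ f = ⟨0, 0, 0, f ^ 2 * a, f ^ 3 * b⟩ := by
  have h48 : (48 : K) ≠ 0 := by
    have : (48 : K) = 2 ^ 4 * 3 := by norm_num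
    rw [this]; exact mul_ne_zero (pow_ne_zero _ h2) h3
  have h864 : (864 : K) ≠ 0 := by
    have : (864 : K) = 2 ^ 5 * 3 ^ 3 := by norm_num
    rw [this]; exact mul_ne_zero (pow_ne_zero _ h2) (pow_ne_zero _ h3)
  ext <;> simp only [quadraticTwist, WeierstrassCurve.c₄, WeierstrassCurve.c₆,
    WeierstrassCurve.b₂, WeierstrassCurve.b₄, WeierstrassCurve.b₆] <;> field_simp <;> ring

/-! ### Reduction types at a place

The reduction at `v` is that of a minimal Weierstrass equation over the local ring of `v`; the
type does not depend on the chosen minimal equation and does not change on completing. -/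

section Reduction

variable {k K L : Type*} [Field k] [Field K] [Field L] [Algebra k K] [Algebra k L] [Algebra K L]

def GoodAt (W : WeierstrassCurve K) (v : Place k K) : Prop :=
  (W.minimal v.ring).HasGoodReduction v.ring

def SplitMultAt (W : WeierstrassCurve K) (v : Place k K) : Prop :=
  (W.minimal v.ring).HasSplitMultiplicativeReduction v.ring

def NonsplitMultAt (W : WeierstrassCurve K) (v : Place k K) : Prop :=
  (W.minimal v.ring).HasMultiplicativeReduction v.ring ∧
    ¬ (W.minimal v.ring).HasSplitMultiplicativeReduction v.ring

def AdditiveAt (W : WeierstrassCurve K) (v : Place k K) : Prop :=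
  (W.minimal v.ring).HasAdditiveReduction v.ring

variable (k L)
variable (W : WeierstrassCurve K)

/-- Unramified places of split multiplicative reduction. -/
def MspUnr : Set (Place k K) := {v | SplitMultAt W v ∧ v.IsUnramified L}

/-- Unramified places of nonsplit multiplicative reduction. -/
def MnsUnr : Set (Place k K) := {v | NonsplitMultAt W v ∧ v.IsUnramified L}

/-- Unramified places of additive reduction. -/
def AUnr : Set (Place k K) := {v | AdditiveAt W v ∧ v.IsUnramified L}

/-- Ramified places of additive reduction over which the curve acquires split multiplicative
reduction over `L`. -/
def ARamSp : Set (Place k K) :=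
  {v | AdditiveAt W v ∧ v.IsRamified L ∧
    ∃ w : Place k L, w.LiesOver v ∧ SplitMultAt (W.baseChange L) w}

/-- Ramified places of additive reduction over which the curve acquires nonsplit multiplicative
reduction over `L`. -/
def ARamNs : Set (Place k K) :=
  {v | AdditiveAt W v ∧ v.IsRamified L ∧
    ∃ w : Place k L, w.LiesOver v ∧ NonsplitMultAt (W.baseChange L) w}

/-- Ramified places of additive reduction over which the curve acquires good reduction
over `L`. -/
def ARamGd : Set (Place k K) :=
  {v | AdditiveAt W v ∧ v.IsRamified L ∧
    ∃ w : Place k L, w.LiesOver v ∧ GoodAt (W.baseChange L) w}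

end Reduction

/-! ### Kodaira symbols -/

/-- The Kodaira symbols; `I 0` is `I₀` and a suffix `star` stands for `*`. -/
inductive KodairaSymbol
  | I (n : ℕ)
  | II
  | III
  | IV
  | Istar (n : ℕ)
  | IVstar
  | IIIstar
  | IIstar

/-- The integral Weierstrass equation `W` over a discrete valuation ring `R` (with perfect residue
field) is a normal form at which Tate's algorithm stops with output the given symbol. Here
`x ∈ m ^ i` means that `π ^ i` divides `x`.

* In the cases `I (n + 1)`, `II`, ..., the singular point of the reduction is the origin.
* For `I₀*` the cubic `T³ + a₂/π T² + a₄/π² T + a₆/π³` is separable modulo `π`.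
* For `Iₙ*` with `n ≥ 1` this cubic has the double root `0` and a simple root modulo `π`, and the
  quadratic polynomial `Y² + a₃/π^(j+1) Y - a₆/π^(2j+2)` for `n = 2 j - 1`, respectively
  `a₂/π X² + a₄/π^(j+2) X + a₆/π^(2j+3)` for `n = 2 j`, is separable modulo `π`.
* For `IV*`, `III*`, `II*` the cubic has the triple root `0` modulo `π`. -/
def IsTateNormalForm {R : Type*} [CommRing R] [IsLocalRing R] (W : WeierstrassCurve R) :
    KodairaSymbol → Prop :=
  let m : Ideal R := IsLocalRing.maximalIdeal R
  fun
  | .I 0 => W.Δ ∉ m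
  | .I (n + 1) => W.a₃ ∈ m ∧ W.a₄ ∈ m ∧ W.a₆ ∈ m ∧ W.b₂ ∉ m ∧ W.Δ ∈ m ^ (n + 1) ∧ W.Δ ∉ m ^ (n + 2)
  | .II => W.a₃ ∈ m ∧ W.a₄ ∈ m ∧ W.a₆ ∈ m ∧ W.b₂ ∈ m ∧ W.a₆ ∉ m ^ 2
  | .III => W.a₃ ∈ m ∧ W.a₄ ∈ m ∧ W.a₆ ∈ m ^ 2 ∧ W.b₂ ∈ m ∧ W.b₈ ∉ m ^ 3
  | .IV => W.a₃ ∈ m ∧ W.a₄ ∈ m ∧ W.a₆ ∈ m ^ 2 ∧ W.b₂ ∈ m ∧ W.b₈ ∈ m ^ 3 ∧ W.b₆ ∉ m ^ 3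
  | .Istar 0 => W.a₁ ∈ m ∧ W.a₂ ∈ m ∧ W.a₃ ∈ m ^ 2 ∧ W.a₄ ∈ m ^ 2 ∧ W.a₆ ∈ m ^ 3 ∧
      W.a₂ ^ 2 * W.a₄ ^ 2 - 4 * W.a₄ ^ 3 - 4 * W.a₂ ^ 3 * W.a₆ - 27 * W.a₆ ^ 2
        + 18 * W.a₂ * W.a₄ * W.a₆ ∉ m ^ 7
  | .Istar (n + 1) => W.a₁ ∈ m ∧ W.a₂ ∈ m ∧ W.a₂ ∉ m ^ 2 ∧
      ((∃ i : ℕ, n + 1 = 2 * i + 1 ∧ W.a₃ ∈ m ^ (i + 2) ∧ W.a₄ ∈ m ^ (i + 3) ∧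
          W.a₆ ∈ m ^ (2 * i + 4) ∧ W.a₃ ^ 2 + 4 * W.a₆ ∉ m ^ (2 * i + 5)) ∨
       (∃ i : ℕ, n + 1 = 2 * i + 2 ∧ W.a₃ ∈ m ^ (i + 3) ∧ W.a₄ ∈ m ^ (i + 3) ∧
          W.a₆ ∈ m ^ (2 * i + 5) ∧ W.a₄ ^ 2 - 4 * W.a₂ * W.a₆ ∉ m ^ (2 * i + 7)))
  | .IVstar => W.a₁ ∈ m ∧ W.a₂ ∈ m ^ 2 ∧ W.a₃ ∈ m ^ 2 ∧ W.a₄ ∈ m ^ 3 ∧ W.a₆ ∈ m ^ 4 ∧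
      W.b₆ ∉ m ^ 5
  | .IIIstar => W.a₁ ∈ m ∧ W.a₂ ∈ m ^ 2 ∧ W.a₃ ∈ m ^ 3 ∧ W.a₄ ∈ m ^ 3 ∧ W.a₆ ∈ m ^ 5 ∧
      W.a₄ ∉ m ^ 4
  | .IIstar => W.a₁ ∈ m ∧ W.a₂ ∈ m ^ 2 ∧ W.a₃ ∈ m ^ 3 ∧ W.a₄ ∈ m ^ 4 ∧ W.a₆ ∈ m ^ 5 ∧
      W.a₆ ∉ m ^ 6

/-- `W` has Kodaira symbol `s` at the place `v`: some change of variables over `K` brings `W` to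
an integral equation at which Tate's algorithm stops with output `s`. -/
def HasKodairaSymbol {k K : Type*} [Field k] [Field K] [Algebra k K] (W : WeierstrassCurve K)
    (v : Place k K) (s : KodairaSymbol) : Prop :=
  ∃ (C : WeierstrassCurve.VariableChange K) (W₀ : WeierstrassCurve v.ring),
    C • W = W₀.baseChange K ∧ IsTateNormalForm W₀ s

/-! ### L-functions, as formal power series with integer coefficients -/

/-- The inverse of a power series with constant coefficient `1`. -/
def inv1 (F : PowerSeries ℤ) : PowerSeries ℤ := PowerSeries.invOfUnit F 1

/-- The series `1 + c T ^ d`. -/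
def lin (c : ℤ) (d : ℕ) : PowerSeries ℤ := 1 + PowerSeries.C c * PowerSeries.X ^ d

section LFunctions

variable {k K : Type*} [Field k] [Field K] [Algebra k K]

/-- The polynomial `L_v(T ^ {d_v}, W / K)`, where `L_v` is `1 - a_v T + q ^ {d_v} T²` at places of
good reduction (with `a_v = 1 + q ^ {d_v} - # W_v(k_v)`), and `1 - T`, `1 + T`, `1` at places
of split multiplicative, nonsplit multiplicative and additive reduction. -/
def eulerFactor (W : WeierstrassCurve K) (v : Place k K) : PowerSeries ℤ :=
  ((Polynomial.expand ℤ v.deg (W.localPolynomial v.ring) : Polynomial ℤ) : PowerSeries ℤ)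

variable (k) in
/-- `L(T, W / K)`. -/
def ellL (W : WeierstrassCurve K) : PowerSeries ℤ :=
  ∏' v : Place k K, inv1 (eulerFactor W v)

variable (L : Type*) [Field L] [Algebra k L] [Algebra K L]

open Classical in
/-- `L_v(T ^ {d_v}, χ)` for the quadratic character `χ` of `L / K`. -/
def artinFactor (v : Place k K) : PowerSeries ℤ :=
  if v.IsSplit L then lin (-1) v.deg else if v.IsInert L then lin 1 v.deg else 1

variable (k K) in
/-- The Artin L-function `L(T, χ)` of the quadratic character `χ` of `L / K`. -/
def artinL : PowerSeries ℤ := ∏' v : Place k K, inv1 (artinFactor L v)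

open Classical in
/-- The sign `α_v` of an unramified place: `1` if `v` is inert, `-1` if `v` is split. -/
def sgn (v : Place k K) : ℤ := if v.IsInert L then 1 else -1

variable (k) in
/-- The product over the unramified multiplicative places. -/
def Rmult (W : WeierstrassCurve K) : PowerSeries ℤ :=
  (∏ᶠ v ∈ MspUnr k L W, lin (sgn L v * (Nat.card k : ℤ) ^ v.deg) v.deg) *
  ∏ᶠ v ∈ MnsUnr k L W,
    lin (sgn L v) v.deg * lin (sgn L v * (Nat.card k : ℤ) ^ v.deg) v.deg *
      inv1 (lin (-sgn L v) v.deg)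

variable (k) in
/-- The product over the unramified additive places. -/
def Radd (W : WeierstrassCurve K) : PowerSeries ℤ :=
  ∏ᶠ v ∈ AUnr k L W, lin (sgn L v) v.deg * lin (sgn L v * (Nat.card k : ℤ) ^ v.deg) v.deg

variable (k) in
/-- The factor `R(T)`. -/
def Rfactor (W : WeierstrassCurve K) (N : ℕ) : PowerSeries ℤ :=
  if 5 ≤ N then Rmult k L W else Rmult k L W * Radd k L W

variable (k) in
/-- The factor `γ_ram`. -/
def gammaRam (W : WeierstrassCurve K) (N : ℕ) : PowerSeries ℤ :=
  if 5 ≤ N then 1 else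
    (∏ᶠ v ∈ ARamSp k L W, inv1 (lin (-1) v.deg)) *
    (∏ᶠ v ∈ ARamNs k L W, inv1 (lin 1 v.deg)) *
    ∏ᶠ v ∈ ARamGd k L W,
      inv1 (lin (-1) v.deg) * inv1 (lin (-(Nat.card k : ℤ) ^ v.deg) v.deg)

end LFunctions

/-- Congruence modulo `N` of power series with integer coefficients. -/
def CongrMod (N : ℕ) (F G : PowerSeries ℤ) : Prop :=
  PowerSeries.map (Int.castRingHom (ZMod N)) F = PowerSeries.map (Int.castRingHom (ZMod N)) G

/-- The Kodaira symbols listed for the unramified additive places, for `N = 2, 3, 4`. -/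
def unrSymbols (N : ℕ) : Set KodairaSymbol :=
  {s | (N = 2 ∧ (s = .III ∨ s = .IIIstar ∨ ∃ n, s = .Istar n)) ∨
       (N = 3 ∧ (s = .IV ∨ s = .IVstar)) ∨
       (N = 4 ∧ ∃ n, s = .Istar n)}

/-- The Kodaira symbols listed for the ramified additive places, for `N = 2, 3, 4`. -/
def ramSymbols : Set KodairaSymbol := {s | ∃ n, s = .Istar n}

end EllTwist

end

/-! The congruence is local. At each place v the inverse Euler factor of E_f is compared modulo N
with the factor of L(T,χ)L(qT,χ) times a correction, which is 1 where E has good reduction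
(`congrMod_local`). The local congruences are then multiplied, since reduction modulo N commutes
with convergent products (`CongrMod.tprod`).

As p ≥ 5, both 2 and 3 are units at every place, so the reduction of E at v can be read off a short
equation y² = x³ + ax + b that cannot be scaled down (`IsPrimitiveModel`). Up to squares, f is a
unit or a uniformizer at v; this decides how v behaves in K(√f) (`Place.decomposition`) and how (a,
b) changes under the twist.

Unramified places. If E has good reduction, the torsion subgroup injects into the reduction
(`card_dvd_of_good`), so the trace of E is 1 + q^d modulo N, and that of E_f is ±(1 + q^d), with
sign + exactly when v splits. If E has multiplicative reduction, so has E_f, and it is of the same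
kind exactly when v splits; here the correction yields an equality. If E has additive reduction, so
has E_f, and the correction cancels the two factors of χ.

Additive reduction and torsion. The points of nonsingular reduction contain no torsion of order N
(`eq_zero_of_torsion`), so all nonzero torsion points reduce to the cusp. If P + Q ≠ 0 for two of
them, the slope ℓ of the line through P and Q satisfies ℓ² = x₁ + x₂ + x₃, hence lies in the maximal
ideal (`AddTorsion.slope`). Comparing orders in the chord and tangent equations then does the work
of the embedding into the component group: it gives N ≤ 4 and the possible Kodaira symbols
(`AddTorsion.classification`).

Ramified places. E_f has additive reduction unless E has type Iₙ*. For that type, dividing out the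
uniformizer gives a model of E_f with the same kind of reduction as E over K_f
(`IsPrimitiveModel.reduction_iff`). If this reduction is good, the torsion points give distinct
roots of the reduced cubic, that is, enough points of order two for N to divide the number of points
(`AddTorsion.dvd_card`).

Convergence and finiteness rest on one bound: a nonconstant function y has at most [K : k(y)] zeros
(`IsCurveFunctionField.finite_zeros`). -/

noncomputable section

namespace EllTwist

/-! ### Orders at a discrete valuation ring of a field -/

section Order

open IsDedekindDomain.HeightOneSpectrum WithZero

variable {K : Type*} [Field K] (O : ValuationSubring K) [IsDiscreteValuationRing O]

/-- The normalized multiplicative valuation of the discrete valuation ring `O` on `K`. -/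
abbrev val : Valuation K (WithZero (Multiplicative ℤ)) :=
  IsDedekindDomain.HeightOneSpectrum.valuation K (IsDiscreteValuationRing.maximalIdeal O)

/-- The order of `x` is at least `n`. -/
def OrdGe (n : ℤ) (x : K) : Prop := val O x ≤ exp (-n)

/-- The order of `x` is exactly `n`. -/
def OrdEq (n : ℤ) (x : K) : Prop := val O x = exp (-n)

variable {O} {m n : ℤ} {x y : K}

theorem OrdEq.ge (h : OrdEq O n x) : OrdGe O n x := le_of_eq h

theorem OrdGe.mono (h : OrdGe O n x) (hm : m ≤ n) : OrdGe O m x :=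
  le_trans h (exp_le_exp.2 (by omega))

theorem OrdGe.add (hx : OrdGe O n x) (hy : OrdGe O n y) : OrdGe O n (x + y) :=
  (val O).map_add_le hx hy

theorem OrdGe.neg (hx : OrdGe O n x) : OrdGe O n (-x) := by
  rwa [OrdGe, Valuation.map_neg]

theorem OrdGe.sub (hx : OrdGe O n x) (hy : OrdGe O n y) : OrdGe O n (x - y) :=
  (val O).map_sub_le hx hy

theorem OrdGe.mul (hx : OrdGe O m x) (hy : OrdGe O n y) : OrdGe O (m + n) (x * y) := by
  rw [OrdGe, map_mul, neg_add, exp_add]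
  exact mul_le_mul' hx hy

theorem OrdGe.mul_of_le {l : ℤ} (hx : OrdGe O m x) (hy : OrdGe O n y) (hl : l ≤ m + n) :
    OrdGe O l (x * y) := (hx.mul hy).mono hl

theorem OrdGe.pow (hx : OrdGe O n x) (k : ℕ) : OrdGe O (k * n) (x ^ k) := by
  induction k with
  | zero => simp [OrdGe]
  | succ k ih =>
    rw [pow_succ]
    exact (ih.mul hx).mono (by push_cast; linarith)

theorem OrdGe.pow_of_le {l : ℤ} {k : ℕ} (hx : OrdGe O n x) (hl : l ≤ k * n) : OrdGe O l (x ^ k) :=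
  (hx.pow k).mono hl

theorem OrdEq.neg (hx : OrdEq O n x) : OrdEq O n (-x) := by
  rwa [OrdEq, Valuation.map_neg]

theorem OrdEq.mul (hx : OrdEq O m x) (hy : OrdEq O n y) : OrdEq O (m + n) (x * y) := by
  rw [OrdEq, map_mul, neg_add, exp_add, hx, hy]

theorem OrdEq.inv (hx : OrdEq O n x) : OrdEq O (-n) x⁻¹ := by
  rw [OrdEq, map_inv₀, hx, ← exp_neg]

theorem OrdEq.div (hx : OrdEq O m x) (hy : OrdEq O n y) : OrdEq O (m - n) (x / y) := by
  rw [div_eq_mul_inv, sub_eq_add_neg]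
  exact hx.mul hy.inv

theorem OrdEq.pow (hx : OrdEq O n x) (k : ℕ) : OrdEq O (k * n) (x ^ k) := by
  induction k with
  | zero => simp [OrdEq]
  | succ k ih =>
    rw [pow_succ]
    have := ih.mul hx
    convert this using 1
    push_cast; ring

theorem OrdEq.congr (hx : OrdEq O n x) (h : m = n) : OrdEq O m x := h ▸ hx

theorem OrdGe.div (hx : OrdGe O m x) (hy : OrdEq O n y) : OrdGe O (m - n) (x / y) := by
  rw [div_eq_mul_inv, sub_eq_add_neg]
  exact hx.mul hy.inv.ge

theorem OrdGe.div_of_le {l : ℤ} (hx : OrdGe O m x) (hy : OrdEq O n y) (hl : l ≤ m - n) :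
    OrdGe O l (x / y) := (hx.div hy).mono hl

theorem OrdEq.add_ge (hx : OrdEq O n x) (hy : OrdGe O (n + 1) y) : OrdEq O n (x + y) := by
  have : val O y < val O x := by
    rw [hx]
    exact lt_of_le_of_lt hy (exp_lt_exp.2 (by omega))
  rw [OrdEq, Valuation.map_add_eq_of_lt_left _ this, hx]

theorem OrdEq.ne_zero (hx : OrdEq O n x) : x ≠ 0 := by
  rintro rfl
  rw [OrdEq, map_zero] at hx
  exact exp_ne_zero hx.symm

theorem OrdEq.not_ge (hx : OrdEq O n x) (h : n < m) : ¬ OrdGe O m x := by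
  rw [OrdGe, hx, exp_le_exp]
  omega

theorem OrdEq.le_of_ge (hx : OrdEq O n x) (h : OrdGe O m x) : m ≤ n := by
  by_contra! h'
  exact hx.not_ge h' h

theorem OrdEq.unique (hx : OrdEq O n x) (h : OrdEq O m x) : m = n :=
  le_antisymm (hx.le_of_ge h.ge) (h.le_of_ge hx.ge)

theorem exists_ordEq (hx : x ≠ 0) : ∃ n, OrdEq O n x := by
  have : val O x ≠ 0 := (Valuation.ne_zero_iff _).2 hx
  exact ⟨-log (val O x), by rw [OrdEq, neg_neg, exp_log this]⟩

theorem ordGe_zero_right (n : ℤ) : OrdGe O n (0 : K) := by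
  rw [OrdGe, map_zero]; exact zero_le

theorem OrdGe.eq_or (hx : OrdGe O n x) : OrdEq O n x ∨ OrdGe O (n + 1) x := by
  by_cases h0 : x = 0
  · subst h0; right; exact ordGe_zero_right _
  obtain ⟨k, hk⟩ := exists_ordEq (O := O) h0
  have := hk.le_of_ge hx
  rcases this.eq_or_lt with rfl | h
  · exact Or.inl hk
  · exact Or.inr (hk.ge.mono (by omega))

theorem OrdGe.eq_of_not (hx : OrdGe O n x) (h : ¬ OrdGe O (n + 1) x) : OrdEq O n x :=
  hx.eq_or.resolve_right h

theorem exists_ordEq_of_not_ge (h : ¬ OrdGe O n x) : ∃ k < n, OrdEq O k x := by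
  have h0 : x ≠ 0 := by rintro rfl; exact h (ordGe_zero_right _)
  obtain ⟨k, hk⟩ := exists_ordEq (O := O) h0
  refine ⟨k, ?_, hk⟩
  by_contra! h'
  exact h (hk.ge.mono h')

theorem ordEq_one : OrdEq O 0 (1 : K) := by simp [OrdEq]

variable (O) in
theorem exists_uniformizer : ∃ π : K, OrdEq O 1 π :=
  IsDedekindDomain.HeightOneSpectrum.valuation_exists_uniformizer K _

theorem OrdEq.zpow (hx : OrdEq O n x) (k : ℤ) : OrdEq O (k * n) (x ^ k) := by
  rw [OrdEq, map_zpow₀, hx, ← exp_zsmul, smul_eq_mul, mul_neg]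

theorem ordGe_zero_iff : OrdGe O 0 x ↔ x ∈ O := by
  constructor
  · intro h
    obtain ⟨a, rfl⟩ := IsDiscreteValuationRing.exists_lift_of_le_one (A := O) (K := K) (x := x)
      (by simpa [OrdGe] using h)
    exact a.2
  · intro h
    have := valuation_le_one (K := K) (IsDiscreteValuationRing.maximalIdeal O) ⟨x, h⟩
    simpa [OrdGe] using this

theorem mem_maximalIdeal_pow_iff (z : O) (n : ℕ) :
    z ∈ IsLocalRing.maximalIdeal O ^ n ↔ OrdGe O n (z : K) := by
  have := intValuation_le_pow_iff_mem (IsDiscreteValuationRing.maximalIdeal O) z n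
  rw [← valuation_of_algebraMap (K := K)] at this
  exact this.symm

theorem mem_maximalIdeal_iff (z : O) :
    z ∈ IsLocalRing.maximalIdeal O ↔ OrdGe O 1 (z : K) := by
  have := mem_maximalIdeal_pow_iff z 1
  simpa using this

theorem isUnit_iff_ordEq (z : O) : IsUnit z ↔ OrdEq O 0 (z : K) := by
  have h := mem_maximalIdeal_iff z
  rw [IsLocalRing.mem_maximalIdeal, mem_nonunits_iff] at h
  have hz : OrdGe O 0 (z : K) := ordGe_zero_iff.2 z.2
  constructor
  · intro hu
    exact hz.eq_of_not fun h' => h.2 h' hu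
  · intro h'
    by_contra hu
    exact h'.not_ge (by norm_num) (h.1 hu)

theorem residue_eq_zero_iff_ordGe (z : O) :
    IsLocalRing.residue O z = 0 ↔ OrdGe O 1 (z : K) := by
  rw [IsLocalRing.residue_eq_zero_iff, mem_maximalIdeal_iff]

theorem residue_eq_iff_ordGe (z w : O) :
    IsLocalRing.residue O z = IsLocalRing.residue O w ↔ OrdGe O 1 ((z : K) - w) := by
  rw [← sub_eq_zero, ← map_sub, residue_eq_zero_iff_ordGe]; rfl

theorem val_eq_one_iff : val O x = 1 ↔ OrdEq O 0 x := by simp [OrdEq]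

theorem val_lt_one_iff : val O x < 1 ↔ OrdGe O 1 x := by
  constructor
  · intro h
    have h0 : OrdGe O 0 x := by simpa [OrdGe] using h.le
    rcases h0.eq_or with h1 | h1
    · rw [← val_eq_one_iff] at h1; exact absurd h1 h.ne
    · exact h1
  · intro h
    refine lt_of_le_of_lt h ?_
    rw [← exp_zero, exp_lt_exp]; norm_num

theorem OrdGe.of_mul_left (hx : OrdEq O m x) (h : OrdGe O n (x * y)) : OrdGe O (n - m) y := by
  have := h.div hx
  rwa [mul_div_cancel_left₀ _ hx.ne_zero] at this

theorem OrdEq.of_mul_left (hx : OrdEq O m x) (h : OrdEq O n (x * y)) : OrdEq O (n - m) y := by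
  have := h.div hx
  rwa [mul_div_cancel_left₀ _ hx.ne_zero] at this

/-- Orders are integers, so the bound n / k may be rounded up; `hm` says that m is at most the
ceiling of n / k. -/
theorem OrdGe.of_pow {k : ℕ} (hk : 0 < k) (h : OrdGe O n (x ^ k)) (hm : k * (m - 1) < n) :
    OrdGe O m x := by
  by_contra h'
  obtain ⟨l, hl, hx⟩ := exists_ordEq_of_not_ge h'
  have h1 := (hx.pow k).le_of_ge h
  have : (k : ℤ) * l ≤ k * (m - 1) := mul_le_mul_of_nonneg_left (by omega) (by positivity)
  omega

theorem OrdEq.of_sq (h : OrdEq O n (x ^ 2)) : ∃ k, n = 2 * k ∧ OrdEq O k x := by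
  have h0 : x ≠ 0 := by
    rintro rfl
    exact h.ne_zero (by simp)
  obtain ⟨k, hk⟩ := exists_ordEq (O := O) h0
  exact ⟨k, h.unique (hk.pow 2) ▸ by push_cast; ring, hk⟩

theorem OrdGe.eq_zero (h : ∀ n : ℕ, OrdGe O n x) : x = 0 := by
  by_contra h0
  obtain ⟨k, hk⟩ := exists_ordEq (O := O) h0
  have := hk.le_of_ge (h (k.toNat + 1))
  push_cast at this
  omega

theorem OrdEq.unit_mul_ge (hx : OrdEq O 0 x) (h : OrdGe O n y) : OrdGe O n (x * y) :=
  (hx.ge.mul h).mono (by omega)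

theorem OrdEq.unit_mul (hx : OrdEq O 0 x) (h : OrdEq O n y) : OrdEq O n (x * y) :=
  (hx.mul h).congr (by omega)

end Order

/-! ### The isomorphism of point groups induced by a change of variables -/

section VariableChange

open WeierstrassCurve WeierstrassCurve.Affine

variable {F : Type*} [Field F] (C : VariableChange F) (W : WeierstrassCurve F)

/-- The new `x`-coordinate. -/
def vcX (x : F) : F := (C.u⁻¹ : Fˣ) ^ 2 * (x - C.r)

/-- The new `y`-coordinate. -/
def vcY (x y : F) : F := (C.u⁻¹ : Fˣ) ^ 3 * (y - C.s * (x - C.r) - C.t)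

theorem vc_equation {x y : F} (h : W.toAffine.Equation x y) :
    (C • W).toAffine.Equation (vcX C x) (vcY C x y) := by
  rw [equation_iff] at h ⊢
  simp only [vcX, vcY, variableChange_a₁, variableChange_a₂, variableChange_a₃, variableChange_a₄,
    variableChange_a₆]
  linear_combination ((C.u⁻¹ : Fˣ) : F) ^ 6 * h

theorem vc_negY (x y : F) :
    (C • W).toAffine.negY (vcX C x) (vcY C x y) = vcY C x (W.toAffine.negY x y) := by
  simp only [negY, vcX, vcY, variableChange_a₁, variableChange_a₃]
  ring

variable {C} in
theorem vcX_injective {x x' : F} (h : vcX C x = vcX C x') : x = x' := by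
  have hu : ((C.u⁻¹ : Fˣ) : F) ^ 2 ≠ 0 := pow_ne_zero _ (Units.ne_zero _)
  have := mul_left_cancel₀ hu h
  linear_combination this

variable {C} in
theorem vcY_injective {x y y' : F} (h : vcY C x y = vcY C x y') : y = y' := by
  have hu : ((C.u⁻¹ : Fˣ) : F) ^ 3 ≠ 0 := pow_ne_zero _ (Units.ne_zero _)
  have := mul_left_cancel₀ hu h
  linear_combination this

variable [DecidableEq F]

/-- This is the content of additivity of `vcHom`: the coordinates of a sum are polynomials in the
slope, which transforms affinely. -/
theorem vc_slope {x₁ x₂ y₁ y₂ : F} (h₁ : W.toAffine.Equation x₁ y₁)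
    (h₂ : W.toAffine.Equation x₂ y₂) (h : ¬(x₁ = x₂ ∧ y₁ = W.toAffine.negY x₂ y₂)) :
    (C • W).toAffine.slope (vcX C x₁) (vcX C x₂) (vcY C x₁ y₁) (vcY C x₂ y₂) =
      (C.u⁻¹ : Fˣ) * (W.toAffine.slope x₁ x₂ y₁ y₂ - C.s) := by
  have hu : ((C.u⁻¹ : Fˣ) : F) ≠ 0 := Units.ne_zero _
  by_cases hx : x₁ = x₂
  · subst hx
    have hy : y₁ ≠ W.toAffine.negY x₁ y₂ := fun h' => h ⟨rfl, h'⟩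
    have hyy : y₁ = y₂ := Y_eq_of_Y_ne h₁ h₂ rfl hy
    subst hyy
    have hy' : vcY C x₁ y₁ ≠ (C • W).toAffine.negY (vcX C x₁) (vcY C x₁ y₁) := by
      rw [vc_negY]
      exact fun h' => hy (vcY_injective h')
    rw [slope_of_Y_ne rfl hy, slope_of_Y_ne rfl hy', vc_negY]
    have hd : y₁ - W.toAffine.negY x₁ y₁ ≠ 0 := sub_ne_zero.2 hy
    have hd' : vcY C x₁ y₁ - vcY C x₁ (W.toAffine.negY x₁ y₁) =
        ((C.u⁻¹ : Fˣ) : F) ^ 3 * (y₁ - W.toAffine.negY x₁ y₁) := by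
      simp only [vcY]; ring
    rw [hd', div_eq_iff (mul_ne_zero (pow_ne_zero _ hu) hd)]
    have : ((C.u⁻¹ : Fˣ) : F) * ((3 * x₁ ^ 2 + 2 * W.toAffine.a₂ * x₁ + W.toAffine.a₄ -
        W.toAffine.a₁ * y₁) / (y₁ - W.toAffine.negY x₁ y₁) - C.s) *
        (((C.u⁻¹ : Fˣ) : F) ^ 3 * (y₁ - W.toAffine.negY x₁ y₁)) =
        ((C.u⁻¹ : Fˣ) : F) ^ 4 * ((3 * x₁ ^ 2 + 2 * W.toAffine.a₂ * x₁ + W.toAffine.a₄ -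
        W.toAffine.a₁ * y₁) - C.s * (y₁ - W.toAffine.negY x₁ y₁)) := by
      field_simp
    rw [this]
    simp only [negY, vcX, vcY, variableChange_a₁, variableChange_a₂, variableChange_a₄]
    ring
  · have hx' : vcX C x₁ ≠ vcX C x₂ := fun h' => hx (vcX_injective h')
    rw [slope_of_X_ne hx, slope_of_X_ne hx']
    have hd : x₁ - x₂ ≠ 0 := sub_ne_zero.2 hx
    have hd' : vcX C x₁ - vcX C x₂ = ((C.u⁻¹ : Fˣ) : F) ^ 2 * (x₁ - x₂) := by
      simp only [vcX]; ring
    rw [hd', div_eq_iff (mul_ne_zero (pow_ne_zero _ hu) hd)]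
    have : ((C.u⁻¹ : Fˣ) : F) * ((y₁ - y₂) / (x₁ - x₂) - C.s) *
        (((C.u⁻¹ : Fˣ) : F) ^ 2 * (x₁ - x₂)) =
        ((C.u⁻¹ : Fˣ) : F) ^ 3 * ((y₁ - y₂) - C.s * (x₁ - x₂)) := by
      field_simp
    rw [this]
    simp only [vcY]
    ring

variable [W.IsElliptic]

omit [DecidableEq F] in
theorem vc_nonsingular {x y : F} (h : W.toAffine.Nonsingular x y) :
    (C • W).toAffine.Nonsingular (vcX C x) (vcY C x y) := by
  rw [← equation_iff_nonsingular] at h ⊢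
  exact vc_equation C W h

/-- The homomorphism of point groups induced by a change of variables. -/
def vcHom : W.toAffine.Point →+ (C • W).toAffine.Point where
  toFun
    | .zero => .zero
    | .some _ _ h => .some _ _ (vc_nonsingular C W h)
  map_zero' := rfl
  map_add' := by
    rintro (_ | ⟨x₁, y₁, h₁⟩) (_ | ⟨x₂, y₂, h₂⟩)
    any_goals rfl
    by_cases h : x₁ = x₂ ∧ y₁ = W.toAffine.negY x₂ y₂
    · rw [Point.add_of_Y_eq h.1 h.2]
      symm
      apply Point.add_of_Y_eq
      · rw [h.1]
      · rw [h.1, h.2, vc_negY]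
    · have h' : ¬(vcX C x₁ = vcX C x₂ ∧
          vcY C x₁ y₁ = (C • W).toAffine.negY (vcX C x₂) (vcY C x₂ y₂)) := by
        rintro ⟨hx, hy⟩
        have := vcX_injective hx
        subst this
        rw [vc_negY] at hy
        exact h ⟨rfl, vcY_injective hy⟩
      rw [Point.add_some h]
      refine Eq.trans ?_ (Point.add_some h' (h₁ := vc_nonsingular C W h₁)
        (h₂ := vc_nonsingular C W h₂)).symm
      have hs := vc_slope C W h₁.1 h₂.1 h
      have hX : vcX C (W.toAffine.addX x₁ x₂ (W.toAffine.slope x₁ x₂ y₁ y₂)) =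
          (C • W).toAffine.addX (vcX C x₁) (vcX C x₂)
            ((C • W).toAffine.slope (vcX C x₁) (vcX C x₂) (vcY C x₁ y₁) (vcY C x₂ y₂)) := by
        rw [hs]
        simp only [addX, vcX, variableChange_a₁, variableChange_a₂]
        ring
      simp only [Point.some.injEq]
      refine ⟨hX, ?_⟩
      rw [addY, addY, negAddY, negAddY, ← hX, ← vc_negY, hs]
      congr 1
      simp only [vcX, vcY]
      ring

theorem vcHom_some {x y : F} (h : W.toAffine.Nonsingular x y) :
    vcHom C W (.some x y h) = .some _ _ (vc_nonsingular C W h) := rfl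

theorem vcHom_injective : Function.Injective (vcHom C W) := by
  rw [injective_iff_map_eq_zero]
  rintro (_ | ⟨x, y, h⟩) hP
  · rfl
  · rw [vcHom_some] at hP
    exact absurd hP (Point.some_ne_zero _)

end VariableChange

/-! ### Short Weierstrass curves -/

section Short

open WeierstrassCurve WeierstrassCurve.Affine

variable {F : Type*} [Field F]

/-- The curve `y² = x³ + a x + b`. -/
abbrev short {R : Type*} [CommRing R] (a b : R) : WeierstrassCurve R := ⟨0, 0, 0, a, b⟩

/-- The discriminant `4 a³ + 27 b²`. -/
def disc {R : Type*} [CommRing R] (a b : R) : R := 4 * a ^ 3 + 27 * b ^ 2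

theorem short_c₄ {R : Type*} [CommRing R] (a b : R) : (short a b).c₄ = -48 * a := by
  simp [WeierstrassCurve.c₄, b₂, b₄]; ring

theorem short_c₆ {R : Type*} [CommRing R] (a b : R) : (short a b).c₆ = -864 * b := by
  simp [WeierstrassCurve.c₆, b₂, b₄, b₆]; ring

theorem short_Δ {R : Type*} [CommRing R] (a b : R) : (short a b).Δ = -16 * disc a b := by
  simp [WeierstrassCurve.Δ, b₂, b₄, b₆, b₈, disc]; ring

theorem short_equation {a b x y : F} :
    (short a b).toAffine.Equation x y ↔ y ^ 2 = x ^ 3 + a * x + b := by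
  rw [equation_iff]; simp

theorem short_negY {a b x y : F} : (short a b).toAffine.negY x y = -y := by
  simp [negY]

theorem short_isElliptic {a b : F} (h2 : (2 : F) ≠ 0) (h : disc a b ≠ 0) :
    (short a b).IsElliptic := by
  rw [isElliptic_iff, short_Δ, isUnit_iff_ne_zero]
  refine mul_ne_zero ?_ h
  have : (-16 : F) = -2 ^ 4 := by norm_num
  rw [this]
  exact neg_ne_zero.2 (pow_ne_zero _ h2)

/-- `ℓ` is the slope of the line through `(x₁, y₁)` and `(x₂, y₂)` on `y² = x³ + a x + b`, in a
form that covers chords and tangents. -/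
structure IsSlope (a x₁ y₁ x₂ y₂ ℓ : F) : Prop where
  chord : (x₁ - x₂) * ℓ = y₁ - y₂
  tangent : (y₁ + y₂) * ℓ = x₁ ^ 2 + x₁ * x₂ + x₂ ^ 2 + a
  ne : ¬(x₁ = x₂ ∧ y₁ = -y₂)

variable [DecidableEq F]

/-- The two equations of `IsSlope` have no denominators and hold for chords and tangents alike, so
they can be reduced modulo the maximal ideal and their orders can be compared without cases. -/
theorem short_add {a b x₁ y₁ x₂ y₂ : F} (h₁ : (short a b).toAffine.Nonsingular x₁ y₁)
    (h₂ : (short a b).toAffine.Nonsingular x₂ y₂) (hne : ¬(x₁ = x₂ ∧ y₁ = -y₂)) :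
    ∃ ℓ, IsSlope a x₁ y₁ x₂ y₂ ℓ ∧
      ∃ h₃ : (short a b).toAffine.Nonsingular (ℓ ^ 2 - x₁ - x₂)
        (-(ℓ * (ℓ ^ 2 - x₁ - x₂ - x₁) + y₁)),
        Point.some _ _ h₁ + Point.some _ _ h₂ = Point.some _ _ h₃ := by
  have hne' : ¬(x₁ = x₂ ∧ y₁ = (short a b).toAffine.negY x₂ y₂) := by rwa [short_negY]
  have e₁ := short_equation.1 h₁.1
  have e₂ := short_equation.1 h₂.1
  refine ⟨(short a b).toAffine.slope x₁ x₂ y₁ y₂, ?_, ?_⟩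
  · by_cases hx : x₁ = x₂
    · subst hx
      have hy : y₁ ≠ (short a b).toAffine.negY x₁ y₂ := fun h' => hne' ⟨rfl, h'⟩
      have hyy : y₁ = y₂ := Y_eq_of_Y_ne h₁.1 h₂.1 rfl hy
      subst hyy
      rw [slope_of_Y_ne rfl hy]
      have hd : y₁ - (short a b).toAffine.negY x₁ y₁ ≠ 0 := sub_ne_zero.2 hy
      refine ⟨by ring, ?_, hne⟩
      rw [short_negY, sub_neg_eq_add] at hd ⊢
      rw [mul_comm, div_mul_cancel₀ _ hd]
      ring
    · rw [slope_of_X_ne hx]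
      have hd : x₁ - x₂ ≠ 0 := sub_ne_zero.2 hx
      refine ⟨by field_simp, ?_, hne⟩
      field_simp
      linear_combination e₁ - e₂
  · have h := nonsingular_add h₁ h₂ hne'
    have hX : (short a b).toAffine.addX x₁ x₂ ((short a b).toAffine.slope x₁ x₂ y₁ y₂) =
        (short a b).toAffine.slope x₁ x₂ y₁ y₂ ^ 2 - x₁ - x₂ := by
      simp [addX]
    have hY : (short a b).toAffine.addY x₁ x₂ y₁ ((short a b).toAffine.slope x₁ x₂ y₁ y₂) =
        -((short a b).toAffine.slope x₁ x₂ y₁ y₂ *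
          ((short a b).toAffine.slope x₁ x₂ y₁ y₂ ^ 2 - x₁ - x₂ - x₁) + y₁) := by
      rw [addY, negAddY, hX, short_negY]
    refine ⟨by rwa [hX, hY] at h, ?_⟩
    rw [Point.add_some hne']
    simp only [Point.some.injEq]
    exact ⟨hX, hY⟩

theorem short_add_eq_zero {a b x₁ y₁ x₂ y₂ : F} (h₁ : (short a b).toAffine.Nonsingular x₁ y₁)
    (h₂ : (short a b).toAffine.Nonsingular x₂ y₂) (h : x₁ = x₂ ∧ y₁ = -y₂) :
    Point.some _ _ h₁ + Point.some _ _ h₂ = 0 :=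
  Point.add_of_Y_eq h.1 (by rw [short_negY]; exact h.2)

end Short

/-! ### The group of points with nonsingular reduction on `y² = x³ + a x + b`, for `a, b ∈ m` -/

section Local

open WeierstrassCurve WeierstrassCurve.Affine

variable {K : Type*} [Field K] {O : ValuationSubring K} [IsDiscreteValuationRing O]

/-- When x is not in m, the term x³ dominates because a and b lie in m; hence 2 ord y = 3 ord x. -/
theorem exists_ord_of_equation {a b x y : K} (ha : OrdGe O 1 a) (hb : OrdGe O 1 b)
    (h : y ^ 2 = x ^ 3 + a * x + b) (hx : ¬ OrdGe O 1 x) :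
    ∃ k : ℤ, 0 ≤ k ∧ OrdEq O (-2 * k) x ∧ OrdEq O (-3 * k) y := by
  obtain ⟨j, hj, hxj⟩ := exists_ordEq_of_not_ge hx
  have h1 : OrdEq O (3 * j) (y ^ 2) := by
    rw [h, add_assoc]
    refine (hxj.pow 3).add_ge (OrdGe.add (ha.mul_of_le hxj.ge ?_) (hb.mono ?_)) <;>
    · push_cast; omega
  obtain ⟨m, hm, hym⟩ := h1.of_sq
  exact ⟨j - m, by omega, hxj.congr (by omega), hym.congr (by omega)⟩

theorem ordGe_y {a b x y : K} (ha : OrdGe O 1 a) (hb : OrdGe O 1 b)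
    (h : y ^ 2 = x ^ 3 + a * x + b) (hx : OrdGe O 1 x) : OrdGe O 1 y := by
  refine OrdGe.of_pow (k := 2) (n := 1) (by norm_num) ?_ (by norm_num)
  rw [h]
  exact ((hx.pow_of_le (by norm_num)).add (ha.mul_of_le hx (by norm_num))).add hb

/-- In the chart z = x/y, w = 1/y the points with x ∉ m are integral, and the line y = ℓx + c
becomes ℓz + cw = 1. That c dominates ℓ means that the reduced line misses the cusp of y² = x³. -/
theorem ord_line_of_slope (h2 : OrdEq O 0 (2 : K)) {a b x₁ y₁ x₂ y₂ ℓ : K} (ha : OrdGe O 1 a)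
    (hb : OrdGe O 1 b)
    (e₁ : y₁ ^ 2 = x₁ ^ 3 + a * x₁ + b) (e₂ : y₂ ^ 2 = x₂ ^ 3 + a * x₂ + b)
    (hx₁ : ¬ OrdGe O 1 x₁) (hx₂ : ¬ OrdGe O 1 x₂) (hℓ : IsSlope a x₁ y₁ x₂ y₂ ℓ) :
    ∃ k : ℤ, k ≤ 0 ∧ OrdEq O k (y₁ - ℓ * x₁) ∧ OrdGe O k ℓ := by
  obtain ⟨k₁, hk₁, hX₁, hY₁⟩ := exists_ord_of_equation ha hb e₁ hx₁
  obtain ⟨k₂, hk₂, hX₂, hY₂⟩ := exists_ord_of_equation ha hb e₂ hx₂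
  have hy₁ := hY₁.ne_zero
  have hy₂ := hY₂.ne_zero
  obtain ⟨z₁, hz₁⟩ : ∃ z, z = x₁ / y₁ := ⟨_, rfl⟩
  obtain ⟨z₂, hz₂⟩ : ∃ z, z = x₂ / y₂ := ⟨_, rfl⟩
  obtain ⟨w₁, hw₁⟩ : ∃ w, w = 1 / y₁ := ⟨_, rfl⟩
  obtain ⟨w₂, hw₂⟩ : ∃ w, w = 1 / y₂ := ⟨_, rfl⟩
  have oz₁ : OrdGe O 0 z₁ := hz₁ ▸ (hX₁.div hY₁).ge.mono (by omega)
  have oz₂ : OrdGe O 0 z₂ := hz₂ ▸ (hX₂.div hY₂).ge.mono (by omega)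
  have ow₁ : OrdGe O 0 w₁ := hw₁ ▸ (ordEq_one.div hY₁).ge.mono (by omega)
  have ow₂ : OrdGe O 0 w₂ := hw₂ ▸ (ordEq_one.div hY₂).ge.mono (by omega)
  by_cases hx : x₁ = x₂
  · subst hx
    have hyy : y₁ = y₂ := by linear_combination -hℓ.chord
    subst hyy
    have ht := hℓ.tangent
    set c := y₁ - ℓ * x₁ with hc
    -- `2 c / y` is a unit
    have hcy : 2 * c = y₁ * (-1 + (2 * a * (z₁ * w₁) + 3 * b * w₁ ^ 2)) := by
      rw [hz₁, hw₁, hc]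
      field_simp
      linear_combination (-x₁) * ht + 3 * e₁
    have h3 : OrdGe O 0 (3 : K) := by
      have : (3 : K) = 2 + 1 := by norm_num
      rw [this]; exact h2.ge.add ordEq_one.ge
    have hu : OrdEq O 0 (-1 + (2 * a * (z₁ * w₁) + 3 * b * w₁ ^ 2)) := by
      refine ordEq_one.neg.add_ge (OrdGe.add ?_ ?_)
      · exact (h2.ge.mul ha).mul_of_le (oz₁.mul ow₁) (by norm_num)
      · exact (h3.mul hb).mul_of_le (ow₁.pow 2) (by norm_num)
    have hc' : OrdEq O (-3 * k₁) c := by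
      have : OrdEq O (-3 * k₁) (2 * c) := by
        rw [hcy]; exact (hY₁.mul hu).congr (by omega)
      exact (OrdEq.of_mul_left h2 this).congr (by omega)
    refine ⟨-3 * k₁, by omega, hc', ?_⟩
    have hl : 2 * ℓ = y₁ * (3 * z₁ ^ 2 + a * w₁ ^ 2) := by
      rw [hz₁, hw₁]
      field_simp
      linear_combination ht
    have : OrdGe O (-3 * k₁) (2 * ℓ) := by
      rw [hl]
      refine hY₁.ge.mul_of_le (n := 0) (OrdGe.add ?_ ?_) (by omega)
      · exact h3.mul_of_le (oz₁.pow 2) (by norm_num)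
      · exact ha.mul_of_le (ow₁.pow 2) (by norm_num)
    exact (OrdGe.of_mul_left h2 this).mono (by omega)
  · set c := y₁ - ℓ * x₁ with hc
    have hc₂ : c = y₂ - ℓ * x₂ := by rw [hc]; linear_combination -hℓ.chord
    -- Subtracting the equations w = z³ + azw² + bw³ of the two points gives d(w₁ - w₂) = n(z₁ -
    -- z₂). As d is a unit, the slope in the (z, w) chart is integral.
    obtain ⟨d, hd⟩ : ∃ d, d = 1 - (a * (z₁ * (w₁ + w₂)) + b * (w₁ ^ 2 + w₁ * w₂ + w₂ ^ 2)) :=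
      ⟨_, rfl⟩
    obtain ⟨n, hn⟩ : ∃ n, n = z₁ ^ 2 + z₁ * z₂ + z₂ ^ 2 + a * w₂ ^ 2 := ⟨_, rfl⟩
    have od : OrdEq O 0 d := by
      rw [hd, sub_eq_add_neg]
      refine ordEq_one.add_ge (OrdGe.neg (OrdGe.add ?_ ?_))
      · exact ha.mul_of_le (n := 0) (oz₁.mul_of_le (ow₁.add ow₂) (by norm_num)) (by norm_num)
      · refine hb.mul_of_le (n := 0) (OrdGe.add (OrdGe.add ?_ ?_) ?_) (by norm_num)
        · exact ow₁.pow_of_le (by norm_num)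
        · exact ow₁.mul_of_le ow₂ (by norm_num)
        · exact ow₂.pow_of_le (by norm_num)
    have on : OrdGe O 0 n := by
      rw [hn]
      refine OrdGe.add (OrdGe.add (OrdGe.add ?_ ?_) ?_) ?_
      · exact oz₁.pow_of_le (by norm_num)
      · exact oz₁.mul_of_le oz₂ (by norm_num)
      · exact oz₂.pow_of_le (by norm_num)
      · exact ha.mul_of_le (ow₂.pow 2) (by norm_num)
    have f₁ : w₁ = z₁ ^ 3 + a * z₁ * w₁ ^ 2 + b * w₁ ^ 3 := by
      rw [hz₁, hw₁]; field_simp; linear_combination e₁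
    have f₂ : w₂ = z₂ ^ 3 + a * z₂ * w₂ ^ 2 + b * w₂ ^ 3 := by
      rw [hz₂, hw₂]; field_simp; linear_combination e₂
    have hdn : d * (w₁ - w₂) = n * (z₁ - z₂) := by
      rw [hd, hn]; linear_combination f₁ - f₂
    have g₁ : 1 = ℓ * z₁ + c * w₁ := by
      rw [hz₁, hw₁, hc]; field_simp; ring
    have g₂ : 1 = ℓ * z₂ + c * w₂ := by
      rw [hz₂, hw₂, hc₂]; field_simp; ring
    have hzz : z₁ - z₂ ≠ 0 := by
      intro h0
      rw [h0, mul_zero] at hdn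
      have hw : w₁ - w₂ = 0 := (mul_eq_zero.1 hdn).resolve_left od.ne_zero
      apply hx
      have i₁ : x₁ = z₁ * y₁ := by rw [hz₁]; field_simp
      have i₂ : x₂ = z₂ * y₂ := by rw [hz₂]; field_simp
      have i₃ : y₁ = y₂ := by
        rw [hw₁, hw₂] at hw
        field_simp at hw
        linear_combination -hw
      rw [i₁, i₂, i₃, sub_eq_zero.1 h0]
    have hdl : d * ℓ = -(c * n) := by
      apply mul_right_cancel₀ hzz
      linear_combination d * (g₂ - g₁) - c * hdn
    have hdc : d = c * (d * w₁ - n * z₁) := by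
      linear_combination d * g₁ + z₁ * hdl
    have hc0 : c ≠ 0 := by
      rintro h0
      rw [h0, zero_mul] at hdc
      exact od.ne_zero hdc
    obtain ⟨k, hk⟩ := exists_ordEq (O := O) hc0
    refine ⟨k, ?_, hk, ?_⟩
    · have : OrdGe O k d := by
        rw [hdc]
        refine hk.ge.mul_of_le (n := 0) (OrdGe.sub ?_ ?_) (by omega)
        · exact od.ge.mul_of_le ow₁ (by norm_num)
        · exact on.mul_of_le oz₁ (by norm_num)
      exact od.le_of_ge this
    · have : OrdGe O k (d * ℓ) := by
        rw [hdl]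
        exact (hk.ge.mul_of_le on (by omega)).neg
      exact (OrdGe.of_mul_left od this).mono (by omega)

/-- On `y² = x³ + a x + b` with `a, b ∈ m`, the points with `x ∉ m` are closed under addition, and
`x / y` is additive modulo `m`. -/
theorem nonsingular_add_of_slope (h2 : OrdEq O 0 (2 : K)) {a b x₁ y₁ x₂ y₂ ℓ x₃ y₃ : K}
    (ha : OrdGe O 1 a) (hb : OrdGe O 1 b)
    (e₁ : y₁ ^ 2 = x₁ ^ 3 + a * x₁ + b) (e₂ : y₂ ^ 2 = x₂ ^ 3 + a * x₂ + b)
    (hx₁ : ¬ OrdGe O 1 x₁) (hx₂ : ¬ OrdGe O 1 x₂) (hℓ : IsSlope a x₁ y₁ x₂ y₂ ℓ)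
    (hx₃ : x₃ = ℓ ^ 2 - x₁ - x₂) (hy₃ : y₃ = -(ℓ * (x₃ - x₁) + y₁)) :
    ¬ OrdGe O 1 x₃ ∧ OrdGe O 1 (x₃ / y₃ - x₁ / y₁ - x₂ / y₂) := by
  obtain ⟨k, hk, hc, hl⟩ := ord_line_of_slope h2 ha hb e₁ e₂ hx₁ hx₂ hℓ
  obtain ⟨k₁, hk₁, hX₁, hY₁⟩ := exists_ord_of_equation ha hb e₁ hx₁
  obtain ⟨k₂, hk₂, hX₂, hY₂⟩ := exists_ord_of_equation ha hb e₂ hx₂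
  have hy₁ := hY₁.ne_zero
  have hy₂ := hY₂.ne_zero
  have h3 : OrdGe O 0 (3 : K) := by
    have : (3 : K) = 2 + 1 := by norm_num
    rw [this]; exact h2.ge.add ordEq_one.ge
  obtain ⟨c, hcdef⟩ : ∃ c, c = y₁ - ℓ * x₁ := ⟨_, rfl⟩
  rw [← hcdef] at hc
  have i₁ : y₁ = ℓ * x₁ + c := by rw [hcdef]; ring
  have i₂ : y₂ = ℓ * x₂ + c := by rw [hcdef]; linear_combination hℓ.chord
  obtain ⟨t, ht⟩ : ∃ t, t = ℓ * x₃ + c := ⟨_, rfl⟩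
  have i₃ : y₃ = -t := by rw [hy₃, ht, hcdef]; ring
  -- Vieta
  have v2 : x₁ * x₂ + (x₁ + x₂) * x₃ = a - 2 * ℓ * c := by
    have := hℓ.tangent
    rw [i₁, i₂] at this
    rw [hx₃]
    linear_combination this
  have v3 : x₁ * x₂ * x₃ = c ^ 2 - b := by
    have e := e₁
    rw [i₁] at e
    rw [hx₃] at v2 ⊢
    linear_combination -e + x₁ * v2
  have v1 : x₁ + x₂ + x₃ = ℓ ^ 2 := by rw [hx₃]; ring
  -- The product of the three values ℓxᵢ + c has leading term c³, which fixes its order.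
  have hprod : y₁ * y₂ * t = c ^ 3 + (a * (ℓ ^ 2 * c) - b * ℓ ^ 3) := by
    rw [i₁, i₂, ht]
    linear_combination ℓ ^ 3 * v3 + ℓ ^ 2 * c * v2 + ℓ * c ^ 2 * v1
  have hP : OrdEq O (3 * k) (y₁ * y₂ * t) := by
    rw [hprod]
    refine (hc.pow 3).add_ge (OrdGe.sub ?_ ?_)
    · exact ha.mul_of_le ((hl.pow 2).mul hc.ge) (by push_cast; omega)
    · exact hb.mul_of_le (hl.pow 3) (by push_cast; omega)
  have ht0 : t ≠ 0 := fun h => hP.ne_zero (by rw [h, mul_zero])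
  -- By Vieta the terms ℓ²c² of the numerator cancel (3 - 4 + 1 = 0). What is left is a combination
  -- of a and b, so the z-coordinates of three collinear points sum to zero modulo m.
  have hsum : x₁ / y₁ + x₂ / y₂ + x₃ / t = (2 * a * (ℓ * c) - 3 * b * ℓ ^ 2) / (y₁ * y₂ * t) := by
    have : x₁ / y₁ + x₂ / y₂ + x₃ / t =
        (x₁ * y₂ * t + x₂ * y₁ * t + x₃ * y₁ * y₂) / (y₁ * y₂ * t) := by
      field_simp
    rw [this]
    congr 1
    rw [i₁, i₂, ht]
    linear_combination 3 * ℓ ^ 2 * v3 + 2 * ℓ * c * v2 + c ^ 2 * v1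
  have osum : OrdGe O 1 (x₁ / y₁ + x₂ / y₂ + x₃ / t) := by
    rw [hsum]
    refine OrdGe.div_of_le (m := 1 + 2 * k) (OrdGe.sub ?_ ?_) hP (by omega)
    · exact (h2.ge.mul ha).mul_of_le (hl.mul hc.ge) (by omega)
    · exact (h3.mul hb).mul_of_le (hl.pow 2) (by push_cast; omega)
  have oz₁ : OrdGe O 0 (x₁ / y₁) := (hX₁.div hY₁).ge.mono (by omega)
  have oz₂ : OrdGe O 0 (x₂ / y₂) := (hX₂.div hY₂).ge.mono (by omega)
  have oz₃ : OrdGe O 0 (x₃ / t) := by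
    have : x₃ / t = (x₁ / y₁ + x₂ / y₂ + x₃ / t) - x₁ / y₁ - x₂ / y₂ := by ring
    rw [this]
    exact ((osum.mono (by norm_num)).sub oz₁).sub oz₂
  have ow₃ : OrdGe O 0 (1 / t) := by
    have : 1 / t = (1 - ℓ * (x₃ / t)) / c := by
      have := hc.ne_zero
      field_simp
      rw [ht]; ring
    rw [this]
    refine OrdGe.div_of_le (m := k) (OrdGe.sub (ordEq_one.ge.mono hk) ?_) hc (by omega)
    exact hl.mul_of_le oz₃ (by omega)
  constructor
  · intro hx
    have e₃ : t ^ 2 = x₃ ^ 3 + a * x₃ + b := by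
      rw [ht]
      linear_combination (-x₃ ^ 2) * v1 + x₃ * v2 - v3
    have := (ordGe_y ha hb e₃ hx).mul ow₃
    rw [mul_one_div_cancel ht0] at this
    exact ordEq_one.not_ge (by norm_num) this
  · have : x₃ / y₃ - x₁ / y₁ - x₂ / y₂ = -(x₁ / y₁ + x₂ / y₂ + x₃ / t) := by
      rw [i₃, div_neg]; ring
    rw [this]
    exact osum.neg

variable [DecidableEq K]

variable (O) in
/-- The points of `y² = x³ + a x + b` whose `x`-coordinate is not in the maximal ideal. -/
def IsRegular {a b : K} : (short a b).toAffine.Point → Prop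
  | .zero => True
  | .some x _ _ => ¬ OrdGe O 1 x

/-- The function `x / y` on points. -/
def zCoord {a b : K} : (short a b).toAffine.Point → K
  | .zero => 0
  | .some x y _ => x / y

theorem IsRegular.add (h2 : OrdEq O 0 (2 : K)) {a b : K} (ha : OrdGe O 1 a) (hb : OrdGe O 1 b)
    {P Q : (short a b).toAffine.Point} (hP : IsRegular O P) (hQ : IsRegular O Q) :
    IsRegular O (P + Q) ∧ OrdGe O 1 (zCoord (P + Q) - zCoord P - zCoord Q) := by
  rcases P with _ | ⟨x₁, y₁, h₁⟩
  · rw [← Point.zero_def, zero_add]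
    exact ⟨hQ, by simpa [zCoord] using ordGe_zero_right _⟩
  rcases Q with _ | ⟨x₂, y₂, h₂⟩
  · rw [← Point.zero_def, add_zero]
    exact ⟨hP, by simpa [zCoord] using ordGe_zero_right _⟩
  by_cases h : x₁ = x₂ ∧ y₁ = -y₂
  · rw [short_add_eq_zero h₁ h₂ h]
    refine ⟨trivial, ?_⟩
    have : zCoord (0 : (short a b).toAffine.Point) - x₁ / y₁ - x₂ / y₂ = 0 := by
      change 0 - x₁ / y₁ - x₂ / y₂ = 0
      rw [h.1, h.2, div_neg]; ring
    exact this ▸ ordGe_zero_right _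
  · obtain ⟨ℓ, hℓ, h₃, e⟩ := short_add h₁ h₂ h
    rw [e]
    exact nonsingular_add_of_slope h2 ha hb (short_equation.1 h₁.1) (short_equation.1 h₂.1) hP hQ
      hℓ rfl rfl

theorem IsRegular.nsmul (h2 : OrdEq O 0 (2 : K)) {a b : K} (ha : OrdGe O 1 a) (hb : OrdGe O 1 b)
    {P : (short a b).toAffine.Point} (hP : IsRegular O P) (n : ℕ) :
    IsRegular O (n • P) ∧ OrdGe O 1 (zCoord (n • P) - n * zCoord P) := by
  induction n with
  | zero =>
    rw [zero_nsmul]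
    refine ⟨trivial, ?_⟩
    have : zCoord (0 : (short a b).toAffine.Point) - (0 : ℕ) * zCoord P = 0 := by
      change 0 - _ = _
      simp
    exact this ▸ ordGe_zero_right _
  | succ n ih =>
    rw [succ_nsmul]
    have h := ih.1.add h2 ha hb hP
    refine ⟨h.1, ?_⟩
    have : zCoord (n • P + P) - ((n + 1 : ℕ) : K) * zCoord P =
        (zCoord (n • P + P) - zCoord (n • P) - zCoord P) + (zCoord (n • P) - n * zCoord P) := by
      push_cast; ring
    rw [this]
    exact h.2.add ih.2

/-- A homomorphism of point groups attached to a change of variables `C • W = W'`. -/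
theorem exists_pointHom {F : Type*} [Field F] [DecidableEq F] {W W' : WeierstrassCurve F}
    [W.IsElliptic] (C : VariableChange F) (h : C • W = W') :
    ∃ φ : W.toAffine.Point →+ W'.toAffine.Point, Function.Injective φ ∧
      ∀ x y hxy, ∃ hxy', φ (.some x y hxy) = .some (vcX C x) (vcY C x y) hxy' := by
  subst h
  exact ⟨vcHom C W, vcHom_injective C W, fun x y hxy => ⟨_, vcHom_some C W hxy⟩⟩

theorem smul_short {F : Type*} [Field F] (u : Fˣ) (a b : F) :
    (⟨u⁻¹, 0, 0, 0⟩ : VariableChange F) • short a b = short ((u : F) ^ 4 * a) ((u : F) ^ 6 * b) := by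
  ext <;> simp [variableChange_def]

/-- Scaling of coordinates. -/
theorem exists_scaleHom {F : Type*} [Field F] [DecidableEq F] {a b : F} (h2 : (2 : F) ≠ 0)
    (hd : disc a b ≠ 0) {u : F} (hu : u ≠ 0) :
    ∃ φ : (short a b).toAffine.Point →+ (short (u ^ 4 * a) (u ^ 6 * b)).toAffine.Point,
      Function.Injective φ ∧
      ∀ x y hxy, ∃ hxy', φ (.some x y hxy) = .some (u ^ 2 * x) (u ^ 3 * y) hxy' := by
  have := short_isElliptic h2 hd
  obtain ⟨φ, hφ, h⟩ := exists_pointHom _ (smul_short (Units.mk0 u hu) a b)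
  simp only [Units.val_mk0] at φ h
  refine ⟨φ, hφ, fun x y hxy => ?_⟩
  obtain ⟨hxy', h'⟩ := h x y hxy
  have hX : vcX (⟨(Units.mk0 u hu)⁻¹, 0, 0, 0⟩ : VariableChange F) x = u ^ 2 * x := by simp [vcX]
  have hY : vcY (⟨(Units.mk0 u hu)⁻¹, 0, 0, 0⟩ : VariableChange F) x y = u ^ 3 * y := by simp [vcY]
  rw [hX, hY] at hxy'
  refine ⟨hxy', h'.trans ?_⟩
  simp only [Point.some.injEq]
  exact ⟨hX, hY⟩

theorem disc_scale {R : Type*} [CommRing R] (u a b : R) :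
    disc (u ^ 4 * a) (u ^ 6 * b) = u ^ 12 * disc a b := by
  simp only [disc]; ring

theorem zCoord_of_torsion (h2 : OrdEq O 0 (2 : K)) {N : ℕ} (hN : OrdEq O 0 (N : K)) {a b : K}
    (ha : OrdGe O 1 a) (hb : OrdGe O 1 b)
    {P : (short a b).toAffine.Point} (hP : IsRegular O P) (hNP : N • P = 0) :
    OrdGe O 1 (zCoord P) := by
  have h := (hP.nsmul h2 ha hb N).2
  rw [hNP] at h
  have h' : OrdGe O 1 ((N : K) * zCoord P) := by
    have : (N : K) * zCoord P = -(zCoord (0 : (short a b).toAffine.Point) - N * zCoord P) := by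
      change _ = -(0 - _)
      ring
    exact this ▸ h.neg
  exact (OrdGe.of_mul_left hN h').mono (by norm_num)

/-- Scaling replaces the filtration of the formal group. Since z = x/y lies in m, the point (π²x,
π³y) on the curve with coefficients π⁴a, π⁶b is again regular and torsion, and its z-coordinate is
z/π; so each turn gains one order. -/
theorem zCoord_of_torsion_pow (h2 : OrdEq O 0 (2 : K)) {N : ℕ} (hN : OrdEq O 0 (N : K)) (n : ℕ) :
    ∀ {a b : K}, disc a b ≠ 0 → OrdGe O 1 a → OrdGe O 1 b →
      ∀ {P : (short a b).toAffine.Point}, IsRegular O P → N • P = 0 → OrdGe O (n + 1) (zCoord P) := by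
  induction n with
  | zero =>
    intro a b hd ha hb P hP hNP
    simpa using zCoord_of_torsion h2 hN ha hb hP hNP
  | succ n ih =>
    intro a b hd ha hb P hP hNP
    rcases P with _ | ⟨x, y, h⟩
    · exact ordGe_zero_right _
    have hz := zCoord_of_torsion h2 hN ha hb hP hNP
    obtain ⟨k, hk, hx, hy⟩ := exists_ord_of_equation ha hb (short_equation.1 h.1) hP
    have hk1 : 1 ≤ k := by
      have := (hx.div hy).le_of_ge hz
      omega
    obtain ⟨π, hπ⟩ := exists_uniformizer O
    obtain ⟨φ, -, hφ⟩ := exists_scaleHom h2.ne_zero hd hπ.ne_zero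
    obtain ⟨h', e⟩ := hφ x y h
    have := ih (by rw [disc_scale]; exact mul_ne_zero (pow_ne_zero _ hπ.ne_zero) hd)
      ((hπ.pow 4).ge.mul_of_le ha (by norm_num)) ((hπ.pow 6).ge.mul_of_le hb (by norm_num))
      (P := φ (.some x y h)) (by
        rw [e]
        exact ((hπ.pow 2).mul hx).not_ge (by push_cast; omega))
      (by rw [← map_nsmul, hNP, map_zero])
    rw [e] at this
    change OrdGe O _ (π ^ 2 * x / (π ^ 3 * y)) at this
    have e' : zCoord (Point.some x y h) = π * (π ^ 2 * x / (π ^ 3 * y)) := by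
      have := hπ.ne_zero
      have := hy.ne_zero
      change x / y = _
      field_simp
    rw [e']
    exact hπ.ge.mul_of_le this (by push_cast; omega)

/-- On `y² = x³ + a x + b` with `a, b ∈ m` there is no torsion of order prime to the residue
characteristic among the points of nonsingular reduction. -/
theorem eq_zero_of_torsion (h2 : OrdEq O 0 (2 : K)) {N : ℕ} (hN : OrdEq O 0 (N : K)) {a b : K}
    (hd : disc a b ≠ 0) (ha : OrdGe O 1 a) (hb : OrdGe O 1 b)
    {P : (short a b).toAffine.Point} (hP : IsRegular O P) (hNP : N • P = 0) : P = 0 := by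
  rcases P with _ | ⟨x, y, h⟩
  · rfl
  exfalso
  obtain ⟨k, hk, hx, hy⟩ := exists_ord_of_equation ha hb (short_equation.1 h.1) hP
  have : x / y = 0 := OrdGe.eq_zero (O := O) fun n =>
    (zCoord_of_torsion_pow h2 hN n hd ha hb hP hNP).mono (by omega)
  exact (div_ne_zero hx.ne_zero hy.ne_zero) this

/-- On an integral curve `y² = x³ + a x + b`, torsion of order prime to the residue
characteristic is integral. -/
theorem integral_of_torsion (h2 : OrdEq O 0 (2 : K)) {N : ℕ} (hN : OrdEq O 0 (N : K)) {a b : K}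
    (hd : disc a b ≠ 0) (ha : OrdGe O 0 a) (hb : OrdGe O 0 b) {x y : K}
    {h : (short a b).toAffine.Nonsingular x y} (hNP : N • Point.some x y h = 0) :
    OrdGe O 0 x ∧ OrdGe O 0 y := by
  have e := short_equation.1 h.1
  have hx : OrdGe O 0 x := by
    by_contra hx
    obtain ⟨j, hj, hxj⟩ := exists_ordEq_of_not_ge hx
    have h1 : OrdEq O (3 * j) (y ^ 2) := by
      rw [e, add_assoc]
      refine (hxj.pow 3).add_ge (OrdGe.add (ha.mul_of_le hxj.ge ?_) (hb.mono ?_)) <;>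
      · push_cast; omega
    obtain ⟨m, hm, hym⟩ := h1.of_sq
    -- From 3j = 2m the order j is even, so j ≤ -2 and π²x is still outside m. After scaling by π
    -- the coefficients lie in m, so `eq_zero_of_torsion` applies.
    obtain ⟨π, hπ⟩ := exists_uniformizer O
    obtain ⟨φ, hφi, hφ⟩ := exists_scaleHom h2.ne_zero hd hπ.ne_zero
    obtain ⟨h', e'⟩ := hφ x y h
    have := eq_zero_of_torsion h2 hN
      (by rw [disc_scale]; exact mul_ne_zero (pow_ne_zero _ hπ.ne_zero) hd)
      ((hπ.pow 4).ge.mul_of_le ha (by norm_num)) ((hπ.pow 6).ge.mul_of_le hb (by norm_num))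
      (P := φ (.some x y h)) (by
        rw [e']
        exact ((hπ.pow 2).mul hxj).not_ge (by push_cast; omega))
      (by rw [← map_nsmul, hNP, map_zero])
    rw [e'] at this
    exact Point.some_ne_zero _ this
  refine ⟨hx, OrdGe.of_pow (k := 2) (n := 0) (by norm_num) ?_ (by norm_num)⟩
  rw [e]
  exact ((hx.pow_of_le (by norm_num)).add (ha.mul_of_le hx (by norm_num))).add hb

end Local

/-! ### Good reduction of torsion -/

section Slope

open WeierstrassCurve WeierstrassCurve.Affine

variable {F : Type*} [Field F]

theorem IsSlope.unique {a x₁ y₁ x₂ y₂ ℓ ℓ' : F} (h : IsSlope a x₁ y₁ x₂ y₂ ℓ)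
    (h' : IsSlope a x₁ y₁ x₂ y₂ ℓ') : ℓ = ℓ' := by
  by_contra hne
  have hne := sub_ne_zero.2 hne
  refine h.ne ⟨?_, ?_⟩
  · have : (x₁ - x₂) * (ℓ - ℓ') = 0 := by linear_combination h.chord - h'.chord
    exact sub_eq_zero.1 ((mul_eq_zero.1 this).resolve_right hne)
  · have : (y₁ + y₂) * (ℓ - ℓ') = 0 := by linear_combination h.tangent - h'.tangent
    exact eq_neg_of_add_eq_zero_left ((mul_eq_zero.1 this).resolve_right hne)

/-- The discriminant lies in the ideal generated by the values at x of the cubic and of its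
derivative. Over the residue field this excludes singular points; the exact powers are used for
orders at type I₀*. -/
theorem disc_eq_of_singular {R : Type*} [CommRing R] (a b x : R) :
    disc a b = 4 * (3 * x ^ 2 + a) ^ 3 - 9 * x ^ 2 * (3 * x ^ 2 + a) ^ 2 +
      27 * (x ^ 3 + a * x + b) ^ 2 + 108 * x ^ 3 * (x ^ 3 + a * x + b) -
      54 * x * (x ^ 3 + a * x + b) * (3 * x ^ 2 + a) := by
  simp only [disc]; ring

theorem map_disc {R S : Type*} [CommRing R] [CommRing S] (f : R →+* S) (a b : R) :
    f (disc a b) = disc (f a) (f b) := by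
  simp only [disc, map_add, map_mul, map_pow, map_ofNat]

end Slope

section GoodReduction

open WeierstrassCurve WeierstrassCurve.Affine IsLocalRing

variable {K : Type*} [Field K] {O : ValuationSubring K} [IsDiscreteValuationRing O]

omit [IsDiscreteValuationRing O] in
theorem short_residue_nonsingular {A B : O} (hD : IsUnit (disc A B))
    (h2 : IsUnit (2 : O)) {x y : O} (h : y ^ 2 = x ^ 3 + A * x + B) :
    (short (residue O A) (residue O B)).toAffine.Nonsingular (residue O x) (residue O y) := by
  have : (short (residue O A) (residue O B)).IsElliptic := by
    apply short_isElliptic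
    · have := (h2.map (residue O)).ne_zero
      rwa [map_ofNat] at this
    · have := (hD.map (residue O)).ne_zero
      rwa [map_disc] at this
  rw [← equation_iff_nonsingular, short_equation]
  simp only [← map_pow, ← map_mul, ← map_add, h]

open Classical in
/-- The reduction of integral points (and zero for other points). -/
def redPoint {A B : O} (hD : IsUnit (disc A B)) (h2 : IsUnit (2 : O)) :
    (short (A : K) (B : K)).toAffine.Point →
      (short (residue O A) (residue O B)).toAffine.Point
  | .zero => .zero
  | .some x y h => if hi : x ∈ O ∧ y ∈ O then
      .some (residue O ⟨x, hi.1⟩) (residue O ⟨y, hi.2⟩) (short_residue_nonsingular hD h2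
        (Subtype.ext (short_equation.1 h.1))) else .zero

omit [IsDiscreteValuationRing O] in
theorem redPoint_some {A B : O} (hD : IsUnit (disc A B)) (h2 : IsUnit (2 : O)) {x y : O} 
    (h : (short (A : K) (B : K)).toAffine.Nonsingular x y) :
    redPoint hD h2 (.some _ _ h) = .some (residue O x) (residue O y) (short_residue_nonsingular hD h2
        (Subtype.ext (short_equation.1 h.1))) := by
  rw [redPoint, dif_pos ⟨x.2, y.2⟩]

variable [DecidableEq K]

/-- The order of a torsion subgroup of order prime to the residue characteristic divides the number
of points of the reduction. -/
theorem card_dvd_of_good {A B : O} (hD : IsUnit (disc A B)) (h2 : IsUnit (2 : O))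
    (T : AddSubgroup (short (A : K) (B : K)).toAffine.Point) {N : ℕ} (hN : OrdEq O 0 (N : K))
    (hT : ∀ P ∈ T, N • P = 0) :
    Nat.card T ∣ Nat.card (short (residue O A) (residue O B)).toAffine.Point := by
  classical
  have h2' : OrdEq O 0 (2 : K) := (isUnit_iff_ordEq (2 : O)).1 h2
  have hd : disc (A : K) (B : K) ≠ 0 := by
    have := hD.ne_zero
    contrapose! this
    exact Subtype.ext ((map_disc O.subtype A B).trans this)
  have hA : OrdGe O 0 (A : K) := ordGe_zero_iff.2 A.2
  have hB : OrdGe O 0 (B : K) := ordGe_zero_iff.2 B.2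
  have hint : ∀ {x y h}, Point.some x y h ∈ T → ∃ x' y' : O, x = x' ∧ y = y' := by
    intro x y h hP
    have := integral_of_torsion h2' hN hd hA hB (hT _ hP)
    exact ⟨⟨x, ordGe_zero_iff.1 this.1⟩, ⟨y, ordGe_zero_iff.1 this.2⟩, rfl, rfl⟩
  -- Since the sum is again torsion, its abscissa is integral, and ℓ² = x₁ + x₂ + x₃ makes the slope
  -- integral. Hence the addition formulas reduce modulo the maximal ideal.
  have hslope : ∀ {x₁ y₁ x₂ y₂ : O} {h₁ : (short (A : K) (B : K)).toAffine.Nonsingular x₁ y₁}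
      {h₂ : (short (A : K) (B : K)).toAffine.Nonsingular x₂ y₂},
      Point.some _ _ h₁ ∈ T → Point.some _ _ h₂ ∈ T → ¬((x₁ : K) = x₂ ∧ (y₁ : K) = -y₂) →
      ∃ ℓ x₃ y₃ : O, (x₁ - x₂) * ℓ = y₁ - y₂ ∧
        (y₁ + y₂) * ℓ = x₁ ^ 2 + x₁ * x₂ + x₂ ^ 2 + A ∧ x₃ = ℓ ^ 2 - x₁ - x₂ ∧
        y₃ = -(ℓ * (x₃ - x₁) + y₁) ∧
        ∃ h₃, Point.some _ _ h₁ + Point.some _ _ h₂ = Point.some (x₃ : K) (y₃ : K) h₃ := by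
    intro x₁ y₁ x₂ y₂ h₁ h₂ hP hQ hne
    obtain ⟨ℓ, hℓ, h₃, e⟩ := short_add h₁ h₂ hne
    have hmem := T.add_mem hP hQ
    rw [e] at hmem
    obtain ⟨x', y', hx', hy'⟩ := hint hmem
    have hℓO : OrdGe O 0 ℓ := by
      refine OrdGe.of_pow (k := 2) (n := 0) (by norm_num) ?_ (by norm_num)
      have : ℓ ^ 2 = x' + x₁ + x₂ := by rw [← hx']; ring
      rw [this, ordGe_zero_iff]
      exact (x' + x₁ + x₂).2
    refine ⟨⟨ℓ, ordGe_zero_iff.1 hℓO⟩, x', y', Subtype.ext hℓ.chord, Subtype.ext hℓ.tangent,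
      Subtype.ext hx'.symm, Subtype.ext ?_, ?_⟩
    · push_cast
      rw [← hy', ← hx']
    · rw [e]
      exact ⟨by rwa [← hx', ← hy'], by simp only [Point.some.injEq]; exact ⟨hx', hy'⟩⟩
  -- If the reductions are opposite but the points are not, the chord and tangent equations reduce
  -- to 2y = 0 and 3x² + A = 0, a singular point of the reduction.
  have hzero : ∀ {x₁ y₁ x₂ y₂ : O} {h₁ : (short (A : K) (B : K)).toAffine.Nonsingular x₁ y₁}
      {h₂ : (short (A : K) (B : K)).toAffine.Nonsingular x₂ y₂},
      Point.some _ _ h₁ ∈ T → Point.some _ _ h₂ ∈ T → residue O x₁ = residue O x₂ →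
      residue O y₁ = -residue O y₂ → (x₁ : K) = x₂ ∧ (y₁ : K) = -y₂ := by
    intro x₁ y₁ x₂ y₂ h₁ h₂ hP hQ hx hy
    by_contra hne
    obtain ⟨ℓ, x₃, y₃, hc, ht, -, -, -⟩ := hslope hP hQ hne
    have hc' := congrArg (residue O) hc
    have ht' := congrArg (residue O) ht
    have e₁ := congrArg (residue O) (Subtype.ext (short_equation.1 h₁.1) :
      y₁ ^ 2 = x₁ ^ 3 + A * x₁ + B)
    simp only [map_mul, map_sub, map_add, map_pow] at hc' ht' e₁
    rw [hx, hy] at hc' ht'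
    have hy0 : 2 * residue O y₂ = 0 := by linear_combination hc'
    have h20 : (2 : ResidueField O) ≠ 0 := by
      have := (h2.map (residue O)).ne_zero
      rwa [map_ofNat] at this
    have hy0 := (mul_eq_zero.1 hy0).resolve_left h20
    have hD0 := (hD.map (residue O)).ne_zero
    apply hD0
    have : residue O (disc A B) = disc (residue O A) (residue O B) := map_disc _ _ _
    rw [this, disc_eq_of_singular _ _ (residue O x₂)]
    have i₁ : 3 * residue O x₂ ^ 2 + residue O A = 0 := by linear_combination -ht'
    have i₂ : residue O x₂ ^ 3 + residue O A * residue O x₂ + residue O B = 0 := by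
      rw [← hx, ← e₁, hy, hy0]; ring
    rw [i₁, i₂]; ring
  let φ : T →+ (short (residue O A) (residue O B)).toAffine.Point :=
    { toFun := fun P => redPoint hD h2 P
      map_zero' := rfl
      map_add' := by
        rintro ⟨P, hP⟩ ⟨Q, hQ⟩
        change redPoint hD h2 (P + Q) = redPoint hD h2 P + redPoint hD h2 Q
        rcases P with _ | ⟨x₁, y₁, h₁⟩
        · rw [← Point.zero_def, zero_add]
          exact (zero_add _).symm
        rcases Q with _ | ⟨x₂, y₂, h₂⟩
        · rw [← Point.zero_def, add_zero]
          exact (add_zero _).symm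
        obtain ⟨x₁, y₁, rfl, rfl⟩ := hint hP
        obtain ⟨x₂, y₂, rfl, rfl⟩ := hint hQ
        rw [redPoint_some, redPoint_some]
        by_cases hne : residue O x₁ = residue O x₂ ∧ residue O y₁ = -residue O y₂
        · rw [short_add_eq_zero _ _ (hzero hP hQ hne.1 hne.2), short_add_eq_zero _ _ hne]
          rfl
        · have hne' : ¬((x₁ : K) = x₂ ∧ (y₁ : K) = -y₂) := by
            rintro ⟨hx, hy⟩
            have hx : x₁ = x₂ := Subtype.ext hx
            have hy : y₁ = -y₂ := Subtype.ext hy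
            exact hne ⟨by rw [hx], by rw [hy, map_neg]⟩
          obtain ⟨ℓ, x₃, y₃, hc, ht, hx₃, hy₃, h₃, e⟩ := hslope hP hQ hne'
          rw [e, redPoint_some]
          obtain ⟨ℓ', hℓ', h₃', e'⟩ := short_add (short_residue_nonsingular hD h2
            (Subtype.ext (short_equation.1 h₁.1))) (short_residue_nonsingular hD h2
            (Subtype.ext (short_equation.1 h₂.1))) hne
          rw [e']
          have hℓℓ : ℓ' = residue O ℓ := by
            refine hℓ'.unique ⟨?_, ?_, hne⟩
            · simpa using congrArg (residue O) hc
            · simpa using congrArg (residue O) ht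
          subst hℓℓ
          simp only [Point.some.injEq]
          rw [hy₃, hx₃]
          constructor <;> simp }
  -- Injectivity is immediate: nonzero torsion points are integral, and integral points do not
  -- reduce to infinity.
  refine AddSubgroup.card_dvd_of_injective φ ?_
  rw [injective_iff_map_eq_zero]
  rintro ⟨P, hP⟩ h0
  change redPoint hD h2 P = 0 at h0
  rcases P with _ | ⟨x₁, y₁, h₁⟩
  · rfl
  · obtain ⟨x₁, y₁, rfl, rfl⟩ := hint hP
    rw [redPoint_some] at h0
    exact absurd h0 (Point.some_ne_zero _)

end GoodReduction

/-! ### Torsion at places of additive reduction -/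

section Additive

open WeierstrassCurve WeierstrassCurve.Affine IsLocalRing

variable {K : Type*} [Field K] {O : ValuationSubring K} [IsDiscreteValuationRing O]

variable (O) in
/-- The conditions on `(a, b)` under which `y² = x³ + a x + b` has Kodaira symbol `Iₙ*`. -/
structure IsStarPair (a b : K) : Prop where
  ord_a : OrdGe O 2 a
  ord_b : OrdGe O 3 b
  min : ¬(OrdGe O 3 a ∧ OrdGe O 4 b)

/-- On a product lying in `m ^ (m + n - 1)`, one of the factors is small. -/
theorem ordGe_or_of_mul {x y : K} {m n l : ℤ} (h : OrdGe O l (x * y)) (hl : m + n - 1 ≤ l) :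
    OrdGe O m x ∨ OrdGe O n y := by
  by_contra! h'
  obtain ⟨i, hi, hx⟩ := exists_ordEq_of_not_ge h'.1
  obtain ⟨j, hj, hy⟩ := exists_ordEq_of_not_ge h'.2
  have := (hx.mul hy).le_of_ge h
  omega

theorem sq_sub_ordGe {h : ℤ} {x y : K} (H : OrdGe O (2 * h + 1) (x ^ 2 - y ^ 2)) :
    OrdGe O (h + 1) (x - y) ∨ OrdGe O (h + 1) (x + y) := by
  have : x ^ 2 - y ^ 2 = (x - y) * (x + y) := by ring
  rw [this] at H
  exact ordGe_or_of_mul H (by omega)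

theorem OrdEq.sub_of_add (h2 : OrdEq O 0 (2 : K)) {h : ℤ} {x y : K} (hx : OrdEq O h x)
    (hs : OrdGe O (h + 1) (x + y)) : OrdEq O h (x - y) := by
  have : x - y = 2 * x + -(x + y) := by ring
  rw [this]
  exact (h2.unit_mul hx).add_ge hs.neg

theorem OrdEq.add_of_sub (h2 : OrdEq O 0 (2 : K)) {h : ℤ} {x y : K} (hx : OrdEq O h x)
    (hs : OrdGe O (h + 1) (x - y)) : OrdEq O h (x + y) := by
  have : x + y = 2 * x + -(x - y) := by ring
  rw [this]
  exact (h2.unit_mul hx).add_ge hs.neg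

theorem not_odd_sq {n : ℤ} {y : K} (h : OrdEq O n (y ^ 2)) (hn : n % 2 = 1) : False := by
  obtain ⟨k, hk, -⟩ := h.of_sq
  omega

variable [DecidableEq K]

/-- A torsion subgroup `T` of order prime to the residue characteristic of `y² = x³ + a x + b`,
with `a, b` in the maximal ideal. -/
structure AddTorsion (O : ValuationSubring K) [IsDiscreteValuationRing O] {a b : K}
    (T : AddSubgroup (short a b).toAffine.Point) : Prop where
  two : OrdEq O 0 (2 : K)
  three : OrdEq O 0 (3 : K)
  ord_a : OrdGe O 1 a
  ord_b : OrdGe O 1 b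
  disc_ne : disc a b ≠ 0
  regular : ∀ P ∈ T, IsRegular O P → P = 0

theorem AddTorsion.mk' {a b : K} (T : AddSubgroup (short a b).toAffine.Point)
    (h2 : OrdEq O 0 (2 : K)) (h3 : OrdEq O 0 (3 : K)) (ha : OrdGe O 1 a) (hb : OrdGe O 1 b)
    (hd : disc a b ≠ 0) {N : ℕ} (hN : OrdEq O 0 (N : K)) (hT : ∀ P ∈ T, N • P = 0) :
    AddTorsion O T :=
  ⟨h2, h3, ha, hb, hd, fun P hP hr => eq_zero_of_torsion h2 hN hd ha hb hr (hT P hP)⟩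

namespace AddTorsion

variable {a b : K} {T : AddSubgroup (short a b).toAffine.Point} (hT : AddTorsion O T)

include hT

theorem ordGe_x {x y : K} {h} (hP : Point.some x y h ∈ T) : OrdGe O 1 x := by
  by_contra hx
  exact Point.some_ne_zero _ (hT.regular _ hP hx)

theorem ordGe_y {x y : K} {h} (hP : Point.some x y h ∈ T) : OrdGe O 1 y :=
  EllTwist.ordGe_y hT.ord_a hT.ord_b (short_equation.1 h.1) (hT.ordGe_x hP)

/-- All nonzero points of T have abscissa in m, so ℓ² = x₁ + x₂ + x₃ lies in m. This is the main use
of the group law; in most cases below, a point P + Q is shown to be zero because otherwise the chord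
or tangent equation would need a slope outside m. -/
theorem slope {x₁ y₁ x₂ y₂ : K} {h₁ h₂} (hP : Point.some x₁ y₁ h₁ ∈ T)
    (hQ : Point.some x₂ y₂ h₂ ∈ T) (hne : Point.some x₁ y₁ h₁ + Point.some x₂ y₂ h₂ ≠ 0) :
    ∃ ℓ, IsSlope a x₁ y₁ x₂ y₂ ℓ ∧ OrdGe O 1 ℓ := by
  have hne' : ¬(x₁ = x₂ ∧ y₁ = -y₂) := fun h => hne (short_add_eq_zero h₁ h₂ h)
  obtain ⟨ℓ, hℓ, h₃, e⟩ := short_add h₁ h₂ hne'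
  have hmem := T.add_mem hP hQ
  rw [e] at hmem
  have hx := hT.ordGe_x hmem
  refine ⟨ℓ, hℓ, OrdGe.of_pow (k := 2) (n := 1) (by norm_num) ?_ (by norm_num)⟩
  have : ℓ ^ 2 = (ℓ ^ 2 - x₁ - x₂) + x₁ + x₂ := by ring
  rw [this]
  exact (hx.add (hT.ordGe_x hP)).add (hT.ordGe_x hQ)

theorem add_eq_zero_of_tangent {x₁ y₁ x₂ y₂ : K} {h₁ h₂} (hP : Point.some x₁ y₁ h₁ ∈ T)
    (hQ : Point.some x₂ y₂ h₂ ∈ T) {n : ℤ}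
    (hn : OrdEq O n (x₁ ^ 2 + x₁ * x₂ + x₂ ^ 2 + a)) (hy : OrdGe O n (y₁ + y₂)) :
    Point.some x₁ y₁ h₁ + Point.some x₂ y₂ h₂ = 0 := by
  by_contra hne
  obtain ⟨ℓ, hℓ, hl⟩ := hT.slope hP hQ hne
  rw [← hℓ.tangent] at hn
  exact hn.not_ge (by omega) (hy.mul hl)

theorem add_eq_zero_of_chord {x₁ y₁ x₂ y₂ : K} {h₁ h₂} (hP : Point.some x₁ y₁ h₁ ∈ T)
    (hQ : Point.some x₂ y₂ h₂ ∈ T) {n : ℤ} (hn : OrdEq O n (y₁ - y₂)) (hx : OrdGe O n (x₁ - x₂)) :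
    Point.some x₁ y₁ h₁ + Point.some x₂ y₂ h₂ = 0 := by
  by_contra hne
  obtain ⟨ℓ, hℓ, hl⟩ := hT.slope hP hQ hne
  rw [← hℓ.chord] at hn
  exact hn.not_ge (by omega) (hx.mul hl)

omit hT in
theorem neg_mem {x y : K} {h} (hP : Point.some x y h ∈ T) :
    ∃ h', -Point.some x y h = Point.some x (-y) h' ∧ Point.some x (-y) h' ∈ T := by
  have e := Point.neg_some h
  have hy : (short a b).toAffine.negY x y = -y := short_negY
  have h' := (nonsingular_neg x y).2 h
  rw [hy] at h'
  have e' : -Point.some x y h = Point.some x (-y) h' := by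
    rw [e]
    simp only [Point.some.injEq, true_and]
    exact hy
  exact ⟨h', e', e' ▸ T.neg_mem hP⟩

/-- Points whose `x`-coordinates are close are equal. -/
theorem eq_of_tangent {x₁ y₁ x₂ y₂ : K} {h₁ h₂} (hP : Point.some x₁ y₁ h₁ ∈ T)
    (hQ : Point.some x₂ y₂ h₂ ∈ T) {n : ℤ}
    (hn : OrdEq O n (x₁ ^ 2 + x₁ * x₂ + x₂ ^ 2 + a)) (hy₁ : OrdGe O n y₁) (hy₂ : OrdGe O n y₂) :
    Point.some x₁ y₁ h₁ = Point.some x₂ y₂ h₂ := by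
  obtain ⟨h', e', hm⟩ := neg_mem hQ
  have := hT.add_eq_zero_of_tangent hP hm hn (hy₁.add hy₂.neg)
  rwa [← e', ← sub_eq_add_neg, sub_eq_zero] at this

/-- One of y₁ - y₂ and y₁ + y₂ is small because their product is. The other then has exact order n,
being 2y₁ up to the small one, and the chord equation forces a sum or difference of the points to
vanish. -/
theorem eq_or_neg_of_chord {x₁ y₁ x₂ y₂ : K} {h₁ h₂} (hP : Point.some x₁ y₁ h₁ ∈ T)
    (hQ : Point.some x₂ y₂ h₂ ∈ T) {n : ℤ} (hy₁ : OrdEq O n y₁)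
    (hyy : OrdGe O (2 * n + 1) (y₁ ^ 2 - y₂ ^ 2)) (hx : OrdGe O n (x₁ - x₂)) :
    Point.some x₁ y₁ h₁ = Point.some x₂ y₂ h₂ ∨ Point.some x₁ y₁ h₁ = -Point.some x₂ y₂ h₂ := by
  rcases sq_sub_ordGe hyy with h | h
  · left
    obtain ⟨h', e', hm⟩ := neg_mem hQ
    have := hT.add_eq_zero_of_chord hP hm (n := n)
      (by rw [sub_neg_eq_add]; exact OrdEq.add_of_sub hT.two hy₁ h) hx
    rwa [← e', ← sub_eq_add_neg, sub_eq_zero] at this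
  · right
    have := hT.add_eq_zero_of_chord hP hQ (OrdEq.sub_of_add hT.two hy₁ h) hx
    exact eq_neg_of_add_eq_zero_left this

/-- Type III has component group of order two. The coefficient a dominates the tangent expression
x₁² + x₁x₂ + x₂² + a, while y₁ + y₂ already lies in m. -/
theorem add_eq_zero_of_III (ha : OrdEq O 1 a) {P Q} (hP : P ∈ T) (hQ : Q ∈ T) (hP0 : P ≠ 0)
    (hQ0 : Q ≠ 0) : P + Q = 0 := by
  rcases P with _ | ⟨x₁, y₁, h₁⟩
  · exact absurd rfl hP0
  rcases Q with _ | ⟨x₂, y₂, h₂⟩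
  · exact absurd rfl hQ0
  have o₁ := hT.ordGe_x hP
  have o₂ := hT.ordGe_x hQ
  refine hT.add_eq_zero_of_tangent hP hQ (n := 1) ?_ ((hT.ordGe_y hP).add (hT.ordGe_y hQ))
  rw [add_comm]
  exact ha.add_ge (((o₁.pow_of_le (by norm_num)).add (o₁.mul_of_le o₂ (by norm_num))).add
    (o₂.pow_of_le (by norm_num)))

/-- An abscissa of order one would make y² of odd order three. -/
theorem ordGe_two_x (ha : OrdGe O 3 a) (hb : OrdGe O 4 b) {x y : K} {h}
    (hP : Point.some x y h ∈ T) : OrdGe O 2 x := by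
  refine (hT.ordGe_x hP).eq_or.resolve_left fun hx => ?_
  have e := short_equation.1 h.1
  refine not_odd_sq (O := O) (n := 3) (y := y) ?_ (by norm_num)
  rw [e, add_assoc]
  exact (hx.pow 3).add_ge ((ha.mul_of_le hx.ge (by norm_num)).add hb)

theorem add_eq_zero_of_IIIstar (ha : OrdEq O 3 a) (hb : OrdGe O 5 b) {P Q} (hP : P ∈ T)
    (hQ : Q ∈ T) (hP0 : P ≠ 0) (hQ0 : Q ≠ 0) : P + Q = 0 := by
  rcases P with _ | ⟨x₁, y₁, h₁⟩
  · exact absurd rfl hP0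
  rcases Q with _ | ⟨x₂, y₂, h₂⟩
  · exact absurd rfl hQ0
  have o₁ := hT.ordGe_two_x ha.ge (hb.mono (by norm_num)) hP
  have o₂ := hT.ordGe_two_x ha.ge (hb.mono (by norm_num)) hQ
  have hy : ∀ {x y : K} {h}, Point.some x y h ∈ T → OrdGe O 3 y := by
    intro x y h hP
    have o := hT.ordGe_two_x ha.ge (hb.mono (by norm_num)) hP
    refine OrdGe.of_pow (k := 2) (n := 5) (by norm_num) ?_ (by norm_num)
    rw [short_equation.1 h.1]
    exact ((o.pow_of_le (by norm_num)).add (ha.ge.mul_of_le o (by norm_num))).add hb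
  refine hT.add_eq_zero_of_tangent hP hQ (n := 3) ?_ ((hy hP).add (hy hQ))
  rw [add_comm]
  exact ha.add_ge (((o₁.pow_of_le (by norm_num)).add (o₁.mul_of_le o₂ (by norm_num))).add
    (o₂.pow_of_le (by norm_num)))

theorem ordEq_y_of_IV (ha : OrdGe O 2 a) (hb : OrdEq O 2 b) {x y : K} {h}
    (hP : Point.some x y h ∈ T) : OrdEq O 1 y := by
  have o := hT.ordGe_x hP
  have : OrdEq O 2 (y ^ 2) := by
    rw [short_equation.1 h.1, add_comm]
    exact hb.add_ge ((o.pow_of_le (by norm_num)).add (ha.mul_of_le o (by norm_num)))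
  obtain ⟨k, hk, hy⟩ := this.of_sq
  exact hy.congr (by omega)

theorem ordEq_y_of_IVstar (ha : OrdGe O 3 a) (hb : OrdEq O 4 b) {x y : K} {h}
    (hP : Point.some x y h ∈ T) : OrdEq O 2 y := by
  have o := hT.ordGe_two_x ha hb.ge hP
  have : OrdEq O 4 (y ^ 2) := by
    rw [short_equation.1 h.1, add_comm]
    exact hb.add_ge ((o.pow_of_le (by norm_num)).add (ha.mul_of_le o (by norm_num)))
  obtain ⟨k, hk, hy⟩ := this.of_sq
  exact hy.congr (by omega)

/-- Type IV has component group of order three. Here y² is b up to higher order, so y is determined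
up to sign to first order. -/
theorem eq_or_neg_of_IV (ha : OrdGe O 2 a) (hb : OrdEq O 2 b) {P Q} (hP : P ∈ T)
    (hQ : Q ∈ T) (hP0 : P ≠ 0) (hQ0 : Q ≠ 0) : P = Q ∨ P = -Q := by
  rcases P with _ | ⟨x₁, y₁, h₁⟩
  · exact absurd rfl hP0
  rcases Q with _ | ⟨x₂, y₂, h₂⟩
  · exact absurd rfl hQ0
  have o₁ := hT.ordGe_x hP
  have o₂ := hT.ordGe_x hQ
  refine hT.eq_or_neg_of_chord hP hQ (hT.ordEq_y_of_IV ha hb hP) ?_ (o₁.sub o₂)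
  have : y₁ ^ 2 - y₂ ^ 2 = x₁ ^ 3 - x₂ ^ 3 + a * (x₁ - x₂) := by
    rw [short_equation.1 h₁.1, short_equation.1 h₂.1]; ring
  rw [this]
  exact ((o₁.pow_of_le (by norm_num)).sub (o₂.pow_of_le (by norm_num))).add
    (ha.mul_of_le (o₁.sub o₂) (by norm_num))

theorem eq_or_neg_of_IVstar (ha : OrdGe O 3 a) (hb : OrdEq O 4 b) {P Q} (hP : P ∈ T)
    (hQ : Q ∈ T) (hP0 : P ≠ 0) (hQ0 : Q ≠ 0) : P = Q ∨ P = -Q := by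
  rcases P with _ | ⟨x₁, y₁, h₁⟩
  · exact absurd rfl hP0
  rcases Q with _ | ⟨x₂, y₂, h₂⟩
  · exact absurd rfl hQ0
  have o₁ := hT.ordGe_two_x ha hb.ge hP
  have o₂ := hT.ordGe_two_x ha hb.ge hQ
  refine hT.eq_or_neg_of_chord hP hQ (hT.ordEq_y_of_IVstar ha hb hP) ?_ (o₁.sub o₂)
  have : y₁ ^ 2 - y₂ ^ 2 = x₁ ^ 3 - x₂ ^ 3 + a * (x₁ - x₂) := by
    rw [short_equation.1 h₁.1, short_equation.1 h₂.1]; ring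
  rw [this]
  exact ((o₁.pow_of_le (by norm_num)).sub (o₂.pow_of_le (by norm_num))).add
    (ha.mul_of_le (o₁.sub o₂) (by norm_num))

/-! #### The case `Iₙ*` -/

theorem ordGe_y_of_star (hs : IsStarPair O a b) {x y : K} {h} (hP : Point.some x y h ∈ T) :
    OrdGe O 2 y := by
  have o := hT.ordGe_x hP
  refine OrdGe.of_pow (k := 2) (n := 3) (by norm_num) ?_ (by norm_num)
  rw [short_equation.1 h.1]
  exact ((o.pow_of_le (by norm_num)).add (hs.ord_a.mul_of_le o (by norm_num))).add hs.ord_b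

/-- For I₀* the cubic in x/π is separable modulo π, and x/π is a root there because y² has order at
least 4 > 3. So the derivative does not vanish; quantitatively, order at least 3 for 3x² + a would
give the discriminant order at least 7. -/
theorem tangent_unit_of_star (hs : IsStarPair O a b) (hd : OrdEq O 6 (disc a b)) {x y : K} {h}
    (hP : Point.some x y h ∈ T) : OrdEq O 2 (3 * x ^ 2 + a) := by
  have o := hT.ordGe_x hP
  have oy := hT.ordGe_y_of_star hs hP
  have h0 : OrdGe O 2 (3 * x ^ 2 + a) :=
    (hT.three.unit_mul_ge (o.pow_of_le (by norm_num))).add hs.ord_a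
  refine h0.eq_or.resolve_right fun h3 => ?_
  have og : OrdGe O 4 (x ^ 3 + a * x + b) := by
    rw [← short_equation.1 h.1]
    exact oy.pow_of_le (by norm_num)
  refine hd.not_ge (m := 7) (by norm_num) ?_
  rw [disc_eq_of_singular a b x]
  have n : ∀ m : ℕ, OrdGe O 0 (m : K) := fun m => ordGe_zero_iff.2 (natCast_mem O m)
  have n4 := n 4
  have n9 := n 9
  have n27 := n 27
  have n54 := n 54
  have n108 := n 108
  push_cast at n4 n9 n27 n54 n108
  refine OrdGe.sub (OrdGe.add (OrdGe.add (OrdGe.sub ?_ ?_) ?_) ?_) ?_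
  · exact n4.mul_of_le (h3.pow 3) (by norm_num)
  · exact (n9.mul (o.pow 2)).mul_of_le (h3.pow 2) (by norm_num)
  · exact n27.mul_of_le (og.pow 2) (by norm_num)
  · exact (n108.mul (o.pow 3)).mul_of_le og (by norm_num)
  · exact ((n54.mul o).mul og).mul_of_le h3 (by norm_num)

theorem eq_of_star_close (hs : IsStarPair O a b) (hd : OrdEq O 6 (disc a b)) {x₁ y₁ x₂ y₂ : K}
    {h₁ h₂} (hP : Point.some x₁ y₁ h₁ ∈ T) (hQ : Point.some x₂ y₂ h₂ ∈ T)
    (hx : OrdGe O 2 (x₁ - x₂)) : Point.some x₁ y₁ h₁ = Point.some x₂ y₂ h₂ := by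
  refine hT.eq_of_tangent hP hQ (n := 2) ?_ (hT.ordGe_y_of_star hs hP) (hT.ordGe_y_of_star hs hQ)
  have : x₁ ^ 2 + x₁ * x₂ + x₂ ^ 2 + a = 3 * x₁ ^ 2 + a + -((x₁ - x₂) * (2 * x₁ + x₂)) := by ring
  rw [this]
  refine (hT.tangent_unit_of_star hs hd hP).add_ge (OrdGe.neg (hx.mul_of_le (n := 1) ?_
    (by norm_num)))
  exact (hT.two.unit_mul_ge (hT.ordGe_x hP)).add (hT.ordGe_x hQ)

/-- The values x/π reduce to roots of a cubic, and points with the same root coincide, so there are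
at most three nonzero points. The proof repeats, by divided differences, the argument that a cubic
has no four roots. -/
theorem not_distinct_of_Izero_star (hs : IsStarPair O a b) (hd : OrdEq O 6 (disc a b))
    {P Q R S} (hP : P ∈ T) (hQ : Q ∈ T) (hR : R ∈ T) (hS : S ∈ T) (hP0 : P ≠ 0) (hQ0 : Q ≠ 0)
    (hR0 : R ≠ 0) (hS0 : S ≠ 0) : P = Q ∨ P = R ∨ P = S ∨ Q = R ∨ Q = S ∨ R = S := by
  rcases P with _ | ⟨x₁, y₁, h₁⟩
  · exact absurd rfl hP0
  rcases Q with _ | ⟨x₂, y₂, h₂⟩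
  · exact absurd rfl hQ0
  rcases R with _ | ⟨x₃, y₃, h₃⟩
  · exact absurd rfl hR0
  rcases S with _ | ⟨x₄, y₄, h₄⟩
  · exact absurd rfl hS0
  by_contra! hne
  obtain ⟨n12, n13, n14, n23, n24, n34⟩ := hne
  have key : ∀ {x₁ y₁ x₂ y₂ : K} {h₁ h₂} (hP : Point.some x₁ y₁ h₁ ∈ T)
      (hQ : Point.some x₂ y₂ h₂ ∈ T), Point.some x₁ y₁ h₁ ≠ Point.some x₂ y₂ h₂ →
      OrdEq O 1 (x₁ - x₂) ∧ OrdGe O 3 (x₁ ^ 2 + x₁ * x₂ + x₂ ^ 2 + a) := by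
    intro x₁ y₁ x₂ y₂ h₁ h₂ hP hQ hne
    have o := (hT.ordGe_x hP).sub (hT.ordGe_x hQ)
    have o' := o.eq_or.resolve_right fun h => hne (hT.eq_of_star_close hs hd hP hQ h)
    refine ⟨o', ?_⟩
    have : (x₁ - x₂) * (x₁ ^ 2 + x₁ * x₂ + x₂ ^ 2 + a) = y₁ ^ 2 - y₂ ^ 2 := by
      rw [short_equation.1 h₁.1, short_equation.1 h₂.1]; ring
    have h4 : OrdGe O 4 ((x₁ - x₂) * (x₁ ^ 2 + x₁ * x₂ + x₂ ^ 2 + a)) := by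
      rw [this]
      exact ((hT.ordGe_y_of_star hs hP).pow_of_le (by norm_num)).sub
        ((hT.ordGe_y_of_star hs hQ).pow_of_le (by norm_num))
    exact (OrdGe.of_mul_left o' h4).mono (by norm_num)
  -- Three distinct roots sum to zero modulo m², so the third is determined by the other two.
  have tri : ∀ {x₁ y₁ x₂ y₂ x₃ y₃ : K} {h₁ h₂ h₃} (hP : Point.some x₁ y₁ h₁ ∈ T)
      (hQ : Point.some x₂ y₂ h₂ ∈ T) (hR : Point.some x₃ y₃ h₃ ∈ T),
      Point.some x₁ y₁ h₁ ≠ Point.some x₂ y₂ h₂ → Point.some x₁ y₁ h₁ ≠ Point.some x₃ y₃ h₃ →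
      Point.some x₂ y₂ h₂ ≠ Point.some x₃ y₃ h₃ → OrdGe O 2 (x₁ + x₂ + x₃) := by
    intro x₁ y₁ x₂ y₂ x₃ y₃ h₁ h₂ h₃ hP hQ hR n12 n13 n23
    have : OrdGe O 3 ((x₂ - x₃) * (x₁ + x₂ + x₃)) := by
      have := (key hP hQ n12).2.sub (key hP hR n13).2
      convert this using 1
      ring
    exact (OrdGe.of_mul_left (key hQ hR n23).1 this).mono (by norm_num)
  have := (tri hP hQ hR n12 n13 n23).sub (tri hP hQ hS n12 n14 n24)
  refine n34 (hT.eq_of_star_close hs hd hR hS ?_)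
  convert this using 1
  ring

end AddTorsion

end Additive

/-! ### Torsion at places of type Iₙ* with n ≥ 1 -/

section Star

open WeierstrassCurve WeierstrassCurve.Affine IsLocalRing

variable {K : Type*} [Field K] {O : ValuationSubring K} [IsDiscreteValuationRing O]

theorem IsStarPair.disc_ge {a b : K} (hs : IsStarPair O a b) : OrdGe O 6 (disc a b) := by
  have n : ∀ m : ℕ, OrdGe O 0 (m : K) := fun m => ordGe_zero_iff.2 (natCast_mem O m)
  have n4 := n 4
  have n27 := n 27
  push_cast at n4 n27
  exact (n4.mul_of_le (hs.ord_a.pow 3) (by norm_num)).add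
    (n27.mul_of_le (hs.ord_b.pow 2) (by norm_num))

theorem ordEq_natCast_pow_mul (h2 : OrdEq O 0 (2 : K)) (h3 : OrdEq O 0 (3 : K)) (i j : ℕ) :
    OrdEq O 0 ((2 : K) ^ i * 3 ^ j) :=
  ((h2.pow i).mul (h3.pow j)).congr (by simp)

/-- A discriminant of order above 6 means a multiple root of the cubic in x/π. By `min` this root is
not triple, so neither coefficient of the reduced cubic vanishes. -/
theorem IsStarPair.ordEq_of_disc (h2 : OrdEq O 0 (2 : K)) (h3 : OrdEq O 0 (3 : K)) {a b : K}
    (hs : IsStarPair O a b) (hd : OrdGe O 7 (disc a b)) : OrdEq O 2 a ∧ OrdEq O 3 b := by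
  have h4 : OrdEq O 0 (4 : K) := by
    have := ordEq_natCast_pow_mul h2 h3 2 0
    norm_num at this; exact this
  have h27 : OrdEq O 0 (27 : K) := by
    have := ordEq_natCast_pow_mul h2 h3 0 3
    norm_num at this; exact this
  have hb : OrdEq O 3 b := by
    refine hs.ord_b.eq_or.resolve_right fun hb => ?_
    refine hs.min ⟨?_, hb⟩
    refine OrdGe.of_pow (k := 3) (n := 7) (by norm_num) ?_ (by norm_num)
    refine (OrdGe.of_mul_left h4 (n := 7) ?_).mono (by norm_num)
    have : 4 * a ^ 3 = disc a b - 27 * b ^ 2 := by simp only [disc]; ring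
    rw [this]
    exact hd.sub (h27.unit_mul_ge (hb.pow_of_le (by norm_num)))
  refine ⟨hs.ord_a.eq_or.resolve_right fun ha => ?_, hb⟩
  have : 27 * b ^ 2 = disc a b - 4 * a ^ 3 := by simp only [disc]; ring
  refine (h27.unit_mul (hb.pow 2)).not_ge (m := 7) (by norm_num) ?_
  rw [this]
  exact hd.sub (h4.unit_mul_ge (ha.pow_of_le (by norm_num)))

/-- The approximate double root of `x³ + a x + b`. -/
theorem exists_node (h2 : OrdEq O 0 (2 : K)) (h3 : OrdEq O 0 (3 : K)) {a b : K} {i n : ℤ}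
    (ha : OrdEq O (2 * i) a) (hb : OrdEq O (3 * i) b) (hd : OrdEq O (n + 6 * i) (disc a b)) :
    ∃ s : K, OrdEq O i s ∧ OrdEq O (n + 2 * i) (3 * s ^ 2 + a) ∧
      OrdEq O (n + 3 * i) (s ^ 3 + a * s + b) := by
  have h4 : OrdEq O 0 (4 : K) := by
    have := ordEq_natCast_pow_mul h2 h3 2 0
    norm_num at this; exact this
  have h8 : OrdEq O 0 (8 : K) := by
    have := ordEq_natCast_pow_mul h2 h3 3 0
    norm_num at this; exact this
  have a0 := ha.ne_zero
  have e2 := h2.ne_zero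
  have e4 := h4.ne_zero
  have e8 := h8.ne_zero
  -- For a cubic with exact roots s, s, -2s one has a = -3s² and b = 2s³, hence s = -3b/(2a). In
  -- general the same expression misses by explicit multiples of the discriminant.
  refine ⟨-3 * b / (2 * a), ?_, ?_, ?_⟩
  · exact ((h3.neg.unit_mul hb).div (h2.unit_mul ha)).congr (by omega)
  · have : 3 * (-3 * b / (2 * a)) ^ 2 + a = disc a b / (4 * a ^ 2) := by
      simp only [disc]
      have : (4 : K) = 2 ^ 2 := by norm_num
      rw [this]
      field_simp
      ring
    rw [this]
    exact (hd.div (h4.unit_mul (ha.pow 2))).congr (by push_cast; omega)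
  · have : (-3 * b / (2 * a)) ^ 3 + a * (-3 * b / (2 * a)) + b = -(b * disc a b / (8 * a ^ 3)) := by
      simp only [disc]
      have : (8 : K) = 2 ^ 3 := by norm_num
      rw [this]
      field_simp
      ring
    rw [this]
    exact ((hb.mul hd).div (h8.unit_mul (ha.pow 3))).neg.congr (by push_cast; omega)

variable [DecidableEq K]

namespace AddTorsion

variable {a b : K} {T : AddSubgroup (short a b).toAffine.Point} (hT : AddTorsion O T)

include hT

/-- With u = x - s the equation reads y² = u²(u + 3s) + (3s² + a)u + (s³ + as + b). All terms except
u²(u + 3s) lie in m⁴, so u/π is congruent to 0 (double root) or to -3s/π (simple root). -/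
theorem simple_or_double (hs : IsStarPair O a b) {n : ℤ} (hn : 1 ≤ n) {s : K} (os : OrdEq O 1 s)
    (o4 : OrdEq O (n + 2) (3 * s ^ 2 + a)) (o6 : OrdEq O (n + 3) (s ^ 3 + a * s + b)) {x y : K} {h}
    (hP : Point.some x y h ∈ T) : OrdGe O 2 (x - s) ∨ OrdGe O 2 (x - s + 3 * s) := by
  have ou : OrdGe O 1 (x - s) := (hT.ordGe_x hP).sub os.ge
  have oy := hT.ordGe_y_of_star hs hP
  have : (x - s) * ((x - s) * (x - s + 3 * s)) =
      y ^ 2 - (3 * s ^ 2 + a) * (x - s) - (s ^ 3 + a * s + b) := by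
    rw [short_equation.1 h.1]; ring
  have h4 : OrdGe O 4 ((x - s) * ((x - s) * (x - s + 3 * s))) := by
    rw [this]
    refine ((oy.pow_of_le (by norm_num)).sub ?_).sub (o6.ge.mono (by omega))
    exact o4.ge.mul_of_le ou (by omega)
  rcases ou.eq_or with h1 | h2
  · right
    exact (OrdGe.of_mul_left h1 (OrdGe.of_mul_left h1 h4)).mono (by norm_num)
  · exact Or.inl h2

theorem eq_of_simple (hs : IsStarPair O a b) {n : ℤ} (hn : 1 ≤ n) {s : K} (os : OrdEq O 1 s)
    (o4 : OrdEq O (n + 2) (3 * s ^ 2 + a)) {x₁ y₁ x₂ y₂ : K} {h₁ h₂}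
    (hP : Point.some x₁ y₁ h₁ ∈ T) (hQ : Point.some x₂ y₂ h₂ ∈ T)
    (hx₁ : OrdGe O 2 (x₁ - s + 3 * s)) (hx₂ : OrdGe O 2 (x₂ - s + 3 * s)) :
    Point.some x₁ y₁ h₁ = Point.some x₂ y₂ h₂ := by
  refine hT.eq_of_tangent hP hQ (n := 2) ?_ (hT.ordGe_y_of_star hs hP) (hT.ordGe_y_of_star hs hQ)
  -- At the simple root x = -2s the tangent expression 3x² + a equals 12s² - 3s² = 9s² to leading
  -- order, which is a unit times π².
  have : x₁ ^ 2 + x₁ * x₂ + x₂ ^ 2 + a = 3 ^ 2 * s ^ 2 + ((x₁ - s + 3 * s) * (x₁ + x₂ - 2 * s) +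
      (x₂ - s + 3 * s) * (x₂ + (-2) * (2 * s)) + (3 * s ^ 2 + a)) := by ring
  rw [this]
  refine (OrdEq.congr ((hT.three.pow 2).mul (os.pow 2)) (by norm_num)).add_ge
    (((hx₁.mul_of_le (n := 1) ?_ (by norm_num)).add
      (hx₂.mul_of_le (n := 1) ?_ (by norm_num))).add (o4.ge.mono (by omega)))
  · exact ((hT.ordGe_x hP).add (hT.ordGe_x hQ)).sub (hT.two.unit_mul_ge os.ge)
  · exact (hT.ordGe_x hQ).add (hT.two.neg.unit_mul_ge (hT.two.unit_mul_ge os.ge))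

/-- At most two points lie over the double root. As in Tate's algorithm the parity of n matters. For
odd n the constant term s³ + as + b governs y², so y is fixed up to sign to leading order. For even
n it is balanced by 3su², so u = x - s is fixed up to sign to leading order. -/
theorem not_distinct_of_double {n : ℤ} (hn : 1 ≤ n) {s : K}
    (os : OrdEq O 1 s) (o4 : OrdEq O (n + 2) (3 * s ^ 2 + a))
    (o6 : OrdEq O (n + 3) (s ^ 3 + a * s + b)) {P Q R}
    (hP : P ∈ T) (hQ : Q ∈ T) (hR : R ∈ T)
    (hP2 : ∃ x y h, P = Point.some x y h ∧ OrdGe O 2 (x - s))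
    (hQ2 : ∃ x y h, Q = Point.some x y h ∧ OrdGe O 2 (x - s))
    (hR2 : ∃ x y h, R = Point.some x y h ∧ OrdGe O 2 (x - s)) :
    P = Q ∨ P = R ∨ Q = R := by
  obtain ⟨x₁, y₁, h₁, rfl, u₁⟩ := hP2
  obtain ⟨x₂, y₂, h₂, rfl, u₂⟩ := hQ2
  obtain ⟨x₃, y₃, h₃, rfl, u₃⟩ := hR2
  have eqn : ∀ {x y : K} {h}, Point.some x y h ∈ T → y ^ 2 = (x - s) ^ 2 * (3 * s + (x - s)) +
      ((3 * s ^ 2 + a) * (x - s) + (s ^ 3 + a * s + b)) := by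
    intro x y h hP
    rw [short_equation.1 h.1]; ring
  -- If u = x - s had order m < j, the term 3su² of odd order 2m + 1 ≤ n + 2 would dominate the
  -- right side, but the left side is a square.
  have hxn : ∀ {x y : K} {h}, Point.some x y h ∈ T → OrdGe O 2 (x - s) →
      ∀ j : ℤ, 2 * j ≤ n + 3 → OrdGe O j (x - s) := by
    intro x y h hP hx j hj
    by_contra hxj
    obtain ⟨m, hm, om⟩ := exists_ordEq_of_not_ge hxj
    have hm2 := om.le_of_ge hx
    refine not_odd_sq (O := O) (n := 2 * m + 1) (y := y) ?_ (by omega)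
    rw [eqn hP]
    refine OrdEq.add_ge (((om.pow 2).mul ((hT.three.unit_mul os).add_ge
      (hx.mono (by norm_num)))).congr (by push_cast; ring)) (OrdGe.add ?_ ?_)
    · exact o4.ge.mul_of_le hx (by omega)
    · exact o6.ge.mono (by omega)
  rcases Int.even_or_odd' n with ⟨k, hk | hk⟩
  · -- `n = 2 k`: the classes are distinguished by `x`
    have key : ∀ {x y : K} {h}, Point.some x y h ∈ T → OrdGe O 2 (x - s) →
        OrdEq O (k + 1) (x - s) ∧ OrdGe O (k + 2) y ∧
          OrdGe O (2 * k + 4) (3 * s * (x - s) ^ 2 + (s ^ 3 + a * s + b)) := by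
      intro x y h hP hx
      have ou := hxn hP hx (k + 1) (by omega)
      have oy : OrdGe O (k + 2) y := by
        refine OrdGe.of_pow (k := 2) (n := 2 * k + 3) (by norm_num) ?_ (by push_cast; omega)
        rw [eqn hP]
        refine OrdGe.add ?_ (OrdGe.add ?_ (o6.ge.mono (by omega)))
        · exact (ou.pow 2).mul_of_le ((hT.three.unit_mul_ge os.ge).add (hx.mono (by norm_num)))
            (by push_cast; omega)
        · exact o4.ge.mul_of_le ou (by omega)
      have o2 : OrdGe O (2 * k + 4) (3 * s * (x - s) ^ 2 + (s ^ 3 + a * s + b)) := by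
        have : 3 * s * (x - s) ^ 2 + (s ^ 3 + a * s + b) =
            y ^ 2 - (x - s) ^ 3 - (3 * s ^ 2 + a) * (x - s) := by
          rw [eqn hP]; ring
        rw [this]
        refine OrdGe.sub (OrdGe.sub ?_ ?_) ?_
        · exact oy.pow_of_le (by push_cast; omega)
        · exact ou.pow_of_le (by push_cast; omega)
        · exact o4.ge.mul_of_le ou (by omega)
      refine ⟨ou.eq_or.resolve_right fun h' => ?_, oy, o2⟩
      have : s ^ 3 + a * s + b = (3 * s * (x - s) ^ 2 + (s ^ 3 + a * s + b)) -
          3 * s * (x - s) ^ 2 := by ring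
      refine o6.not_ge (m := 2 * k + 4) (by omega) ?_
      rw [this]
      exact o2.sub ((hT.three.unit_mul_ge os.ge).mul_of_le (h'.pow 2) (by push_cast; omega))
    have close : ∀ {x y x' y' : K} {h h'}, Point.some x y h ∈ T → Point.some x' y' h' ∈ T →
        OrdGe O 2 (x - s) → OrdGe O 2 (x' - s) →
        OrdGe O (k + 2) (x - x') → Point.some x y h = Point.some x' y' h' := by
      intro x y x' y' h h' hP hP' hx hx' hxx
      obtain ⟨e, oy, -⟩ := key hP hx
      obtain ⟨e', oy', -⟩ := key hP' hx'
      refine hT.eq_of_tangent hP hP' (n := k + 2) ?_ oy oy'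
      have : x ^ 2 + x * x' + x' ^ 2 + a = 3 * s * ((x - s) + (x' - s)) + ((x - s) ^ 2 +
          (x - s) * (x' - s) + (x' - s) ^ 2 + (3 * s ^ 2 + a)) := by ring
      rw [this]
      have ed : OrdEq O (k + 1) ((x - s) + (x' - s)) :=
        OrdEq.add_of_sub hT.two e (by convert hxx using 1 <;> ring)
      refine (((hT.three.unit_mul os).mul ed).congr (by omega)).add_ge (OrdGe.add (OrdGe.add
        (OrdGe.add ?_ ?_) ?_) (o4.ge.mono (by omega)))
      · exact e.ge.pow_of_le (by push_cast; omega)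
      · exact e.ge.mul_of_le e'.ge (by omega)
      · exact e'.ge.pow_of_le (by push_cast; omega)
    have two : ∀ {x y x' y' : K} {h h'}, Point.some x y h ∈ T → Point.some x' y' h' ∈ T →
        OrdGe O 2 (x - s) → OrdGe O 2 (x' - s) → Point.some x y h ≠ Point.some x' y' h' →
        OrdGe O (k + 2) ((x - s) + (x' - s)) := by
      intro x y x' y' h h' hP hP' hx hx' hne
      have o := ((key hP hx).2.2).sub (key hP' hx').2.2
      have : 3 * s * (x - s) ^ 2 + (s ^ 3 + a * s + b) -
          (3 * s * (x' - s) ^ 2 + (s ^ 3 + a * s + b)) =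
          3 * s * ((x - s) ^ 2 - (x' - s) ^ 2) := by ring
      rw [this] at o
      have o := (OrdGe.of_mul_left (hT.three.unit_mul os) o).mono (m := 2 * (k + 1) + 1) (by omega)
      rcases sq_sub_ordGe o with o | o
      · refine absurd (close hP hP' hx hx' ?_) hne
        convert o using 1 <;> ring
      · exact o.mono (by omega)
    by_contra! hne
    have := (two hP hQ u₁ u₂ hne.1).sub (two hP hR u₁ u₃ hne.2.1)
    refine hne.2.2 (close hQ hR u₂ u₃ ?_)
    convert this using 1
    ring
  · -- `n = 2 k + 1`: the classes are distinguished by `y`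
    have key : ∀ {x y : K} {h}, Point.some x y h ∈ T → OrdGe O 2 (x - s) →
        OrdGe O (k + 2) (x - s) ∧ OrdEq O (k + 2) y ∧
          OrdGe O (2 * k + 5) (y ^ 2 - (s ^ 3 + a * s + b)) := by
      intro x y h hP hx
      have ou := hxn hP hx (k + 2) (by omega)
      have o : OrdGe O (2 * k + 5) (y ^ 2 - (s ^ 3 + a * s + b)) := by
        have : y ^ 2 - (s ^ 3 + a * s + b) = (x - s) ^ 2 * (3 * s + (x - s)) +
            (3 * s ^ 2 + a) * (x - s) := by
          rw [eqn hP]; ring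
        rw [this]
        refine OrdGe.add ?_ ?_
        · exact (ou.pow 2).mul_of_le ((hT.three.unit_mul_ge os.ge).add (hx.mono (by norm_num)))
            (by push_cast; omega)
        · exact o4.ge.mul_of_le ou (by omega)
      have : OrdEq O (n + 3) (y ^ 2) := by
        have e : y ^ 2 = (s ^ 3 + a * s + b) + (y ^ 2 - (s ^ 3 + a * s + b)) := by ring
        rw [e]
        exact o6.add_ge (o.mono (by omega))
      obtain ⟨j, hj, oy⟩ := this.of_sq
      exact ⟨ou, oy.congr (by omega), o⟩
    have two : ∀ {x y x' y' : K} {h h'}, Point.some x y h ∈ T → Point.some x' y' h' ∈ T →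
        OrdGe O 2 (x - s) → OrdGe O 2 (x' - s) →
        Point.some x y h = Point.some x' y' h' ∨ Point.some x y h = -Point.some x' y' h' := by
      intro x y x' y' h h' hP hP' hx hx'
      obtain ⟨ou, oy, o⟩ := key hP hx
      obtain ⟨ou', oy', o'⟩ := key hP' hx'
      refine hT.eq_or_neg_of_chord hP hP' oy ?_ ?_
      · have := o.sub o'
        refine OrdGe.mono (n := 2 * k + 5) ?_ (by omega)
        convert this using 1
        ring
      · convert ou.sub ou' using 1
        ring
    rcases two hP hQ u₁ u₂ with e | e
    · exact Or.inl e
    rcases two hP hR u₁ u₃ with e' | e'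
    · exact Or.inr (Or.inl e')
    · exact Or.inr (Or.inr (neg_injective (e.symm.trans e')))

/-- The component group of Iₙ* has order four. For n ≥ 1 there is at most one nonzero point over the
simple root and at most two over the double root; for n = 0 there is at most one over each of three
roots. -/
theorem not_distinct_of_star (hs : IsStarPair O a b)
    {P Q R S} (hP : P ∈ T) (hQ : Q ∈ T) (hR : R ∈ T) (hS : S ∈ T) (hP0 : P ≠ 0) (hQ0 : Q ≠ 0)
    (hR0 : R ≠ 0) (hS0 : S ≠ 0) : P = Q ∨ P = R ∨ P = S ∨ Q = R ∨ Q = S ∨ R = S := by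
  rcases hs.disc_ge.eq_or with hd | hd
  · exact hT.not_distinct_of_Izero_star hs hd hP hQ hR hS hP0 hQ0 hR0 hS0
  obtain ⟨d, od⟩ := exists_ordEq (O := O) hT.disc_ne
  have hd7 := od.le_of_ge hd
  obtain ⟨oa, ob⟩ := hs.ordEq_of_disc hT.two hT.three hd
  obtain ⟨s, os, o4, o6⟩ := exists_node hT.two hT.three (i := 1) (n := d - 6)
    (oa.congr (by norm_num)) (ob.congr (by norm_num)) (od.congr (by ring))
  have hcase : ∀ P ∈ T, P ≠ 0 → ∃ x y h, P = Point.some x y h ∧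
      (OrdGe O 2 (x - s) ∨ OrdGe O 2 (x - s + 3 * s)) := by
    rintro (_ | ⟨x, y, h⟩) hP hP0
    · exact absurd rfl hP0
    · exact ⟨x, y, h, rfl, hT.simple_or_double hs (by omega) os o4 o6 hP⟩
  have simple : ∀ P ∈ T, ∀ Q ∈ T,
      (∃ x y h, P = Point.some x y h ∧ OrdGe O 2 (x - s + 3 * s)) →
      (∃ x y h, Q = Point.some x y h ∧ OrdGe O 2 (x - s + 3 * s)) → P = Q := by
    rintro P hP Q hQ ⟨x, y, h, rfl, o⟩ ⟨x', y', h', rfl, o'⟩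
    exact hT.eq_of_simple hs (n := d - 6) (by omega) os o4 hP hQ o o'
  have double : ∀ P ∈ T, ∀ Q ∈ T, ∀ R ∈ T,
      (∃ x y h, P = Point.some x y h ∧ OrdGe O 2 (x - s)) →
      (∃ x y h, Q = Point.some x y h ∧ OrdGe O 2 (x - s)) →
      (∃ x y h, R = Point.some x y h ∧ OrdGe O 2 (x - s)) → P = Q ∨ P = R ∨ Q = R :=
    fun P hP Q hQ R hR h₁ h₂ h₃ =>
      hT.not_distinct_of_double (n := d - 6) (by omega) os o4 o6 hP hQ hR h₁ h₂ h₃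
  have hcase' : ∀ P ∈ T, P ≠ 0 →
      (∃ x y h, P = Point.some x y h ∧ OrdGe O 2 (x - s + 3 * s)) ∨
      (∃ x y h, P = Point.some x y h ∧ OrdGe O 2 (x - s)) := by
    intro P hP hP0
    obtain ⟨x, y, h, e, o | o⟩ := hcase P hP hP0
    · exact Or.inr ⟨x, y, h, e, o⟩
    · exact Or.inl ⟨x, y, h, e, o⟩
  by_contra! hne
  obtain ⟨n12, n13, n14, n23, n24, n34⟩ := hne
  have d123 := fun h₁ h₂ h₃ => (double P hP Q hQ R hR h₁ h₂ h₃).elim n12 (·.elim n13 n23)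
  have d124 := fun h₁ h₂ h₃ => (double P hP Q hQ S hS h₁ h₂ h₃).elim n12 (·.elim n14 n24)
  have d134 := fun h₁ h₂ h₃ => (double P hP R hR S hS h₁ h₂ h₃).elim n13 (·.elim n14 n34)
  have d234 := fun h₁ h₂ h₃ => (double Q hQ R hR S hS h₁ h₂ h₃).elim n23 (·.elim n24 n34)
  rcases hcase' P hP hP0 with c₁ | c₁ <;> rcases hcase' Q hQ hQ0 with c₂ | c₂ <;>
  rcases hcase' R hR hR0 with c₃ | c₃ <;> rcases hcase' S hS hS0 with c₄ | c₄ <;>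
  first
  | exact n12 (simple P hP Q hQ c₁ c₂)
  | exact n13 (simple P hP R hR c₁ c₃)
  | exact n14 (simple P hP S hS c₁ c₄)
  | exact n23 (simple Q hQ R hR c₂ c₃)
  | exact n24 (simple Q hQ S hS c₂ c₄)
  | exact n34 (simple R hR S hS c₃ c₄)
  | exact d123 c₁ c₂ c₃
  | exact d124 c₁ c₂ c₄
  | exact d134 c₁ c₃ c₄
  | exact d234 c₂ c₃ c₄

/-- There is no point of order three at places of type `Iₙ*`. -/
theorem no_three_torsion_of_star (hs : IsStarPair O a b) {P} (hP : P ∈ T) (hP0 : P ≠ 0)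
    (h3 : P + P = -P) : False := by
  rcases P with _ | ⟨x, y, h⟩
  · exact absurd rfl hP0
  have hne : Point.some x y h + Point.some x y h ≠ 0 := by
    rw [h3, neg_ne_zero]; exact hP0
  obtain ⟨ℓ, hℓ, ol⟩ := hT.slope hP hP hne
  obtain ⟨ℓ', hℓ', h₃, e⟩ := short_add h h hℓ.ne
  obtain rfl := hℓ.unique hℓ'
  obtain ⟨h', e', -⟩ := neg_mem hP
  rw [h3, e'] at e
  simp only [Point.some.injEq] at e
  -- A point of order three is a flex, so 2P and P share their abscissa and ℓ² = 3x. This puts x in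
  -- m² and then a in m³, so b has order exactly 3, and so has y².
  have hx : 3 * x = ℓ ^ 2 := by linear_combination e.1
  have ox : OrdGe O 2 x := by
    have : OrdGe O 2 (3 * x) := by
      rw [hx]; exact ol.pow_of_le (by norm_num)
    exact OrdGe.of_mul_left hT.three this
  have oy := hT.ordGe_y_of_star hs hP
  have oa : OrdGe O 3 a := by
    have : a = 2 * (y * ℓ) - 3 * x ^ 2 := by linear_combination -hℓ.tangent
    rw [this]
    exact (hT.two.unit_mul_ge (oy.mul_of_le ol (by norm_num))).sub
      (hT.three.unit_mul_ge (ox.pow_of_le (by norm_num)))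
  have ob : OrdEq O 3 b := hs.ord_b.eq_or.resolve_right fun hb => hs.min ⟨oa, hb⟩
  refine not_odd_sq (O := O) (n := 3) (y := y) ?_ (by norm_num)
  rw [short_equation.1 h.1, add_comm]
  exact ob.add_ge ((ox.pow_of_le (by norm_num)).add (oa.mul_of_le ox (by norm_num)))

end AddTorsion

end Star

/-! ### Classification of additive reduction with torsion -/

section Conclusions

open WeierstrassCurve WeierstrassCurve.Affine IsLocalRing

variable {K : Type*} [Field K] {O : ValuationSubring K} [IsDiscreteValuationRing O]

/-- If any two nonzero elements of a subgroup are opposite, then its order is at most two. -/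
theorem exists_nonzero_ne {G : Type*} [AddCommGroup G] (T : AddSubgroup G) {n : ℕ}
    (h : n < Nat.card T) (s : Finset G) (hs : s.card ≤ n) : ∃ P ∈ T, P ∉ s := by
  classical
  by_contra! hT
  have : Nat.card T ≤ s.card := by
    have := Set.ncard_le_ncard (s := (T : Set G)) (t := (s : Set G)) (fun x hx => hT x hx)
      s.finite_toSet
    rwa [Set.ncard_coe_finset, ← Nat.card_coe_set_eq] at this
  omega

variable [DecidableEq K]

/-- At a place of additive reduction, a torsion subgroup of order `N ≥ 2` prime to the residue
characteristic forces one of the listed types. -/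
theorem AddTorsion.classification {a b : K} {T : AddSubgroup (short a b).toAffine.Point}
    (hT : AddTorsion O T) (hmin : ¬(OrdGe O 4 a ∧ OrdGe O 6 b)) (h1 : 1 < Nat.card T) :
    (Nat.card T = 2 ∧ ((OrdEq O 1 a ∧ OrdGe O 2 b) ∨ (OrdEq O 3 a ∧ OrdGe O 5 b) ∨
      IsStarPair O a b)) ∨
    (Nat.card T = 3 ∧ ((OrdGe O 2 a ∧ OrdEq O 2 b) ∨ (OrdGe O 3 a ∧ OrdEq O 4 b))) ∨
    (Nat.card T = 4 ∧ IsStarPair O a b) := by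
  classical
  obtain ⟨P, hP, hP0⟩ := exists_nonzero_ne T h1 {0} (by simp)
  have hP0 : P ≠ 0 := by simpa using hP0
  have le_two : (∀ P ∈ T, ∀ Q ∈ T, P ≠ 0 → Q ≠ 0 → P + Q = 0) → Nat.card T ≤ 2 := by
    intro h
    by_contra! h2
    obtain ⟨Q, hQ, hQs⟩ := exists_nonzero_ne T h2 {0, P} Finset.card_le_two
    simp only [Finset.mem_insert, Finset.mem_singleton, not_or] at hQs
    have e₁ := h P hP Q hQ hP0 hQs.1
    have e₂ := h P hP P hP hP0 hP0
    exact hQs.2 (add_left_cancel (e₁.trans e₂.symm))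
  have le_three : (∀ P ∈ T, ∀ Q ∈ T, P ≠ 0 → Q ≠ 0 → P = Q ∨ P = -Q) → Nat.card T ≤ 3 := by
    intro h
    by_contra! h2
    obtain ⟨Q, hQ, hQs⟩ := exists_nonzero_ne T h2 {0, P, -P} Finset.card_le_three
    simp only [Finset.mem_insert, Finset.mem_singleton, not_or] at hQs
    rcases h Q hQ P hP hQs.1 hP0 with e | e
    · exact hQs.2.1 e
    · exact hQs.2.2 e
  have two_torsion : Nat.card T = 2 → P + P = 0 := by
    intro h2
    have : Nat.card T • (⟨P, hP⟩ : T) = 0 := card_nsmul_eq_zero'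
    rw [h2, two_nsmul] at this
    exact congrArg Subtype.val this
  have y_zero : Nat.card T = 2 → ∀ {x y : K} {h}, P = Point.some x y h → y = 0 := by
    rintro h2 x y h rfl
    by_contra hy
    have hne : ¬(x = x ∧ y = -y) := by
      rintro ⟨-, h⟩
      have : 2 * y = 0 := by linear_combination h
      exact hy ((mul_eq_zero.1 this).resolve_left hT.two.ne_zero)
    obtain ⟨ℓ, -, h₃, e⟩ := short_add h h hne
    exact Point.some_ne_zero _ (e.symm.trans (two_torsion h2))
  rcases hPe : P with _ | ⟨x, y, h⟩
  · exact absurd hPe hP0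
  have hP' := hPe ▸ hP
  have ox := hT.ordGe_x hP'
  have oy := hT.ordGe_y hP'
  have e := short_equation.1 h.1
  -- The mere existence of a nonzero torsion point at the cusp excludes type II.
  have hb2 : OrdGe O 2 b := by
    have : b = y ^ 2 - x ^ 3 - a * x := by rw [e]; ring
    rw [this]
    exact ((oy.pow_of_le (by norm_num)).sub (ox.pow_of_le (by norm_num))).sub
      (hT.ord_a.mul_of_le ox (by norm_num))
  rcases hT.ord_a.eq_or with a1 | a2
  · have := le_two fun P hP Q hQ => hT.add_eq_zero_of_III a1 hP hQ
    exact Or.inl ⟨by omega, Or.inl ⟨a1, hb2⟩⟩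
  -- At types IV and IV* the ordinate has a definite order, so it is nonzero and the order of T is
  -- not 2.
  have two_IV : ∀ n : ℤ, OrdEq O n y → Nat.card T ≠ 2 := fun n hy h2 =>
    hy.ne_zero (y_zero h2 hPe)
  rcases hb2.eq_or with b2 | b3
  · have := le_three fun P hP Q hQ => hT.eq_or_neg_of_IV a2 b2 hP hQ
    have := two_IV 1 (hT.ordEq_y_of_IV a2 b2 hP')
    exact Or.inr (Or.inl ⟨by omega, Or.inl ⟨a2, b2⟩⟩)
  by_cases hs : OrdGe O 3 a ∧ OrdGe O 4 b
  · obtain ⟨a3, b4⟩ := hs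
    rcases b4.eq_or with b4 | b5
    · have := le_three fun P hP Q hQ => hT.eq_or_neg_of_IVstar a3 b4 hP hQ
      have := two_IV 2 (hT.ordEq_y_of_IVstar a3 b4 hP')
      exact Or.inr (Or.inl ⟨by omega, Or.inr ⟨a3, b4⟩⟩)
    rcases a3.eq_or with a3 | a4
    · have := le_two fun P hP Q hQ => hT.add_eq_zero_of_IIIstar a3 b5 hP hQ
      exact Or.inl ⟨by omega, Or.inr (Or.inl ⟨a3, b5⟩)⟩
    -- Type II*: order 5 for b would give y² order 5, and b in m⁶ contradicts minimality.
    exfalso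
    have ox2 := hT.ordGe_two_x (a4.mono (by norm_num)) (b5.mono (by norm_num)) hP'
    rcases b5.eq_or with b5 | b6
    · refine not_odd_sq (O := O) (n := 5) (y := y) ?_ (by norm_num)
      rw [e, add_comm]
      exact b5.add_ge ((ox2.pow_of_le (by norm_num)).add (a4.mul_of_le ox2 (by norm_num)))
    · exact hmin ⟨a4, b6⟩
  · have hs : IsStarPair O a b := ⟨a2, b3, hs⟩
    have h4 : Nat.card T ≤ 4 := by
      by_contra! h4
      obtain ⟨Q, hQ, hQs⟩ := exists_nonzero_ne T (n := 2) (by omega) {0, P} Finset.card_le_two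
      obtain ⟨R, hR, hRs⟩ := exists_nonzero_ne T (n := 3) (by omega) {0, P, Q}
        Finset.card_le_three
      obtain ⟨S, hS, hSs⟩ := exists_nonzero_ne T (n := 4) (by omega) {0, P, Q, R}
        Finset.card_le_four
      simp only [Finset.mem_insert, Finset.mem_singleton, not_or] at hQs hRs hSs
      rcases hT.not_distinct_of_star hs hP hQ hR hS hP0 hQs.1 hRs.1 hSs.1 with h | h | h | h | h | h
      exacts [hQs.2 h.symm, hRs.2.1 h.symm, hSs.2.1 h.symm, hRs.2.2 h.symm, hSs.2.2.1 h.symm,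
        hSs.2.2.2 h.symm]
    have h3 : Nat.card T ≠ 3 := by
      intro h3
      have : Nat.card T • (⟨P, hP⟩ : T) = 0 := card_nsmul_eq_zero'
      rw [h3] at this
      have : 3 • P = 0 := congrArg Subtype.val this
      refine hT.no_three_torsion_of_star hs hP hP0 (eq_neg_of_add_eq_zero_left ?_)
      rw [← this]; abel
    have : Nat.card T = 2 ∨ Nat.card T = 4 := by omega
    rcases this with h | h
    · exact Or.inl ⟨h, Or.inr (Or.inr hs)⟩
    · exact Or.inr (Or.inr ⟨h, hs⟩)

/-- The order of the elementary abelian `2`-group `G[2]` is divisible by `2` or `4` as soon as it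
has that many elements. -/
theorem dvd_card_of_two_torsion {G : Type*} [AddCommGroup G] (s : Set G) (hs : ∀ g ∈ s, 2 • g = 0)
    {N : ℕ} (hN : N = 2 ∨ N = 4) (hsN : N ≤ s.ncard) : N ∣ Nat.card G := by
  rcases finite_or_infinite G with hG | hG
  swap
  · simp
  let H : AddSubgroup G := (nsmulAddMonoidHom (α := G) 2).ker
  have hsH : s ⊆ H := fun g hg => hs g hg
  have hcard : N ≤ Nat.card H := by
    refine hsN.trans ?_
    have := Set.ncard_le_ncard hsH (Set.toFinite _)
    rwa [← Nat.card_coe_set_eq] at this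
  have hp : IsPGroup 2 (Multiplicative H) := by
    intro g
    refine ⟨1, ?_⟩
    have : 2 • g.toAdd = 0 := Subtype.ext g.toAdd.2
    exact congrArg Multiplicative.ofAdd this
  have : Fact (Nat.Prime 2) := ⟨Nat.prime_two⟩
  obtain ⟨n, hn⟩ := hp.exists_card_eq
  have hn : Nat.card H = 2 ^ n := by
    rw [← hn]; exact Nat.card_congr Multiplicative.ofAdd
  refine Dvd.dvd.trans ?_ H.card_addSubgroup_dvd_card
  rw [hn] at hcard ⊢
  rcases hN with rfl | rfl
  · have : 1 ≤ n := by
      by_contra! h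
      interval_cases n; norm_num at hcard
    exact (pow_one 2 ▸ pow_dvd_pow 2 this :)
  · have : 2 ≤ n := by
      by_contra! h
      interval_cases n <;> norm_num at hcard
    exact (pow_dvd_pow 2 this : 2 ^ 2 ∣ 2 ^ n)

/-- At a place of type `I₀*` the twisted curve `y² = x³ + a / π² x + b / π³` has good reduction, and
its reduction has enough points of order two. -/
theorem AddTorsion.dvd_card {a b : K} {T : AddSubgroup (short a b).toAffine.Point}
    (hT : AddTorsion O T) (hs : IsStarPair O a b) (hd : OrdEq O 6 (disc a b))
    (hN : Nat.card T = 2 ∨ Nat.card T = 4) {π : K} (hπ : OrdEq O 1 π) {A B : O}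
    (hA : π ^ 2 * A = a) (hB : π ^ 3 * B = b) [DecidableEq (ResidueField O)] :
    Nat.card T ∣ Nat.card (short (residue O A) (residue O B)).toAffine.Point := by
  have hD : IsUnit (disc A B) := by
    rw [isUnit_iff_ordEq]
    have : (disc A B : O) = disc (A : K) (B : K) := map_disc O.subtype A B
    rw [this]
    refine (OrdEq.of_mul_left (hπ.pow 6) (n := 6) ?_).congr (by norm_num)
    have : π ^ 6 * disc (A : K) (B : K) = disc a b := by
      rw [← hA, ← hB]; simp only [disc]; ring
    rwa [this]
  have h2 : IsUnit (2 : O) := (isUnit_iff_ordEq (2 : O)).2 hT.two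
  have hfin : Finite T := Nat.finite_of_card_ne_zero (by omega)
  -- Dividing the equation by π³ leaves y²/π³, which lies in m because y lies in m².
  have hroot : ∀ {x y : K} {h}, Point.some x y h ∈ T → ∃ X : O, x = π * X ∧
      residue O (X ^ 3 + A * X + B) = 0 := by
    intro x y h hP
    have ox : OrdGe O 0 (x / π) := (hT.ordGe_x hP).div hπ
    refine ⟨⟨x / π, ordGe_zero_iff.1 ox⟩, (mul_div_cancel₀ x hπ.ne_zero).symm, ?_⟩
    rw [residue_eq_zero_iff_ordGe]
    have := hT.ordGe_y_of_star hs hP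
    have e : π ^ 3 * ((x / π) ^ 3 + A * (x / π) + B) = y ^ 2 := by
      have := hπ.ne_zero
      rw [short_equation.1 h.1, ← hA, ← hB]
      field_simp
    exact (OrdGe.of_mul_left (hπ.pow 3) (n := 4)
      (e ▸ this.pow_of_le (by norm_num))).mono (by norm_num)
  have hpt : ∀ {X : O}, residue O (X ^ 3 + A * X + B) = 0 →
      (short (residue O A) (residue O B)).toAffine.Nonsingular (residue O X) 0 := by
    intro X hX
    have : (short (residue O A) (residue O B)).IsElliptic := by
      apply short_isElliptic
      · have := (h2.map (residue O)).ne_zero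
        rwa [map_ofNat] at this
      · have := (hD.map (residue O)).ne_zero
        rwa [map_disc] at this
    rw [← equation_iff_nonsingular, short_equation]
    simp only [map_add, map_mul, map_pow] at hX
    rw [hX]; ring
  -- The map P ↦ (x/π mod m, 0) is only used as an injection of sets into the 2-torsion of the
  -- reduction. Counting suffices, since the order of that 2-torsion, if finite, is a power of 2.
  have hex : ∀ P : T, ∃ Q : (short (residue O A) (residue O B)).toAffine.Point,
      ((P : (short a b).toAffine.Point) = 0 ∧ Q = 0) ∨
      ∃ x y h, ∃ X : O, ∃ h', (P : (short a b).toAffine.Point) = Point.some x y h ∧ x = π * X ∧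
        Q = Point.some (residue O X) 0 h' := by
    rintro ⟨_ | ⟨x, y, h⟩, hP⟩
    · exact ⟨0, Or.inl ⟨rfl, rfl⟩⟩
    · obtain ⟨X, hX, hr⟩ := hroot hP
      exact ⟨_, Or.inr ⟨x, y, h, X, hpt hr, rfl, hX, rfl⟩⟩
  choose φ hφ using hex
  have hinj : Function.Injective φ := by
    intro P Q hPQ
    apply Subtype.ext
    rcases hφ P with ⟨hP, e⟩ | ⟨x, y, h, X, h', hP, hx, e⟩ <;>
    rcases hφ Q with ⟨hQ, e₂⟩ | ⟨x₂, y₂, h₂, X₂, h₂', hQ, hx₂, e₂⟩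
    · rw [hP, hQ]
    · rw [e, e₂] at hPQ
      exact absurd hPQ.symm (Point.some_ne_zero _)
    · rw [e, e₂] at hPQ
      exact absurd hPQ (Point.some_ne_zero _)
    · rw [e, e₂] at hPQ
      simp only [Point.some.injEq, and_true] at hPQ
      rw [residue_eq_iff_ordGe] at hPQ
      rw [hP, hQ]
      refine hT.eq_of_star_close hs hd (hP ▸ P.2) (hQ ▸ Q.2) ?_
      rw [hx, hx₂, ← mul_sub]
      exact hπ.ge.mul_of_le hPQ (by norm_num)
  refine dvd_card_of_two_torsion (Set.range φ) ?_ hN ?_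
  · rintro _ ⟨P, rfl⟩
    rw [two_nsmul]
    rcases hφ P with ⟨-, e⟩ | ⟨x, y, h, X, h', hP, hx, e⟩
    · rw [e, add_zero]
    · rw [e]
      exact short_add_eq_zero _ _ ⟨rfl, by simp⟩
  · rw [← Nat.card_coe_set_eq, Nat.card_congr (Equiv.ofInjective φ hinj).symm]

end Conclusions

/-! ### Kodaira symbols -/

section Kodaira

open WeierstrassCurve IsLocalRing

variable {k K : Type*} [Field k] [Field K] [Algebra k K] {v : Place k K}

theorem hasKodairaSymbol_of_short {W : WeierstrassCurve K} {C : VariableChange K} {A B : v.ring}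
    (hC : C • W = short (A : K) (B : K)) {s : KodairaSymbol} (h : IsTateNormalForm (short A B) s) :
    HasKodairaSymbol W v s := by
  refine ⟨C, short A B, hC.trans ?_, h⟩
  ext <;> simp [WeierstrassCurve.baseChange, WeierstrassCurve.map]

theorem mem_pow_iff (z : v.ring) (n : ℕ) :
    z ∈ maximalIdeal v.ring ^ n ↔ OrdGe v.ring n (z : K) := mem_maximalIdeal_pow_iff z n

theorem mem_iff (z : v.ring) : z ∈ maximalIdeal v.ring ↔ OrdGe v.ring 1 (z : K) :=
  mem_maximalIdeal_iff z

variable {W : WeierstrassCurve K} {C : VariableChange K} {a b : K} (hC : C • W = short a b)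

include hC

theorem hasKodairaSymbol_III (ha : OrdEq v.ring 1 a) (hb : OrdGe v.ring 2 b) :
    HasKodairaSymbol W v .III := by
  lift a to v.ring using ordGe_zero_iff.1 (ha.ge.mono (by norm_num))
  lift b to v.ring using ordGe_zero_iff.1 (hb.mono (by norm_num))
  refine hasKodairaSymbol_of_short hC ?_
  refine ⟨zero_mem _, (mem_iff _).2 ha.ge, (mem_pow_iff _ _).2 hb, ?_, ?_⟩
  · simp [b₂]
  · rw [mem_pow_iff]
    have : ((short a b).b₈ : K) = -(a : K) ^ 2 := by simp [b₈]
    rw [this]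
    exact (ha.pow 2).neg.not_ge (by norm_num)

theorem hasKodairaSymbol_IIIstar (ha : OrdEq v.ring 3 a) (hb : OrdGe v.ring 5 b) :
    HasKodairaSymbol W v .IIIstar := by
  lift a to v.ring using ordGe_zero_iff.1 (ha.ge.mono (by norm_num))
  lift b to v.ring using ordGe_zero_iff.1 (hb.mono (by norm_num))
  refine hasKodairaSymbol_of_short hC ?_
  refine ⟨zero_mem _, zero_mem _, zero_mem _, (mem_pow_iff _ _).2 ha.ge, (mem_pow_iff _ _).2 hb, ?_⟩
  rw [mem_pow_iff]
  exact ha.not_ge (by norm_num)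

theorem hasKodairaSymbol_IV (h2 : OrdEq v.ring 0 (2 : K)) (ha : OrdGe v.ring 2 a)
    (hb : OrdEq v.ring 2 b) : HasKodairaSymbol W v .IV := by
  lift a to v.ring using ordGe_zero_iff.1 (ha.mono (by norm_num))
  lift b to v.ring using ordGe_zero_iff.1 (hb.ge.mono (by norm_num))
  refine hasKodairaSymbol_of_short hC ?_
  refine ⟨zero_mem _, (mem_iff _).2 (ha.mono (by norm_num)), (mem_pow_iff _ _).2 hb.ge, ?_, ?_, ?_⟩
  · simp [b₂]
  · rw [mem_pow_iff]
    have : ((short a b).b₈ : K) = -(a : K) ^ 2 := by simp [b₈]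
    rw [this]
    exact (ha.pow_of_le (by norm_num)).neg
  · rw [mem_pow_iff]
    have : ((short a b).b₆ : K) = 2 ^ 2 * (b : K) := by
      have : (short a b).b₆ = 2 ^ 2 * b := by simp [b₆]; norm_num
      rw [this]; rfl
    rw [this]
    exact ((h2.pow 2).mul hb).not_ge (by norm_num)

theorem hasKodairaSymbol_IVstar (h2 : OrdEq v.ring 0 (2 : K)) (ha : OrdGe v.ring 3 a)
    (hb : OrdEq v.ring 4 b) : HasKodairaSymbol W v .IVstar := by
  lift a to v.ring using ordGe_zero_iff.1 (ha.mono (by norm_num))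
  lift b to v.ring using ordGe_zero_iff.1 (hb.ge.mono (by norm_num))
  refine hasKodairaSymbol_of_short hC ?_
  refine ⟨zero_mem _, zero_mem _, zero_mem _, (mem_pow_iff _ _).2 ha, (mem_pow_iff _ _).2 hb.ge, ?_⟩
  rw [mem_pow_iff]
  have : ((short a b).b₆ : K) = 2 ^ 2 * (b : K) := by
    have : (short a b).b₆ = 2 ^ 2 * b := by simp [b₆]; norm_num
    rw [this]; rfl
  rw [this]
  exact ((h2.pow 2).mul hb).not_ge (by norm_num)

theorem hasKodairaSymbol_Istar (h2 : OrdEq v.ring 0 (2 : K)) (h3 : OrdEq v.ring 0 (3 : K))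
    (hd : disc a b ≠ 0) (hs : IsStarPair v.ring a b) : ∃ n, HasKodairaSymbol W v (.Istar n) := by
  rcases hs.disc_ge.eq_or with hd6 | hd7
  · refine ⟨0, ?_⟩
    have ha := hs.ord_a
    have hb := hs.ord_b
    lift a to v.ring using ordGe_zero_iff.1 (ha.mono (by norm_num))
    lift b to v.ring using ordGe_zero_iff.1 (hb.mono (by norm_num))
    refine hasKodairaSymbol_of_short hC ?_
    refine ⟨zero_mem _, zero_mem _, zero_mem _, (mem_pow_iff _ _).2 ha, (mem_pow_iff _ _).2 hb, ?_⟩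
    rw [mem_pow_iff]
    have : (((short a b).a₂ ^ 2 * (short a b).a₄ ^ 2 - 4 * (short a b).a₄ ^ 3 -
        4 * (short a b).a₂ ^ 3 * (short a b).a₆ - 27 * (short a b).a₆ ^ 2 +
        18 * (short a b).a₂ * (short a b).a₄ * (short a b).a₆ : v.ring) : K) =
        -disc (a : K) (b : K) := by
      have key : (short a b).a₂ ^ 2 * (short a b).a₄ ^ 2 - 4 * (short a b).a₄ ^ 3 -
          4 * (short a b).a₂ ^ 3 * (short a b).a₆ - 27 * (short a b).a₆ ^ 2 +
          18 * (short a b).a₂ * (short a b).a₄ * (short a b).a₆ = -disc a b := by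
        simp only [disc]; ring
      rw [key]
      exact congrArg Neg.neg (map_disc v.ring.subtype a b)
    rw [this]
    exact hd6.neg.not_ge (by norm_num)
  obtain ⟨d, od⟩ := exists_ordEq (O := v.ring) hd
  have hd7' := od.le_of_ge hd7
  obtain ⟨oa, ob⟩ := hs.ordEq_of_disc h2 h3 hd7
  obtain ⟨s, os, o4, o6⟩ := exists_node h2 h3 (i := 1) (n := d - 6)
    (oa.congr (by norm_num)) (ob.congr (by norm_num)) (od.congr (by ring))
  obtain ⟨n, hn⟩ : ∃ n : ℕ, d = n + 7 := ⟨(d - 7).toNat, by omega⟩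
  have os3 : OrdEq v.ring 1 (3 * s) := h3.unit_mul os
  obtain ⟨α, hα⟩ : ∃ α : v.ring, (α : K) = 3 * s :=
    ⟨⟨_, ordGe_zero_iff.1 (os3.ge.mono (by norm_num))⟩, rfl⟩
  obtain ⟨β, hβ⟩ : ∃ β : v.ring, (β : K) = 3 * s ^ 2 + a :=
    ⟨⟨_, ordGe_zero_iff.1 (o4.ge.mono (by omega))⟩, rfl⟩
  obtain ⟨γ, hγ⟩ : ∃ γ : v.ring, (γ : K) = s ^ 3 + a * s + b :=
    ⟨⟨_, ordGe_zero_iff.1 (o6.ge.mono (by omega))⟩, rfl⟩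
  rw [← hα] at os3
  rw [← hβ] at o4
  rw [← hγ] at o6
  have h4 : OrdEq v.ring 0 (4 : K) := by
    have := h2.pow 2
    norm_num at this; exact this
  -- Moving the approximate double root s to the origin gives a₂ = 3s, a₄ = 3s² + a, a₆ = s³ + as +
  -- b, of orders 1, n + 3, n + 4. With discriminant of order n + 7 the symbol is I*_{n+1}.
  refine ⟨n + 1, (⟨1, s, 0, 0⟩ : VariableChange K) * C, ⟨0, α, 0, β, γ⟩, ?_, ?_⟩
  · rw [mul_smul, hC]
    ext <;> simp [variableChange_def, WeierstrassCurve.baseChange, WeierstrassCurve.map]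
    · exact hα.symm
    · refine Eq.trans ?_ hβ.symm; ring
    · refine Eq.trans ?_ hγ.symm; ring
  · refine ⟨zero_mem _, (mem_iff _).2 os3.ge, ?_, ?_⟩
    · rw [mem_pow_iff]
      exact os3.not_ge (by norm_num)
    rcases Nat.even_or_odd' n with ⟨i, hi | hi⟩
    · left
      refine ⟨i, by omega, zero_mem _, ?_, ?_, ?_⟩
      · rw [mem_pow_iff]; exact o4.ge.mono (by push_cast; omega)
      · rw [mem_pow_iff]; exact o6.ge.mono (by push_cast; omega)
      · rw [mem_pow_iff]
        have : (((0 : v.ring) ^ 2 + 4 * γ : v.ring) : K) = 4 * (γ : K) := by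
          have : (0 : v.ring) ^ 2 + 4 * γ = 4 * γ := by ring
          rw [this]; rfl
        rw [this]
        exact (h4.unit_mul o6).not_ge (by push_cast; omega)
    · right
      refine ⟨i, by omega, zero_mem _, ?_, ?_, ?_⟩
      · rw [mem_pow_iff]; exact o4.ge.mono (by push_cast; omega)
      · rw [mem_pow_iff]; exact o6.ge.mono (by push_cast; omega)
      · rw [mem_pow_iff]
        have : ((β ^ 2 - 4 * α * γ : v.ring) : K) = -(4 * (α : K) * γ) + (β : K) ^ 2 := by
          have : β ^ 2 - 4 * α * γ = -(4 * α * γ) + β ^ 2 := by ring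
          rw [this]; rfl
        rw [this]
        refine OrdEq.not_ge (n := 2 * i + 6) ?_ (by push_cast; omega)
        refine ((h4.unit_mul os3).mul o6).neg.congr (by omega) |>.add_ge ?_
        exact o4.ge.pow_of_le (by push_cast; omega)

end Kodaira

/-! ### Reduction types in terms of a primitive short equation -/

section ReductionType

open WeierstrassCurve IsLocalRing

theorem splits_quadratic_iff {F : Type*} [Field F] (h2 : (2 : F) ≠ 0) {a b c : F} (ha : a ≠ 0) :
    (Polynomial.C a * Polynomial.X ^ 2 + Polynomial.C b * Polynomial.X - Polynomial.C c).Splits ↔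
      IsSquare (b ^ 2 + 4 * a * c) := by
  have : NeZero (2 : F) := ⟨h2⟩
  have hdeg : (Polynomial.C a * Polynomial.X ^ 2 + Polynomial.C b * Polynomial.X -
      Polynomial.C c).natDegree = 2 := by
    rw [sub_eq_add_neg, ← Polynomial.C_neg]
    exact Polynomial.natDegree_quadratic ha
  have hd : b ^ 2 + 4 * a * c = discrim a b (-c) := by simp only [discrim]; ring
  constructor
  · intro h
    obtain ⟨x, hx⟩ := h.exists_eval_eq_zero (by
      intro h0
      rw [Polynomial.natDegree_eq_of_degree_eq_some h0] at hdeg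
      norm_num at hdeg)
    simp only [Polynomial.eval_sub, Polynomial.eval_add, Polynomial.eval_mul, Polynomial.eval_C,
      Polynomial.eval_pow, Polynomial.eval_X] at hx
    exact ⟨2 * a * x + b, by linear_combination (-4) * a * hx⟩
  · rintro ⟨s, hs⟩
    rw [hd] at hs
    obtain ⟨x, hx⟩ := exists_quadratic_eq_zero ha ⟨s, hs⟩
    refine Polynomial.Splits.of_natDegree_eq_two hdeg (x := x) ?_
    simp only [Polynomial.eval_sub, Polynomial.eval_add, Polynomial.eval_mul, Polynomial.eval_C,
      Polynomial.eval_pow, Polynomial.eval_X]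
    linear_combination hx

/-- Completing the square and the cube. -/
theorem exists_smul_eq_short {F : Type*} [Field F] (h2 : (2 : F) ≠ 0) (h3 : (3 : F) ≠ 0)
    (W : WeierstrassCurve F) :
    ∃ C : VariableChange F, C • W = short (-W.c₄ / 48) (-W.c₆ / 864) := by
  have e12 : (12 : F) = 2 ^ 2 * 3 := by norm_num
  have e48 : (48 : F) = 2 ^ 4 * 3 := by norm_num
  have e864 : (864 : F) = 2 ^ 5 * 3 ^ 3 := by norm_num
  refine ⟨⟨1, -W.b₂ / 12, -W.a₁ / 2, -(W.a₃ + (-W.b₂ / 12) * W.a₁) / 2⟩, ?_⟩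
  rw [e12, e48, e864]
  ext <;> simp only [variableChange_def, inv_one, Units.val_one, WeierstrassCurve.c₄,
    WeierstrassCurve.c₆, b₂, b₄, b₆] <;> field_simp <;> ring

variable {K : Type*} [Field K] (O : ValuationSubring K) [IsDiscreteValuationRing O]

/-- `y² = x³ + a x + b` is, up to isomorphism over `K`, a short equation of `W`, it is integral at
`O`, and it cannot be scaled down. -/
structure IsPrimitiveModel (W : WeierstrassCurve K) (c : K) (a b : O) : Prop where
  c_ne : c ≠ 0
  a_eq : (a : K) = c ^ 4 * (-W.c₄ / 48)
  b_eq : (b : K) = c ^ 6 * (-W.c₆ / 864)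
  min : ¬(OrdGe O 4 (a : K) ∧ OrdGe O 6 (b : K))

variable {O}

theorem IsPrimitiveModel.exists_smul (h2 : (2 : K) ≠ 0) (h3 : (3 : K) ≠ 0)
    {W : WeierstrassCurve K} {c : K} {a b : O}
    (h : IsPrimitiveModel O W c a b) : ∃ C : VariableChange K, C • W = short (a : K) b := by
  obtain ⟨C, hC⟩ := exists_smul_eq_short h2 h3 W
  refine ⟨⟨(Units.mk0 c h.c_ne)⁻¹, 0, 0, 0⟩ * C, ?_⟩
  rw [mul_smul, hC, smul_short, Units.val_mk0, h.a_eq, h.b_eq]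

variable (O) in
-- Among all powers πⁿ that make the scaled coefficients integral there is a least one, because the
-- two coefficients do not both vanish.
theorem exists_isPrimitiveModel (h2 : OrdEq O 0 (2 : K)) (h3 : OrdEq O 0 (3 : K))
    (W : WeierstrassCurve K) [W.IsElliptic] : ∃ c a b, IsPrimitiveModel O W c a b := by
  obtain ⟨π, hπ⟩ := exists_uniformizer O
  set A := -W.c₄ / 48 with hA
  set B := -W.c₆ / 864 with hB
  have hn : ∃ n : ℤ, OrdGe O (-4 * n) A ∧ OrdGe O (-6 * n) B := by
    have : ∀ x : K, ∃ n : ℤ, OrdGe O n x := fun x => by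
      by_cases hx : x = 0
      · exact ⟨0, hx ▸ ordGe_zero_right _⟩
      · exact (exists_ordEq hx).imp fun _ h => h.ge
    obtain ⟨i, hi⟩ := this A
    obtain ⟨j, hj⟩ := this B
    exact ⟨max (-i) (max (-j) 0), hi.mono (by omega), hj.mono (by omega)⟩
  have hne : A ≠ 0 ∨ B ≠ 0 := by
    by_contra! h0
    have e48 : (48 : K) = 2 ^ 4 * 3 := by norm_num
    have e864 : (864 : K) = 2 ^ 5 * 3 ^ 3 := by norm_num
    have e1728 : (1728 : K) = 2 ^ 6 * 3 ^ 3 := by norm_num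
    have z2 := h2.ne_zero
    have z3 := h3.ne_zero
    have c4 : W.c₄ = 0 := by
      have := h0.1
      rw [hA, e48] at this
      simpa [z2, z3] using this
    have c6 : W.c₆ = 0 := by
      have := h0.2
      rw [hB, e864] at this
      simpa [z2, z3] using this
    have hΔ : W.Δ = 0 := by
      have := W.c_relation
      rw [c4, c6, e1728] at this
      simpa [z2, z3] using this
    exact W.isUnit_Δ.ne_zero hΔ
  have hbdd : ∃ m : ℤ, ∀ n : ℤ, OrdGe O (-4 * n) A ∧ OrdGe O (-6 * n) B → m ≤ n := by
    rcases hne with h | h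
    · obtain ⟨i, hi⟩ := exists_ordEq (O := O) h
      exact ⟨-max i (-i), fun n hn => by have := hi.le_of_ge hn.1; omega⟩
    · obtain ⟨i, hi⟩ := exists_ordEq (O := O) h
      exact ⟨-max i (-i), fun n hn => by have := hi.le_of_ge hn.2; omega⟩
  obtain ⟨m, hm⟩ := hbdd
  obtain ⟨n, hn, hmin⟩ := Int.exists_least_of_bdd ⟨m, hm⟩ hn
  have hc : OrdEq O n (π ^ n) := (hπ.zpow n).congr (by ring)
  refine ⟨π ^ n, ⟨_, ordGe_zero_iff.1 ((hc.pow 4).ge.mul_of_le hn.1 (by push_cast; omega))⟩,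
    ⟨_, ordGe_zero_iff.1 ((hc.pow 6).ge.mul_of_le hn.2 (by push_cast; omega))⟩,
    hc.ne_zero, rfl, rfl, ?_⟩
  rintro ⟨h4, h6⟩
  have := hmin (n - 1) ⟨(OrdGe.of_mul_left (hc.pow 4) h4).mono (by push_cast; omega),
    (OrdGe.of_mul_left (hc.pow 6) h6).mono (by push_cast; omega)⟩
  omega

variable (O) in
/-- The invariants of the chosen minimal equation differ from those of a primitive short equation
by units. -/
theorem IsPrimitiveModel.exists_unit (h2 : OrdEq O 0 (2 : K)) (h3 : OrdEq O 0 (3 : K))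
    {W : WeierstrassCurve K} [W.IsElliptic] {c : K} {a b : O} (h : IsPrimitiveModel O W c a b) :
    ∃ w : O, IsUnit w ∧ ((W.minimal O).integralModel O).c₄ = w ^ 4 * (-48 * a) ∧
      ((W.minimal O).integralModel O).c₆ = w ^ 6 * (-864 * b) ∧
      ((W.minimal O).integralModel O).Δ = w ^ 12 * (-16 * disc a b) := by
  obtain ⟨C, hC⟩ := h.exists_smul h2.ne_zero h3.ne_zero
  obtain ⟨D, hD⟩ : ∃ D : VariableChange K, W.minimal O = D • W := ⟨_, rfl⟩
  set M := W.minimal O with hM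
  -- the change of variables from the short equation to the minimal one
  have hCM : (C * D⁻¹) • M = short (a : K) b := by
    rw [hD, mul_smul, inv_smul_smul, hC]
  have hSM : (C * D⁻¹)⁻¹ • short (a : K) b = M := by rw [← hCM, inv_smul_smul]
  obtain ⟨w, hw⟩ : ∃ w : Kˣ, w = ((C * D⁻¹)⁻¹).u⁻¹ := ⟨_, rfl⟩
  have f4 : M.c₄ = (w : K) ^ 4 * (-48 * a) := by
    rw [← hSM, variableChange_c₄, short_c₄, hw]
  have f6 : M.c₆ = (w : K) ^ 6 * (-864 * b) := by
    rw [← hSM, variableChange_c₆, short_c₆, hw]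
  have fΔ : M.Δ = (w : K) ^ 12 * (-16 * disc (a : K) b) := by
    rw [← hSM, variableChange_Δ, short_Δ, hw]
  have o48 : OrdEq O 0 (-48 : K) := by
    have := (ordEq_natCast_pow_mul h2 h3 4 1).neg
    norm_num at this; exact this
  have o864 : OrdEq O 0 (-864 : K) := by
    have := (ordEq_natCast_pow_mul h2 h3 5 3).neg
    norm_num at this; exact this
  have o16 : OrdEq O 0 (-16 : K) := by
    have := (ordEq_natCast_pow_mul h2 h3 4 0).neg
    norm_num at this; exact this
  have g4 : OrdGe O 0 M.c₄ := by
    rw [ordGe_zero_iff, ← integralModel_c₄_eq O M]; exact SetLike.coe_mem _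
  have g6 : OrdGe O 0 M.c₆ := by
    rw [ordGe_zero_iff, ← integralModel_c₆_eq O M]; exact SetLike.coe_mem _
  have hΔ0 : M.Δ ≠ 0 := by
    have : M.IsElliptic := by rw [hD]; infer_instance
    exact M.isUnit_Δ.ne_zero
  obtain ⟨j, hj⟩ := exists_ordEq (O := O) w.ne_zero
  -- A negative order of w would allow the short equation to be scaled down. A positive one would
  -- give the short equation a discriminant of smaller order than the minimal equation.
  have hj0 : j = 0 := by
    rcases lt_trichotomy j 0 with hlt | h0 | hgt
    · exfalso
      refine h.min ⟨?_, ?_⟩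
      · have := OrdGe.of_mul_left o48 (OrdGe.of_mul_left (hj.pow 4) (f4 ▸ g4))
        exact this.mono (by push_cast; omega)
      · have := OrdGe.of_mul_left o864 (OrdGe.of_mul_left (hj.pow 6) (f6 ▸ g6))
        exact this.mono (by push_cast; omega)
    · exact h0
    · exfalso
      have hint : IsIntegral O ((C * D⁻¹) • M) := by
        rw [hCM]
        exact ⟨short a b, by ext <;> simp⟩
      have hmin := (inferInstance : IsMinimal O M).val_Δ_maximal.2 hint
      simp only [one_smul] at hmin
      have key : val O M.Δ < val O (short (a : K) b).Δ := by
        obtain ⟨d, hd⟩ := exists_ordEq (O := O) (x := (short (a : K) b).Δ) (by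
          intro h0
          rw [short_Δ] at h0
          rw [h0, mul_zero] at fΔ
          exact hΔ0 fΔ)
        have hd' : OrdEq O (12 * j + d) M.Δ := by
          rw [fΔ, ← short_Δ]; exact (hj.pow 12).mul hd
        rw [hd, hd', WithZero.exp_lt_exp]
        omega
      have key' : valuation_Δ_aux O M ≤ valuation_Δ_aux O ((C * D⁻¹) • M) := by
        rw [← Subtype.coe_le_coe, valuation_Δ_aux_eq_of_isIntegral,
          valuation_Δ_aux_eq_of_isIntegral, hCM]
        exact key.le
      have := hmin key'
      rw [← Subtype.coe_le_coe, valuation_Δ_aux_eq_of_isIntegral,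
          valuation_Δ_aux_eq_of_isIntegral, hCM] at this
      exact absurd this (not_le.2 key)
  rw [hj0] at hj
  refine ⟨⟨w, ordGe_zero_iff.1 hj.ge⟩, (isUnit_iff_ordEq _).2 hj, ?_, ?_, ?_⟩ <;>
    apply Subtype.ext
  · exact (integralModel_c₄_eq O M).trans f4
  · exact (integralModel_c₆_eq O M).trans f6
  · refine (integralModel_Δ_eq O M).trans (fΔ.trans ?_)
    have := map_disc O.subtype a b
    change _ = (w : K) ^ 12 * (-16 * O.subtype (disc a b))
    rw [this]; rfl

end ReductionType

/-! ### Reduction type, point count and local polynomial from a primitive model -/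

section LocalPolynomial

open WeierstrassCurve IsLocalRing

/-- The injections attached to C and to its inverse give a bijection by Schröder–Bernstein, so no
finiteness is needed. -/
theorem card_point_smul {F : Type*} [Field F] {W W' : WeierstrassCurve F} [W.IsElliptic]
    (C : VariableChange F) (h : C • W = W') :
    Nat.card W.toAffine.Point = Nat.card W'.toAffine.Point := by
  classical
  obtain ⟨φ, hφ, -⟩ := exists_pointHom C h
  have : W'.IsElliptic := by rw [← h]; infer_instance
  obtain ⟨ψ, hψ, -⟩ := exists_pointHom C⁻¹ (W := W') (W' := W) (by rw [← h, inv_smul_smul])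
  obtain ⟨e⟩ := Function.Embedding.antisymm ⟨φ, hφ⟩ ⟨ψ, hψ⟩
  exact Nat.card_congr e

variable {K : Type*} [Field K] {O : ValuationSubring K} [IsDiscreteValuationRing O]
  {W : WeierstrassCurve K} [W.IsElliptic] {c : K} {a b : O}

theorem ordEq_unit_mul_iff {n : ℤ} {w x : K} (hw : OrdEq O 0 w) :
    OrdEq O n (w * x) ↔ OrdEq O n x :=
  ⟨fun h => (OrdEq.of_mul_left hw h).congr (by omega), fun h => hw.unit_mul h⟩

theorem ordGe_unit_mul_iff {n : ℤ} {w x : K} (hw : OrdEq O 0 w) :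
    OrdGe O n (w * x) ↔ OrdGe O n x :=
  ⟨fun h => (OrdGe.of_mul_left hw h).mono (by omega), fun h => hw.unit_mul_ge h⟩

theorem IsPrimitiveModel.exists_ordEq (h2 : OrdEq O 0 (2 : K)) (h3 : OrdEq O 0 (3 : K))
    (h : IsPrimitiveModel O W c a b) :
    ∃ u v : K, OrdEq O 0 u ∧ OrdEq O 0 v ∧ (W.minimal O).Δ = u * disc (a : K) b ∧
      (W.minimal O).c₄ = v * a := by
  obtain ⟨w, hw, e4, -, eΔ⟩ := h.exists_unit O h2 h3
  rw [isUnit_iff_ordEq] at hw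
  have o48 : OrdEq O 0 (-48 : K) := by
    have := (ordEq_natCast_pow_mul h2 h3 4 1).neg
    norm_num at this; exact this
  have o16 : OrdEq O 0 (-16 : K) := by
    have := (ordEq_natCast_pow_mul h2 h3 4 0).neg
    norm_num at this; exact this
  refine ⟨w ^ 12 * -16, w ^ 4 * -48, ((hw.pow 12).mul o16).congr (by norm_num),
    ((hw.pow 4).mul o48).congr (by norm_num), ?_, ?_⟩
  · rw [← integralModel_Δ_eq O, eΔ]
    have := map_disc O.subtype a b
    simp only [map_mul, map_pow, map_neg, map_ofNat]
    rw [mul_assoc]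
    exact congrArg _ (congrArg _ this)
  · rw [← integralModel_c₄_eq O, e4]
    simp only [map_mul, map_pow, map_neg, map_ofNat]
    rw [mul_assoc]
    rfl

theorem IsPrimitiveModel.good_iff (h2 : OrdEq O 0 (2 : K)) (h3 : OrdEq O 0 (3 : K))
    (h : IsPrimitiveModel O W c a b) :
    (W.minimal O).HasGoodReduction O ↔ OrdEq O 0 (disc (a : K) b) := by
  obtain ⟨u, v, hu, hv, eΔ, e4⟩ := h.exists_ordEq h2 h3
  rw [hasGoodReduction_iff, val_eq_one_iff, eΔ, ordEq_unit_mul_iff hu]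
  exact and_iff_right inferInstance

theorem IsPrimitiveModel.multiplicative_iff (h2 : OrdEq O 0 (2 : K)) (h3 : OrdEq O 0 (3 : K))
    (h : IsPrimitiveModel O W c a b) :
    (W.minimal O).HasMultiplicativeReduction O ↔
      OrdGe O 1 (disc (a : K) b) ∧ OrdEq O 0 (a : K) := by
  obtain ⟨u, v, hu, hv, eΔ, e4⟩ := h.exists_ordEq h2 h3
  rw [hasMultiplicativeReduction_iff, val_eq_one_iff, val_lt_one_iff, eΔ, e4,
    ordEq_unit_mul_iff hv, ordGe_unit_mul_iff hu]
  exact and_iff_right inferInstance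

theorem IsPrimitiveModel.additive_iff (h2 : OrdEq O 0 (2 : K)) (h3 : OrdEq O 0 (3 : K))
    (h : IsPrimitiveModel O W c a b) :
    (W.minimal O).HasAdditiveReduction O ↔ OrdGe O 1 (a : K) ∧ OrdGe O 1 (b : K) := by
  obtain ⟨u, v, hu, hv, eΔ, e4⟩ := h.exists_ordEq h2 h3
  rw [hasAdditiveReduction_iff, val_lt_one_iff, val_lt_one_iff, eΔ, e4,
    ordGe_unit_mul_iff hv, ordGe_unit_mul_iff hu]
  have o27 : OrdEq O 0 (27 : K) := by
    have := (ordEq_natCast_pow_mul h2 h3 0 3)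
    norm_num at this; exact this
  have o4 : OrdEq O 0 (4 : K) := by
    have := (ordEq_natCast_pow_mul h2 h3 2 0)
    norm_num at this; exact this
  refine (and_iff_right (inferInstance : (W.minimal O).IsMinimal O)).trans ?_
  constructor
  · rintro ⟨hd, ha⟩
    refine ⟨ha, OrdGe.of_pow (k := 2) (n := 1) (by norm_num) ?_ (by norm_num)⟩
    rw [← ordGe_unit_mul_iff o27]
    have : 27 * (b : K) ^ 2 = disc (a : K) b - 4 * (a : K) ^ 3 := by simp only [disc]; ring
    rw [this]
    exact hd.sub (o4.unit_mul_ge (ha.pow_of_le (by norm_num)))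
  · rintro ⟨ha, hb⟩
    exact ⟨(o4.unit_mul_ge (ha.pow_of_le (by norm_num))).add
      (o27.unit_mul_ge (hb.pow_of_le (by norm_num))), ha⟩

theorem residue_two_ne (h2 : OrdEq O 0 (2 : K)) : (2 : ResidueField O) ≠ 0 := by
  have h : ¬ OrdGe O 1 ((2 : O) : K) := h2.not_ge (by norm_num)
  rwa [← residue_eq_zero_iff_ordGe, map_ofNat] at h

theorem residue_three_ne (h3 : OrdEq O 0 (3 : K)) : (3 : ResidueField O) ≠ 0 := by
  have h : ¬ OrdGe O 1 ((3 : O) : K) := h3.not_ge (by norm_num)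
  rwa [← residue_eq_zero_iff_ordGe, map_ofNat] at h

theorem isSquare_sq_mul_iff {F : Type*} [Field F] {u x : F} (hu : u ≠ 0) :
    IsSquare (u ^ 2 * x) ↔ IsSquare x := by
  constructor
  · rintro ⟨r, hr⟩
    exact ⟨r / u, by field_simp; linear_combination hr⟩
  · rintro ⟨r, rfl⟩
    exact ⟨u * r, by ring⟩

/-- The quadratic of tangent directions at the node has discriminant -c₄c₆. Being built from c₄ and
c₆, it can be computed on the short equation, where it equals (144w⁵)²·(-2ab). -/
theorem IsPrimitiveModel.split_iff (h2 : OrdEq O 0 (2 : K)) (h3 : OrdEq O 0 (3 : K))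
    (h : IsPrimitiveModel O W c a b) :
    (W.minimal O).HasSplitMultiplicativeReduction O ↔
      (OrdGe O 1 (disc (a : K) b) ∧ OrdEq O 0 (a : K)) ∧ IsSquare (residue O (-2 * a * b)) := by
  rw [hasSplitMultiplicativeReduction_iff, ← h.multiplicative_iff h2 h3]
  suffices key : ∀ hm : (W.minimal O).HasMultiplicativeReduction O,
      letI I := (W.minimal O).integralModel O
      ((Polynomial.C I.c₄ * Polynomial.X ^ 2 + Polynomial.C (I.a₁ * I.c₄) * Polynomial.X -
        Polynomial.C (54 * I.b₆ - 3 * I.b₂ * I.b₄ + I.a₂ * I.c₄)).map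
          (algebraMap O (ResidueField O))).Splits ↔ IsSquare (residue O (-2 * a * b)) from
    ⟨fun ⟨p, q⟩ => ⟨p, (key p).1 q⟩, fun ⟨p, q⟩ => ⟨p, (key p).2 q⟩⟩
  intro hm
  rw [h.multiplicative_iff h2 h3] at hm
  obtain ⟨w, hw, e4, e6, -⟩ := h.exists_unit O h2 h3
  set I := (W.minimal O).integralModel O
  have z2 := residue_two_ne h2
  have z3 := residue_three_ne h3
  have ha : residue O a ≠ 0 := by
    rw [ne_eq, residue_eq_zero_iff_ordGe]; exact hm.2.not_ge (by norm_num)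
  have hw' : residue O w ≠ 0 := (hw.map (residue O)).ne_zero
  have hc : residue O I.c₄ ≠ 0 := by
    rw [e4, map_mul, map_pow, map_mul]
    refine mul_ne_zero (pow_ne_zero _ hw') (mul_ne_zero ?_ ha)
    have : residue O (-48 : O) = -(2 ^ 4 * 3) := by
      rw [map_neg, map_ofNat]; norm_num
    rw [this]
    exact neg_ne_zero.2 (mul_ne_zero (pow_ne_zero _ z2) z3)
  simp only [Polynomial.map_sub, Polynomial.map_add, Polynomial.map_mul, Polynomial.map_C,
    Polynomial.map_pow, Polynomial.map_X]
  rw [ResidueField.algebraMap_eq, splits_quadratic_iff z2 hc]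
  have key : (residue O (I.a₁ * I.c₄)) ^ 2 +
      4 * residue O I.c₄ * residue O (54 * I.b₆ - 3 * I.b₂ * I.b₄ + I.a₂ * I.c₄) =
      (144 * residue O w ^ 5) ^ 2 * residue O (-2 * a * b) := by
    have e : (I.a₁ * I.c₄) ^ 2 + 4 * I.c₄ * (54 * I.b₆ - 3 * I.b₂ * I.b₄ + I.a₂ * I.c₄) =
        -(I.c₄ * I.c₆) := by
      simp only [WeierstrassCurve.c₄, WeierstrassCurve.c₆, b₂, b₄, b₆]; ring
    have e' : (I.a₁ * I.c₄) ^ 2 + 4 * I.c₄ * (54 * I.b₆ - 3 * I.b₂ * I.b₄ + I.a₂ * I.c₄) =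
        (144 * w ^ 5) ^ 2 * (-2 * a * b) := by
      rw [e, e4, e6]; ring
    have := congrArg (residue O) e'
    simpa only [map_add, map_mul, map_pow, map_ofNat] using this
  rw [key, isSquare_sq_mul_iff]
  refine mul_ne_zero ?_ (pow_ne_zero _ hw')
  have : (144 : ResidueField O) = 2 ^ 4 * 3 ^ 2 := by norm_num
  rw [this]
  exact mul_ne_zero (pow_ne_zero _ z2) (pow_ne_zero _ z3)

/-- Over the residue field both curves have a short equation, and these differ by scaling with the
residue of w, since c₄ and c₆ differ by w⁴ and w⁶. -/
theorem IsPrimitiveModel.card_reduction (h2 : OrdEq O 0 (2 : K)) (h3 : OrdEq O 0 (3 : K))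
    (h : IsPrimitiveModel O W c a b) (hd : OrdEq O 0 (disc (a : K) b)) :
    Nat.card ((W.minimal O).reduction O).toAffine.Point =
      Nat.card (short (residue O a) (residue O b)).toAffine.Point := by
  obtain ⟨w, hw, e4, e6, -⟩ := h.exists_unit O h2 h3
  have z2 := residue_two_ne h2
  have z3 := residue_three_ne h3
  have hell : ((W.minimal O).reduction O).IsElliptic :=
    (hasGoodReduction_iff_isElliptic_reduction O).1 ((h.good_iff h2 h3).2 hd)
  obtain ⟨C, hC⟩ := exists_smul_eq_short z2 z3 ((W.minimal O).reduction O)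
  have hw' : residue O w ≠ 0 := (hw.map (residue O)).ne_zero
  have e48 : (48 : ResidueField O) ≠ 0 := by
    have : (48 : ResidueField O) = 2 ^ 4 * 3 := by norm_num
    rw [this]
    exact mul_ne_zero (pow_ne_zero _ z2) z3
  have e864 : (864 : ResidueField O) ≠ 0 := by
    have : (864 : ResidueField O) = 2 ^ 5 * 3 ^ 3 := by norm_num
    rw [this]
    exact mul_ne_zero (pow_ne_zero _ z2) (pow_ne_zero _ z3)
  have f4 : -((W.minimal O).reduction O).c₄ / 48 = residue O w ^ 4 * residue O a := by
    rw [reduction, map_c₄, e4]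
    simp only [map_mul, map_pow, map_neg, map_ofNat]
    field_simp
  have f6 : -((W.minimal O).reduction O).c₆ / 864 = residue O w ^ 6 * residue O b := by
    rw [reduction, map_c₆, e6]
    simp only [map_mul, map_pow, map_neg, map_ofNat]
    field_simp
  rw [f4, f6] at hC
  rw [card_point_smul C hC]
  have hd' : disc (residue O a) (residue O b) ≠ 0 := by
    rw [← map_disc, ne_eq, residue_eq_zero_iff_ordGe]
    have := map_disc O.subtype a b
    change ¬ OrdGe O 1 (O.subtype (disc a b))
    rw [this]
    exact hd.not_ge (by norm_num)
  have := short_isElliptic z2 hd'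
  exact (card_point_smul _ (smul_short (Units.mk0 _ hw') (residue O a) (residue O b))).symm

open Polynomial in
theorem IsPrimitiveModel.localPolynomial_good (h2 : OrdEq O 0 (2 : K)) (h3 : OrdEq O 0 (3 : K))
    (h : IsPrimitiveModel O W c a b) (hd : OrdEq O 0 (disc (a : K) b)) :
    W.localPolynomial O =
      1 - C ((Nat.card (ResidueField O) : ℤ) + 1 -
        Nat.card (short (residue O a) (residue O b)).toAffine.Point) * X +
        C (Nat.card (ResidueField O) : ℤ) * X ^ 2 := by
  rw [localPolynomial, if_pos ((h.good_iff h2 h3).2 hd), h.card_reduction h2 h3 hd]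

open Polynomial in
theorem localPolynomial_split {W : WeierstrassCurve K} (h : (W.minimal O).HasSplitMultiplicativeReduction O) :
    W.localPolynomial O = 1 - X := by
  rw [localPolynomial, if_neg h.toHasMultiplicativeReduction.not_hasGoodReduction, if_pos h]

open Polynomial in
theorem localPolynomial_nonsplit {W : WeierstrassCurve K} (h : (W.minimal O).HasMultiplicativeReduction O)
    (h' : ¬ (W.minimal O).HasSplitMultiplicativeReduction O) :
    W.localPolynomial O = 1 + X := by
  rw [localPolynomial, if_neg h.not_hasGoodReduction, if_neg h', if_pos h]

theorem localPolynomial_additive {W : WeierstrassCurve K} (h : (W.minimal O).HasAdditiveReduction O) :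
    W.localPolynomial O = 1 := by
  rw [localPolynomial, if_neg h.not_hasGoodReduction,
    if_neg fun h' => h.not_hasMultiplicativeReduction _ h'.toHasMultiplicativeReduction,
    if_neg h.not_hasMultiplicativeReduction]

end LocalPolynomial

/-! ### Points on twists over a finite field -/

section TwistCount

open WeierstrassCurve

variable {F : Type*} [Field F]

/-- The points of `y² = x³ + a x + b`. -/
def pointEquiv {a b : F} (h2 : (2 : F) ≠ 0) (hd : disc a b ≠ 0) :
    (short a b).toAffine.Point ≃ Option (Σ x : F, {y : F // y ^ 2 = x ^ 3 + a * x + b}) where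
  toFun
    | .zero => none
    | .some x y h => some ⟨x, y, short_equation.1 h.1⟩
  invFun
    | none => .zero
    | some ⟨x, y, h⟩ => .some x y
      (haveI := short_isElliptic h2 hd
       Affine.equation_iff_nonsingular.1 (short_equation.2 h))
  left_inv := by rintro (_ | _) <;> rfl
  right_inv := by rintro (_ | ⟨x, y, h⟩) <;> rfl

theorem card_short [Fintype F] [DecidableEq F] {a b : F} (h2 : (2 : F) ≠ 0) (hd : disc a b ≠ 0) :
    (Nat.card (short a b).toAffine.Point : ℤ) =
      Nat.card F + 1 + ∑ x : F, quadraticChar F (x ^ 3 + a * x + b) := by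
  have hF : ringChar F ≠ 2 := by
    intro h
    have := ringChar.Nat.cast_ringChar (R := F)
    rw [h] at this
    exact h2 (by exact_mod_cast this)
  rw [Nat.card_congr (pointEquiv h2 hd), Nat.card_eq_fintype_card, Fintype.card_option,
    Fintype.card_sigma, Nat.card_eq_fintype_card]
  have (x : F) : (Fintype.card {y : F // y ^ 2 = x ^ 3 + a * x + b} : ℤ) =
      quadraticChar F (x ^ 3 + a * x + b) + 1 := by
    rw [← quadraticChar_card_sqrts hF, Set.toFinset_card]
    rfl
  push_cast
  rw [Finset.sum_congr rfl fun x _ => this x, Finset.sum_add_distrib]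
  simp
  ring

theorem disc_twist {R : Type*} [CommRing R] (u a b : R) :
    disc (u ^ 2 * a) (u ^ 3 * b) = u ^ 6 * disc a b := by
  simp only [disc]; ring

/-- Substituting ux for x multiplies the cubic by u³, whose quadratic character is -1, so the
character sum changes sign. -/
theorem card_twist_of_not_isSquare [Finite F] {a b u : F} (h2 : (2 : F) ≠ 0) (hd : disc a b ≠ 0)
    (hu : ¬ IsSquare u) :
    (Nat.card (short (u ^ 2 * a) (u ^ 3 * b)).toAffine.Point : ℤ) =
      2 * (Nat.card F + 1) - Nat.card (short a b).toAffine.Point := by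
  classical
  have := Fintype.ofFinite F
  have hu0 : u ≠ 0 := by rintro rfl; exact hu (IsSquare.zero)
  have hd' : disc (u ^ 2 * a) (u ^ 3 * b) ≠ 0 := by
    rw [disc_twist]; exact mul_ne_zero (pow_ne_zero _ hu0) hd
  have hχ : quadraticChar F u = -1 := quadraticChar_neg_one_iff_not_isSquare.2 hu
  rw [card_short h2 hd, card_short h2 hd']
  have : ∑ x : F, quadraticChar F (x ^ 3 + u ^ 2 * a * x + u ^ 3 * b) =
      -∑ x : F, quadraticChar F (x ^ 3 + a * x + b) := by
    rw [← Equiv.sum_comp (Equiv.mulLeft₀ u hu0), ← Finset.sum_neg_distrib]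
    refine Finset.sum_congr rfl fun x _ => ?_
    have : (u * x) ^ 3 + u ^ 2 * a * (u * x) + u ^ 3 * b = u ^ 3 * (x ^ 3 + a * x + b) := by ring
    rw [Equiv.mulLeft₀_apply, this, map_mul, map_pow, hχ]
    ring
  rw [this]
  ring

theorem card_twist_of_isSquare {a b u : F} (h2 : (2 : F) ≠ 0) (hd : disc a b ≠ 0)
    (hu0 : u ≠ 0) (hu : IsSquare u) :
    Nat.card (short (u ^ 2 * a) (u ^ 3 * b)).toAffine.Point =
      Nat.card (short a b).toAffine.Point := by
  obtain ⟨s, rfl⟩ := hu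
  have hs : s ≠ 0 := by rintro rfl; simp at hu0
  have := short_isElliptic h2 hd
  rw [card_point_smul _ (smul_short (Units.mk0 s hs) a b)]
  simp only [Units.val_mk0]
  ring_nf

end TwistCount

/-! ### Finiteness properties of the places of a function field -/

section FunctionField

open IntermediateField IsDedekindDomain.HeightOneSpectrum

variable {k K : Type*} [Field k] [Field K] [Algebra k K]

/-- As K has transcendence degree one, t is algebraic over k(y). So k(y, t) is finite over k(y), and
K is finite over k(y, t), which contains k(t). -/
theorem IsCurveFunctionField.finiteDimensional_adjoin (hK : IsCurveFunctionField k K) {y : K}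
    (hy : Transcendental k y) : FiniteDimensional k⟮y⟯ K := by
  obtain ⟨t, ht, hfin⟩ := hK.exists_finite
  let kyt := restrictScalars k k⟮y⟯⟮t⟯
  let kty := restrictScalars k k⟮t⟯⟮y⟯
  let : Algebra k⟮y⟯ kyt := k⟮y⟯⟮t⟯.algebra
  let : Module k⟮y⟯ kyt := Algebra.toModule
  let : SMul k⟮y⟯ kyt := Algebra.toSMul
  let : Algebra k⟮t⟯ kty := k⟮t⟯⟮y⟯.algebra
  let : Module k⟮t⟯ kty := Algebra.toModule
  let : SMul k⟮t⟯ kty := Algebra.toSMul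
  have halg : IsAlgebraic k⟮y⟯ t :=
    isAlgebraic_adjoin_iff.mpr (.adjoin_singleton ht hy
      (isAlgebraic_adjoin_iff.mp (Algebra.IsAlgebraic.isAlgebraic y)))
  have : FiniteDimensional k⟮y⟯ kyt :=
    adjoin.finiteDimensional (isAlgebraic_iff_isIntegral.mp halg)
  have : FiniteDimensional kyt K := by
    unfold kyt
    rw [adjoin_simple_comm]
    have : IsScalarTower k⟮t⟯ kty K := isScalarTower_mid' k⟮t⟯⟮y⟯
    exact .right k⟮t⟯ kty K
  have : IsScalarTower k⟮y⟯ kyt K := isScalarTower_mid' k⟮y⟯⟮t⟯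
  exact .trans k⟮y⟯ kyt K

theorem Place.ordEq_algebraMap (v : Place k K) {c : k} (hc : c ≠ 0) :
    OrdEq v.ring 0 (algebraMap k K c) := by
  have h : ∀ c : k, OrdGe v.ring 0 (algebraMap k K c) := fun c =>
    ordGe_zero_iff.2 (v.algebraMap_mem c)
  refine (h c).eq_of_not fun h1 => ?_
  have := h1.mul (h c⁻¹)
  rw [← map_mul, mul_inv_cancel₀ hc, map_one] at this
  exact ordEq_one.not_ge (by norm_num) this

theorem Place.ordGe_algebraMap (v : Place k K) (c : k) : OrdGe v.ring 0 (algebraMap k K c) :=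
  ordGe_zero_iff.2 (v.algebraMap_mem c)

theorem IsCurveFunctionField.transcendental (hK : IsCurveFunctionField k K) {v : Place k K} {y : K}
    (hy : OrdGe v.ring 1 y) (h0 : y ≠ 0) : Transcendental k y := by
  intro h
  obtain ⟨c, rfl⟩ := hK.constants y h
  exact (v.ordEq_algebraMap (by rintro rfl; simp at h0)).not_ge (by norm_num) hy

/-- A nonzero polynomial in `y` is a power of `y` times an element that reduces to the same nonzero
constant at all the zeros of `y`. -/
theorem exists_pow_mul_of_polynomial (y : K) {r : Polynomial k} (hr : r ≠ 0) :
    ∃ (n : ℕ) (γ : k), γ ≠ 0 ∧ ∃ s : Polynomial k, Polynomial.aeval y r =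
      y ^ n * (algebraMap k K γ + y * Polynomial.aeval y s) := by
  obtain ⟨s, hs, hX⟩ := Polynomial.exists_eq_pow_rootMultiplicity_mul_and_not_dvd r hr 0
  rw [map_zero, sub_zero] at hs hX
  refine ⟨r.rootMultiplicity 0, s.coeff 0, fun h => hX (Polynomial.X_dvd_iff.2 h), s.divX, ?_⟩
  conv_lhs => rw [hs, ← Polynomial.divX_mul_X_add s]
  rw [map_mul, map_pow, map_add, map_mul, Polynomial.aeval_X, Polynomial.aeval_C]
  ring

theorem Place.ordGe_aeval (v : Place k K) {y : K} (hy : OrdGe v.ring 0 y) (s : Polynomial k) :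
    OrdGe v.ring 0 (Polynomial.aeval y s) := by
  induction s using Polynomial.induction_on' with
  | add p q hp hq => rw [map_add]; exact hp.add hq
  | monomial n c =>
    rw [Polynomial.aeval_monomial]
    exact (v.ordGe_algebraMap c).mul_of_le (hy.pow_of_le (l := 0) (by simp)) (by norm_num)

/-- The function y has a single zero on the projective line, so an element of k(y), divided by a
power of y, takes one and the same nonzero constant value γ at all zeros of y in K. -/
theorem exists_zpow_mul_of_mem_adjoin (y : K) {c : K} (hc : c ∈ k⟮y⟯) (hc0 : c ≠ 0) :
    ∃ (n : ℤ) (γ : k) (e : K), γ ≠ 0 ∧ c = y ^ n * (algebraMap k K γ + e) ∧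
      ∀ v : Place k K, OrdGe v.ring 1 y → OrdGe v.ring 1 e := by
  obtain ⟨r, s, rfl⟩ := (mem_adjoin_simple_iff k c).1 hc
  have hr : r ≠ 0 := by rintro rfl; simp at hc0
  have hs : s ≠ 0 := by rintro rfl; simp at hc0
  obtain ⟨n, γ, hγ, r', hr'⟩ := exists_pow_mul_of_polynomial y hr
  obtain ⟨m, δ, hδ, s', hs'⟩ := exists_pow_mul_of_polynomial y hs
  have hs0 : Polynomial.aeval y s ≠ 0 := by
    intro h; rw [h] at hc0; simp at hc0
  have hm0 : y ^ m ≠ 0 := by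
    intro h; rw [hs', h, zero_mul] at hs0; exact hs0 rfl
  have hd0 : algebraMap k K δ + y * Polynomial.aeval y s' ≠ 0 := by
    intro h; rw [hs', h, mul_zero] at hs0; exact hs0 rfl
  have hδ' : algebraMap k K δ ≠ 0 := by simpa using hδ
  refine ⟨n - m, γ / δ, (algebraMap k K γ + y * Polynomial.aeval y r') /
    (algebraMap k K δ + y * Polynomial.aeval y s') - algebraMap k K (γ / δ),
    div_ne_zero hγ hδ, ?_, fun v hv => ?_⟩
  · rw [hr', hs', add_sub_cancel]
    by_cases hy : y = 0
    · subst hy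
      have hm : m = 0 := by
        by_contra h; exact hm0 (zero_pow h)
      subst hm
      by_cases hn : n = 0
      · subst hn; simp
      · simp [hn]
    · rw [zpow_sub₀ hy, zpow_natCast, zpow_natCast, mul_div_mul_comm]
  · have hy0 : OrdGe v.ring 0 y := hv.mono (by norm_num)
    have h1 : OrdEq v.ring 0 (algebraMap k K δ + y * Polynomial.aeval y s') :=
      (v.ordEq_algebraMap hδ).add_ge (hv.mul_of_le (v.ordGe_aeval hy0 s') (by norm_num))
    have : (algebraMap k K γ + y * Polynomial.aeval y r') /
        (algebraMap k K δ + y * Polynomial.aeval y s') - algebraMap k K (γ / δ) =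
        (y * Polynomial.aeval y r' - algebraMap k K γ / algebraMap k K δ *
          (y * Polynomial.aeval y s')) / (algebraMap k K δ + y * Polynomial.aeval y s') := by
      rw [map_div₀]
      field_simp
      ring
    rw [this]
    refine OrdGe.div_of_le (OrdGe.sub (hv.mul_of_le (v.ordGe_aeval hy0 r') (le_refl _))
      (OrdGe.mul_of_le (m := 0) (n := 1) ?_ (hv.mul_of_le (v.ordGe_aeval hy0 s') (le_refl _))
        (by norm_num))) h1 (by norm_num)
    rw [← map_div₀]
    exact v.ordGe_algebraMap _

/-- Coefficients in `k(y)`, not all zero, can be scaled so as to be integral with constant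
reductions, not all zero, at all the zeros of `y`. -/
theorem exists_scaling {ι : Type*} [Finite ι] {y : K} (hy : y ≠ 0) (c : ι → K)
    (hc : ∀ i, c i ∈ k⟮y⟯) (h0 : ∃ i, c i ≠ 0) :
    ∃ (g : K) (γ : ι → k) (e : ι → K), g ≠ 0 ∧ (∃ i, γ i ≠ 0) ∧
      (∀ i, c i = g * (algebraMap k K (γ i) + e i)) ∧
      ∀ v : Place k K, OrdGe v.ring 1 y → ∀ i, OrdGe v.ring 1 (e i) := by
  classical
  have hch : ∀ i, ∃ (n : ℤ) (γ : k) (e : K), c i ≠ 0 → (γ ≠ 0 ∧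
      c i = y ^ n * (algebraMap k K γ + e) ∧
      ∀ v : Place k K, OrdGe v.ring 1 y → OrdGe v.ring 1 e) := fun i => by
    by_cases hi : c i = 0
    · exact ⟨0, 0, 0, fun h => absurd hi h⟩
    · obtain ⟨n, γ, e, h⟩ := exists_zpow_mul_of_mem_adjoin y (hc i) hi
      exact ⟨n, γ, e, fun _ => h⟩
  choose n γ e h using hch
  -- Dividing by the lowest power of y that occurs keeps the constants at the indices where it is
  -- attained and makes all other coefficients vanish at the zeros of y.
  obtain ⟨i₀, hi₀, hmin⟩ := Set.exists_min_image {i | c i ≠ 0} n (Set.toFinite _) h0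
  refine ⟨y ^ n i₀, fun i => if c i ≠ 0 ∧ n i = n i₀ then γ i else 0,
    fun i => if c i = 0 then 0 else if n i = n i₀ then e i else
      y ^ (n i - n i₀) * (algebraMap k K (γ i) + e i), zpow_ne_zero _ hy, ⟨i₀, ?_⟩, fun i => ?_,
    fun v hv i => ?_⟩
  · beta_reduce; rw [if_pos ⟨hi₀, rfl⟩]; exact (h i₀ hi₀).1
  · by_cases hi : c i = 0
    · simp [hi]
    · by_cases hn : n i = n i₀
      · simp only [hi, hn, ne_eq, not_false_eq_true, and_self, ↓reduceIte]
        rw [← hn, ← (h i hi).2.1]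
      · simp only [hi, hn, not_false_eq_true, ne_eq, and_false, ↓reduceIte, map_zero, zero_add]
        rw [← mul_assoc, ← zpow_add₀ hy, add_sub_cancel, ← (h i hi).2.1]
  · beta_reduce
    split_ifs with h1 h2
    · exact ordGe_zero_right _
    · exact (h i h1).2.2 v hv
    · have hle := hmin i h1
      have hlt : n i₀ < n i := lt_of_le_of_ne hle (Ne.symm h2)
      obtain ⟨j, hj⟩ : ∃ j : ℕ, n i - n i₀ = (j + 1 : ℕ) := ⟨(n i - n i₀ - 1).toNat, by omega⟩
      rw [hj, zpow_natCast]
      exact OrdGe.mul_of_le (hv.pow_of_le (l := 1) (by push_cast; omega))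
        ((v.ordGe_algebraMap _).add (((h i h1).2.2 v hv).mono (by norm_num))) (by norm_num)

/-- Weak approximation. -/
theorem exists_separating {ι : Type*} [Finite ι] (v : ι → Place k K) (hv : Function.Injective v)
    (i : ι) : ∃ x : K, OrdEq (v i).ring 0 x ∧ ∀ j ≠ i, OrdGe (v j).ring 1 x := by
  have hb : (1 : NNReal) < 2 := one_lt_two
  let A (j : ι) : AbsoluteValue K ℝ :=
    (IsDiscreteValuationRing.maximalIdeal (v j).ring).adicAbv hb
  have hlt (j : ι) (x : K) : A j x < 1 ↔ OrdGe (v j).ring 1 x := by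
    rw [← val_lt_one_iff]
    change ((WithZeroMulInt.toNNReal (ne_zero_of_lt hb) (val (v j).ring x) : NNReal) : ℝ) < 1 ↔ _
    rw [← WithZeroMulInt.toNNReal_lt_one_iff hb]
    exact_mod_cast Iff.rfl
  have hle (j : ι) (x : K) : A j x ≤ 1 ↔ x ∈ (v j).ring := by
    rw [← ordGe_zero_iff]
    have : OrdGe (v j).ring 0 x ↔ val (v j).ring x ≤ 1 := by simp [OrdGe]
    rw [this, ← WithZeroMulInt.toNNReal_le_one_iff hb]
    change ((WithZeroMulInt.toNNReal (ne_zero_of_lt hb) (val (v j).ring x) : NNReal) : ℝ) ≤ 1 ↔ _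
    exact_mod_cast Iff.rfl
  obtain ⟨z, hz, hz'⟩ := AbsoluteValue.exists_one_lt_lt_one_pi_of_not_isEquiv (v := A)
    (fun j => by
      obtain ⟨π, hπ⟩ := exists_uniformizer (v j).ring
      exact ⟨π, hπ.ne_zero, ((hlt j π).2 hπ.ge).ne⟩)
    (fun j l hjl he => hjl <| hv <| Place.ext <| by
      ext x
      rw [← hle, ← hle]
      exact he.le_one_iff) i
  have hz1 : ¬ OrdGe (v i).ring 0 z := by
    rw [ordGe_zero_iff, ← hle]; exact not_le.2 hz
  obtain ⟨n, hn, hzn⟩ := exists_ordEq_of_not_ge hz1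
  -- As z has a pole at `v i` and zeros at the other places, z/(1 + z) is 1 modulo the maximal ideal
  -- at `v i` and lies in the maximal ideal elsewhere.
  refine ⟨z / (1 + z), ?_, fun j hj => ?_⟩
  · refine (hzn.div (n := n) ?_).congr (by ring)
    rw [add_comm]
    exact hzn.add_ge (ordEq_one.ge.mono (by omega))
  · have h1 := (hlt j z).1 (hz' j hj)
    exact (h1.div (ordEq_one.add_ge (h1.mono (by norm_num)))).mono (by norm_num)

theorem not_ordGe_sum {O : ValuationSubring K} [IsDiscreteValuationRing O] {ι : Type*} [Fintype ι]
    (i : ι) (x : ι → K) (hi : OrdEq O 0 (x i)) (hj : ∀ j ≠ i, OrdGe O 1 (x j)) :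
    ∑ j, x j ≠ 0 := by
  classical
  rw [← Finset.add_sum_erase _ _ (Finset.mem_univ i)]
  refine (hi.add_ge ?_).ne_zero
  have : ∀ s : Finset ι, i ∉ s → OrdGe O (0 + 1) (∑ j ∈ s, x j) := by
    intro s
    induction s using Finset.induction_on with
    | empty => intro _; simpa using ordGe_zero_right _
    | insert a s ha ih =>
      intro h
      rw [Finset.sum_insert ha]
      rw [Finset.mem_insert, not_or] at h
      exact (hj a (Ne.symm h.1)).add (ih h.2)
  exact this _ (Finset.notMem_erase _ _)

/-- After scaling, a relation has coefficients with constant values at the zeros of y, not all zero.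
At a place whose own coefficient survives, exactly one term of the sum is a unit. -/
theorem linearIndependent_separating {ι : Type*} [Finite ι] {y : K} (hy : y ≠ 0)
    (v : ι → Place k K) (hyv : ∀ i, OrdGe (v i).ring 1 y) (x : ι → K)
    (hx : ∀ i, OrdEq (v i).ring 0 (x i)) (hx' : ∀ i, ∀ j ≠ i, OrdGe (v i).ring 1 (x j)) :
    LinearIndependent k⟮y⟯ x := by
  have := Fintype.ofFinite ι
  rw [Fintype.linearIndependent_iff]
  intro c hc
  by_contra! h0
  obtain ⟨g, γ, e, hg, ⟨i, hi⟩, he, hev⟩ := exists_scaling hy (fun i => (c i : K))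
    (fun i => (c i).2) (h0.imp fun i h => by simpa using h)
  have hsum : g * ∑ i, (algebraMap k K (γ i) + e i) * x i = 0 := by
    rw [Finset.mul_sum, ← hc]
    refine Finset.sum_congr rfl fun j _ => ?_
    rw [← mul_assoc, ← he j]
    rfl
  refine not_ordGe_sum (O := (v i).ring) i _ ?_ ?_ ((mul_eq_zero.1 hsum).resolve_left hg)
  · exact (((v i).ordEq_algebraMap hi).add_ge (hev _ (hyv i) i)).unit_mul (hx i)
  · intro j hj
    exact OrdGe.mul_of_le (((v i).ordGe_algebraMap _).add ((hev _ (hyv i) j).mono zero_le_one))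
      (hx' i j hj) (by norm_num)

/-- Any finite set of zeros of y yields as many elements independent over k(y), so there are at most
[K : k(y)] zeros. -/
theorem IsCurveFunctionField.finite_zeros (hK : IsCurveFunctionField k K) {y : K} (hy : y ≠ 0) :
    {v : Place k K | OrdGe v.ring 1 y}.Finite := by
  by_contra hinf
  obtain ⟨v₀, hv₀⟩ := (Set.Infinite.nonempty hinf)
  have := hK.finiteDimensional_adjoin (hK.transcendental hv₀ hy)
  obtain ⟨s, hs, hcard⟩ := Set.Infinite.exists_subset_card_eq hinf
    (Module.finrank k⟮y⟯ K + 1)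
  have hsep := fun i : s => exists_separating (fun i : s => (i : Place k K))
    Subtype.val_injective i
  choose x hx hx' using hsep
  have hli := linearIndependent_separating hy (fun i : s => (i : Place k K))
    (fun i => hs i.2) x hx fun i j hj => hx' j i hj.symm
  have := hli.fintype_card_le_finrank
  rw [Fintype.card_coe] at this
  omega

theorem IsCurveFunctionField.finite_not_unit (hK : IsCurveFunctionField k K) {y : K} (hy : y ≠ 0) :
    {v : Place k K | ¬ OrdEq v.ring 0 y}.Finite := by
  refine ((hK.finite_zeros hy).union (hK.finite_zeros (inv_ne_zero hy))).subset fun v hv => ?_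
  obtain ⟨n, hn⟩ := exists_ordEq (O := v.ring) hy
  rcases lt_trichotomy n 0 with h | h | h
  · right; exact hn.inv.ge.mono (by omega)
  · exact absurd (h ▸ hn) hv
  · left; exact hn.ge.mono (by omega)

theorem Place.algebraMap_residueField (v : Place k K) (c : k) :
    algebraMap k v.residueField c =
      IsLocalRing.residue v.ring ⟨algebraMap k K c, v.algebraMap_mem c⟩ := rfl

/-- The same scaling argument at one place: lifts of a k-basis of the residue field are independent
over k(y) for a uniformizer y. -/
theorem IsCurveFunctionField.finite_residueField (hK : IsCurveFunctionField k K) (v : Place k K) :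
    Module.Finite k v.residueField := by
  obtain ⟨y, hy⟩ := exists_uniformizer v.ring
  have hfin := hK.finiteDimensional_adjoin (hK.transcendental hy.ge hy.ne_zero)
  let B := Module.Basis.ofVectorSpace k v.residueField
  have hlift : ∀ i, ∃ x : v.ring, IsLocalRing.residue v.ring x = B i :=
    fun i => IsLocalRing.residue_surjective _
  choose x hx using hlift
  have hli : LinearIndependent k⟮y⟯ (fun i => (x i : K)) := by
    rw [linearIndependent_iff']
    intro s c hc
    by_contra! h0
    obtain ⟨i₁, hi₁, hne⟩ := h0
    obtain ⟨g, γ, e, hg, ⟨i, hi⟩, he, hev⟩ := exists_scaling hy.ne_zero (fun i : s => (c i : K))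
      (fun i => (c i).2) ⟨⟨i₁, hi₁⟩, by simpa using hne⟩
    have hsum : g * ∑ i : s, (algebraMap k K (γ i) + e i) * x i = 0 := by
      rw [Finset.mul_sum, ← hc, ← Finset.sum_coe_sort s]
      refine Finset.sum_congr rfl fun j _ => ?_
      rw [← mul_assoc, ← he j]
      rfl
    have hsum' := (mul_eq_zero.1 hsum).resolve_left hg
    have hmem : ∀ i : s, algebraMap k K (γ i) + e i ∈ v.ring := fun i =>
      ordGe_zero_iff.1 ((v.ordGe_algebraMap _).add ((hev v hy.ge i).mono zero_le_one))
    have hO : ∑ i : s, (⟨algebraMap k K (γ i) + e i, hmem i⟩ : v.ring) * x i = 0 := by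
      apply Subtype.ext
      push_cast
      exact hsum'
    have hres := congrArg (IsLocalRing.residue v.ring) hO
    rw [map_sum, map_zero] at hres
    have hterm : ∀ i : s, IsLocalRing.residue v.ring
        ((⟨algebraMap k K (γ i) + e i, hmem i⟩ : v.ring) * x i) = γ i • B i := fun i => by
      rw [map_mul, hx, Algebra.smul_def, v.algebraMap_residueField]
      congr 1
      rw [residue_eq_iff_ordGe]
      simpa using hev v hy.ge i
    simp only [hterm] at hres
    have := Fintype.linearIndependent_iff.1
      (B.linearIndependent.comp (Subtype.val : s → _) Subtype.val_injective) γ hres i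
    exact hi this
  have : Finite (Module.Basis.ofVectorSpaceIndex k v.residueField) := hli.finite
  exact Module.Finite.of_basis B

theorem IsCurveFunctionField.deg_pos (hK : IsCurveFunctionField k K) (v : Place k K) :
    0 < v.deg := by
  have := hK.finite_residueField v
  exact Module.finrank_pos

theorem IsCurveFunctionField.finite [Finite k] (hK : IsCurveFunctionField k K) (v : Place k K) :
    Finite v.residueField := by
  have := hK.finite_residueField v
  exact Module.finite_of_finite k

theorem IsCurveFunctionField.card_residueField [Finite k] (hK : IsCurveFunctionField k K)
    (v : Place k K) : Nat.card v.residueField = Nat.card k ^ v.deg := by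
  have := hK.finite_residueField v
  exact Module.natCard_eq_pow_finrank

/-- At a place of degree e ≥ 1 every residue satisfies X^(q^e) = X. So the place is a pole of t or a
zero of the nonzero function t^(q^e) - t. -/
theorem IsCurveFunctionField.finite_deg_le [Finite k] (hK : IsCurveFunctionField k K) (d : ℕ) :
    {v : Place k K | v.deg ≤ d}.Finite := by
  obtain ⟨t, ht, -⟩ := hK.exists_finite
  have ht0 : t ≠ 0 := fun h => ht (h ▸ isAlgebraic_zero)
  have hne : ∀ e : ℕ, e ≠ 0 → t ^ (Nat.card k ^ e) - t ≠ 0 := by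
    intro e he h
    refine ht ⟨Polynomial.X ^ (Nat.card k ^ e) - Polynomial.X, ?_, by simpa using h⟩
    exact FiniteField.X_pow_card_pow_sub_X_ne_zero k he Finite.one_lt_card
  refine (((Set.finite_Icc 1 d).biUnion fun e he => hK.finite_zeros
    (hne e (by have := he.1; omega))).union (hK.finite_zeros (inv_ne_zero ht0))).subset
    fun v hv => ?_
  by_cases h0 : OrdGe v.ring 0 t
  · left
    have hd := hK.deg_pos v
    refine Set.mem_biUnion (x := v.deg) ⟨hd, hv⟩ ?_
    have hfin := hK.finite v
    have := Fintype.ofFinite v.residueField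
    let t' : v.ring := ⟨t, ordGe_zero_iff.1 h0⟩
    have := FiniteField.pow_card (IsLocalRing.residue v.ring t')
    rw [← Nat.card_eq_fintype_card, hK.card_residueField, ← map_pow, residue_eq_iff_ordGe] at this
    exact this
  · right
    obtain ⟨n, hn, h⟩ := exists_ordEq_of_not_ge h0
    exact h.inv.ge.mono (by omega)

end FunctionField

/-! ### Places of a quadratic extension -/

section Quadratic

open IsLocalRing

variable {K L : Type*} [Field K] [Field L] [Algebra K L]

/-- `L` is generated over `K` by the square root `θ` of `f`. -/
structure IsSqrtGenerator (θ : L) (f : K) : Prop where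
  sq : θ ^ 2 = algebraMap K L f
  exists_eq : ∀ z : L, ∃ x y : K, z = algebraMap K L x + algebraMap K L y * θ

theorem IsSqrtGenerator.of_adjoin {θ : L} {f : K} (hθ : θ ^ 2 = algebraMap K L f)
    (hgen : IntermediateField.adjoin K {θ} = ⊤) : IsSqrtGenerator θ f where
  sq := hθ
  exists_eq z := by
    have hint : IsIntegral K θ := by
      refine IsIntegral.of_pow (n := 2) (by norm_num) ?_
      rw [hθ]; exact isIntegral_algebraMap
    have hz : z ∈ Algebra.adjoin K {θ} := by
      rw [← IntermediateField.adjoin_simple_toSubalgebra_of_isAlgebraic hint.isAlgebraic, hgen]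
      trivial
    induction hz using Algebra.adjoin_induction with
    | mem x hx => exact ⟨0, 1, by simpa using hx⟩
    | algebraMap r => exact ⟨r, 0, by simp⟩
    | add x y _ _ hx hy =>
      obtain ⟨a, b, rfl⟩ := hx
      obtain ⟨c, d, rfl⟩ := hy
      exact ⟨a + c, b + d, by simp only [map_add]; ring⟩
    | mul x y _ _ hx hy =>
      obtain ⟨a, b, rfl⟩ := hx
      obtain ⟨c, d, rfl⟩ := hy
      exact ⟨a * c + b * d * f, a * d + b * c, by
        simp only [map_add, map_mul]; linear_combination algebraMap K L b * algebraMap K L d * hθ⟩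

/-- Allows f to be replaced, separately at each place, by a unit or a uniformizer. -/
theorem IsSqrtGenerator.scale {θ : L} {f f₀ g : K} (h : IsSqrtGenerator θ f) (hg : g ≠ 0)
    (hf : f = f₀ * g ^ 2) : IsSqrtGenerator (θ / algebraMap K L g) f₀ where
  sq := by
    have hg' : algebraMap K L g ≠ 0 := by simpa using hg
    rw [div_pow, h.sq, hf, map_mul, map_pow]
    field_simp
  exists_eq z := by
    have hg' : algebraMap K L g ≠ 0 := by simpa using hg
    obtain ⟨x, y, rfl⟩ := h.exists_eq z
    exact ⟨x, y * g, by rw [map_mul]; field_simp⟩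

theorem IsSqrtGenerator.unique {θ : L} {f : K} (h : IsSqrtGenerator θ f) (hf : ¬ IsSquare f)
    {x y x' y' : K}
    (e : algebraMap K L x + algebraMap K L y * θ = algebraMap K L x' + algebraMap K L y' * θ) :
    x = x' ∧ y = y' := by
  have hy : y = y' := by
    by_contra hne
    have hd : y - y' ≠ 0 := sub_ne_zero.2 hne
    have hd' : algebraMap K L (y - y') ≠ 0 := (map_ne_zero _).2 hd
    have hθ : θ = algebraMap K L ((x' - x) / (y - y')) := by
      rw [map_div₀, eq_div_iff hd', map_sub, map_sub]
      linear_combination e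
    refine hf ⟨(x' - x) / (y - y'), (algebraMap K L).injective (h.sq.symm.trans ?_)⟩
    rw [pow_two, map_mul]
    exact congrArg₂ _ hθ hθ
  subst hy
  exact ⟨(algebraMap K L).injective (by linear_combination e), rfl⟩

theorem IsSqrtGenerator.exists_conj {θ : L} {f : K} (h : IsSqrtGenerator θ f)
    (hf : ¬ IsSquare f) :
    ∃ σ : L →+* L, (∀ x, σ (algebraMap K L x) = algebraMap K L x) ∧ σ θ = -θ := by
  choose X Y hXY using h.exists_eq
  have key : ∀ x y : K, algebraMap K L (X (algebraMap K L x + algebraMap K L y * θ)) -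
      algebraMap K L (Y (algebraMap K L x + algebraMap K L y * θ)) * θ =
      algebraMap K L x - algebraMap K L y * θ := fun x y => by
    have := h.unique hf (hXY (algebraMap K L x + algebraMap K L y * θ))
    rw [← this.1, ← this.2]
  have key' : ∀ (z : L) (x y : K), z = algebraMap K L x + algebraMap K L y * θ →
      algebraMap K L (X z) - algebraMap K L (Y z) * θ =
      algebraMap K L x - algebraMap K L y * θ := by
    rintro z x y rfl; exact key x y
  refine ⟨⟨⟨⟨fun z => algebraMap K L (X z) - algebraMap K L (Y z) * θ, ?_⟩, ?_⟩, ?_, ?_⟩, ?_, ?_⟩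
  · simpa using key' 1 1 0 (by simp)
  · intro z w
    refine (key' _ (X z * X w + Y z * Y w * f) (X z * Y w + Y z * X w) ?_).trans ?_
    · conv_lhs => rw [hXY z, hXY w]
      simp only [map_add, map_mul]
      linear_combination algebraMap K L (Y z) * algebraMap K L (Y w) * h.sq
    · simp only [map_add, map_mul]
      linear_combination -algebraMap K L (Y z) * algebraMap K L (Y w) * h.sq
  · simpa using key' 0 0 0 (by simp)
  · intro z w
    refine (key' _ (X z + X w) (Y z + Y w) ?_).trans ?_
    · conv_lhs => rw [hXY z, hXY w]
      simp only [map_add]; ring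
    · simp only [map_add]; ring
  · intro x
    simpa using key' (algebraMap K L x) x 0 (by simp)
  · simpa using key' θ 0 1 (by simp)

section Valuation

variable {O : ValuationSubring K} [IsDiscreteValuationRing O] {A : ValuationSubring L}

theorem valuation_comap_le_one_iff (hA : A.comap (algebraMap K L) = O) {x : K} :
    A.valuation (algebraMap K L x) ≤ 1 ↔ OrdGe O 0 x := by
  rw [A.valuation_le_one_iff, ordGe_zero_iff, ← hA, ValuationSubring.mem_comap]

theorem valuation_comap_eq_one (hA : A.comap (algebraMap K L) = O) {x : K} (hx : OrdEq O 0 x) :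
    A.valuation (algebraMap K L x) = 1 := by
  refine le_antisymm ((valuation_comap_le_one_iff hA).2 hx.ge) ?_
  have h := (valuation_comap_le_one_iff hA).2 hx.inv.ge
  rw [map_inv₀, map_inv₀] at h
  have hne : A.valuation (algebraMap K L x) ≠ 0 := by
    rw [Valuation.ne_zero_iff]; simpa using hx.ne_zero
  exact (inv_le_one₀ (zero_lt_iff.2 hne)).1 h

theorem valuation_comap_lt_one (hA : A.comap (algebraMap K L) = O) {x : K} (hx : OrdGe O 1 x) :
    A.valuation (algebraMap K L x) < 1 := by
  refine lt_of_le_of_ne ((valuation_comap_le_one_iff hA).2 (hx.mono zero_le_one)) fun h => ?_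
  have h' : A.valuation (algebraMap K L x⁻¹) ≤ 1 := by
    rw [map_inv₀, map_inv₀, h, inv_one]
  have h0 : x ≠ 0 := by rintro rfl; simp at h
  have := hx.mul ((valuation_comap_le_one_iff hA).1 h')
  rw [mul_inv_cancel₀ h0] at this
  exact ordEq_one.not_ge (by norm_num) this

theorem valuation_comap_eq_zpow (hA : A.comap (algebraMap K L) = O) {π x : K} {n : ℤ}
    (hπ : OrdEq O 1 π) (hx : OrdEq O n x) :
    A.valuation (algebraMap K L x) = A.valuation (algebraMap K L π) ^ n := by
  have h : OrdEq O 0 (x / π ^ n) := (hx.div (hπ.zpow n)).congr (by ring)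
  have := valuation_comap_eq_one hA h
  rw [map_div₀, map_div₀, map_zpow₀, map_zpow₀, div_eq_one_iff_eq] at this
  · exact this
  · refine zpow_ne_zero _ ?_
    rw [Valuation.ne_zero_iff]; simpa using hπ.ne_zero

variable (L) in
-- A valuation ring of L dominating the image of O exists by maximality of local subrings. If it
-- contains x, and x⁻¹ lies in O, then x⁻¹ is a unit above, hence a unit of O by domination; so
-- nothing new is added over K.
theorem exists_comap_eq (O : ValuationSubring K) : ∃ A : ValuationSubring L, A.comap (algebraMap K L) = O := by
  obtain ⟨B, hle, hloc⟩ := LocalSubring.exists_le_valuationSubring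
    (LocalSubring.range ((algebraMap K L).comp O.subtype))
  have hO : ∀ x ∈ O, algebraMap K L x ∈ B := fun x hx => hle ⟨⟨x, hx⟩, rfl⟩
  refine ⟨B, ?_⟩
  ext x
  rw [ValuationSubring.mem_comap]
  refine ⟨fun hx => ?_, hO x⟩
  rcases O.mem_or_inv_mem x with h | h
  · exact h
  by_cases h0 : x = 0
  · rw [h0]; exact O.zero_mem
  have hmem : algebraMap K L x⁻¹ ∈
      (LocalSubring.range ((algebraMap K L).comp O.subtype)).toSubring := ⟨⟨x⁻¹, h⟩, rfl⟩
  have hu : IsUnit (Subring.inclusion hle ⟨algebraMap K L x⁻¹, hmem⟩) := by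
    refine IsUnit.of_mul_eq_one (⟨algebraMap K L x, hx⟩ : B.toLocalSubring.toSubring) ?_
    apply Subtype.ext
    change algebraMap K L x⁻¹ * algebraMap K L x = 1
    rw [← map_mul, inv_mul_cancel₀ h0, map_one]
  obtain ⟨⟨y, ⟨z, hz⟩⟩, hy⟩ := (hloc.map_nonunit _ hu).exists_right_inv
  have hy' : algebraMap K L x⁻¹ * y = 1 := congrArg Subtype.val hy
  have hz' : algebraMap K L (z : K) = y := hz
  rw [← hz', ← map_mul, ← map_one (algebraMap K L)] at hy'
  have : (z : K) = x := by
    have := (algebraMap K L).injective hy'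
    field_simp at this
    exact this
  rw [← this]; exact z.2

end Valuation

/-- If every nonzero element is, up to units, a power of `ϖ`, then the valuation ring is discrete
with uniformizer `ϖ`. -/
theorem isDVR_of_zpow {A : ValuationSubring L} {ϖ : L} (h0 : ϖ ≠ 0) (h1 : A.valuation ϖ < 1)
    (h : ∀ z : L, z ≠ 0 → ∃ n : ℤ, A.valuation z = A.valuation ϖ ^ n) :
    IsDiscreteValuationRing A := by
  have ht : 0 < A.valuation ϖ := zero_lt_iff.2 ((Valuation.ne_zero_iff _).2 h0)
  have hanti := zpow_right_strictAnti₀ ht h1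
  have hnn : ∀ {n : ℤ}, A.valuation ϖ ^ n ≤ 1 → 0 ≤ n := fun {n} hn => by
    rw [← zpow_zero (A.valuation ϖ)] at hn
    exact hanti.le_iff_ge.1 hn
  have hϖ : ϖ ∈ A := (A.valuation_le_one_iff _).1 h1.le
  refine IsDiscreteValuationRing.ofHasUnitMulPowIrreducibleFactorization
    ⟨⟨ϖ, hϖ⟩, ⟨fun hu => ?_, fun a b hab => ?_⟩, fun {x} hx => ?_⟩
  · rw [A.valuation_eq_one_iff] at hu
    exact h1.ne hu
  · have hab' : ϖ = (a : L) * b := congrArg Subtype.val hab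
    have ha : (a : L) ≠ 0 := by rintro h; rw [h, zero_mul] at hab'; exact h0 hab'
    have hb : (b : L) ≠ 0 := by rintro h; rw [h, mul_zero] at hab'; exact h0 hab'
    obtain ⟨i, hi⟩ := h _ ha
    obtain ⟨j, hj⟩ := h _ hb
    have hi0 := hnn (hi ▸ A.valuation_le_one a)
    have hj0 := hnn (hj ▸ A.valuation_le_one b)
    have hij : i + j = 1 := by
      apply hanti.injective
      simp only [zpow_one]
      rw [zpow_add₀ ht.ne', ← hi, ← hj, ← map_mul, ← hab']
    rw [A.valuation_eq_one_iff, A.valuation_eq_one_iff, hi, hj]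
    rcases Int.le_iff_lt_or_eq.1 hi0 with hlt | rfl
    · right
      obtain rfl : j = 0 := by omega
      simp
    · left; simp
  · have hx' : (x : L) ≠ 0 := by simpa using hx
    obtain ⟨n, hn⟩ := h _ hx'
    have hn0 := hnn (hn ▸ A.valuation_le_one x)
    lift n to ℕ using hn0
    refine ⟨n, ?_⟩
    rw [zpow_natCast, ← map_pow] at hn
    obtain ⟨u, hu⟩ := (A.valuation_eq_iff _ _).1 hn
    refine ⟨u, Subtype.ext ?_⟩
    push_cast
    rw [← hu, mul_comm]

theorem ordEq_one_of_zpow {A : ValuationSubring L} [IsDiscreteValuationRing A] {ϖ : L}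
    (h0 : ϖ ≠ 0) (h1 : A.valuation ϖ < 1)
    (h : ∀ z : L, z ≠ 0 → ∃ n : ℤ, A.valuation z = A.valuation ϖ ^ n) : OrdEq A 1 ϖ := by
  obtain ⟨m, hm⟩ := exists_ordEq (O := A) h0
  obtain ⟨z, hz⟩ := exists_uniformizer A
  obtain ⟨n, hn⟩ := h z hz.ne_zero
  rw [← map_zpow₀] at hn
  obtain ⟨u, hu⟩ := (A.valuation_eq_iff _ _).1 hn
  have hu0 : OrdEq A 0 (u : L) := (isUnit_iff_ordEq (u : A)).1 u.isUnit
  have h1n : 1 = n * m := by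
    have := hz.unique (hu ▸ hu0.mul (hm.zpow n))
    omega
  have hm1 : 1 ≤ m := by
    have : (⟨ϖ, (A.valuation_le_one_iff _).1 h1.le⟩ : A) ∈ maximalIdeal A :=
      (A.valuation_lt_one_iff _).2 h1
    rw [mem_maximalIdeal_iff] at this
    exact hm.le_of_ge this
  have : m = 1 := by
    have := Int.eq_one_or_neg_one_of_mul_eq_one' h1n.symm
    omega
  exact this ▸ hm

/-- Membership of z in either ring amounts to n ≥ 0. This is the source of all uniqueness statements
for places above v. -/
theorem valuationSubring_eq_of_zpow {A B : ValuationSubring L} {ϖ : L} (h0 : ϖ ≠ 0)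
    (hA : A.valuation ϖ < 1) (hB : B.valuation ϖ < 1)
    (h : ∀ z : L, z ≠ 0 → ∃ n : ℤ, A.valuation z = A.valuation ϖ ^ n ∧
      B.valuation z = B.valuation ϖ ^ n) : A = B := by
  have hiff : ∀ C : ValuationSubring L, C.valuation ϖ < 1 → ∀ n : ℤ,
      C.valuation ϖ ^ n ≤ 1 ↔ 0 ≤ n := fun C hC n => by
    rw [← zpow_zero (C.valuation ϖ)]
    exact (zpow_right_strictAnti₀ (zero_lt_iff.2 ((Valuation.ne_zero_iff _).2 h0)) hC).le_iff_ge
  ext z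
  by_cases hz : z = 0
  · rw [hz]; exact iff_of_true A.zero_mem B.zero_mem
  · obtain ⟨n, h1, h2⟩ := h z hz
    rw [← A.valuation_le_one_iff, ← B.valuation_le_one_iff, h1, h2, hiff A hA, hiff B hB]

end Quadratic

/-! ### Valuations of x + yθ above ramified, inert and split places -/

section QuadraticPlaces

open IsLocalRing

variable {K L : Type*} [Field K] [Field L] [Algebra K L]
  {O : ValuationSubring K} [IsDiscreteValuationRing O] {A : ValuationSubring L}

/-- Relative to θ the term x has even exponent and yθ odd exponent, so no cancellation occurs. The
exponent does not depend on A, which yields discreteness and uniqueness at once. -/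
theorem exists_zpow_of_ramified {θ : L} {π : K} (h : IsSqrtGenerator θ π)
    (hπ : OrdEq O 1 π) {z : L} (hz : z ≠ 0) :
    ∃ n : ℤ, ∀ A : ValuationSubring L, A.comap (algebraMap K L) = O →
      A.valuation z = A.valuation θ ^ n := by
  have hsq : ∀ A : ValuationSubring L, A.valuation (algebraMap K L π) = A.valuation θ ^ 2 :=
    fun A => by rw [← h.sq, map_pow]
  have hev : ∀ {x : K} {i : ℤ}, OrdEq O i x → ∀ A : ValuationSubring L,
      A.comap (algebraMap K L) = O →
      A.valuation (algebraMap K L x) = A.valuation θ ^ (2 * i) := fun {x i} hx A hA => by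
    rw [valuation_comap_eq_zpow hA hπ hx, hsq, zpow_mul]; rfl
  have hθ0 : θ ≠ 0 := by
    rintro rfl
    have := h.sq
    simp only [ne_eq, OfNat.ofNat_ne_zero, not_false_eq_true, zero_pow] at this
    exact hπ.ne_zero (by simpa using this.symm)
  have hod : ∀ {y : K} {j : ℤ}, OrdEq O j y → ∀ A : ValuationSubring L,
      A.comap (algebraMap K L) = O →
      A.valuation (algebraMap K L y * θ) = A.valuation θ ^ (2 * j + 1) := fun {y j} hy A hA => by
    rw [map_mul, hev hy A hA, zpow_add_one₀]
    exact (Valuation.ne_zero_iff _).2 hθ0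
  have hlt : ∀ A : ValuationSubring L, A.comap (algebraMap K L) = O → A.valuation θ < 1 :=
    fun A hA => by
      have := valuation_comap_lt_one hA hπ.ge
      rw [hsq] at this
      exact lt_of_pow_lt_pow_left₀ 2 zero_le_one (by simpa using this)
  obtain ⟨x, y, rfl⟩ := h.exists_eq z
  by_cases hx : x = 0
  · by_cases hy : y = 0
    · simp [hx, hy] at hz
    · obtain ⟨j, hj⟩ := exists_ordEq (O := O) hy
      refine ⟨2 * j + 1, fun A hA => ?_⟩
      rw [hx, map_zero, zero_add]
      exact hod hj A hA
  · obtain ⟨i, hi⟩ := exists_ordEq (O := O) hx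
    by_cases hy : y = 0
    · refine ⟨2 * i, fun A hA => ?_⟩
      rw [hy, map_zero, zero_mul, add_zero]
      exact hev hi A hA
    · obtain ⟨j, hj⟩ := exists_ordEq (O := O) hy
      refine ⟨min (2 * i) (2 * j + 1), fun A hA => ?_⟩
      have hanti := zpow_right_strictAnti₀ (zero_lt_iff.2 ((Valuation.ne_zero_iff _).2 hθ0))
        (hlt A hA)
      rcases lt_or_gt_of_ne (show 2 * i ≠ 2 * j + 1 by omega) with hij | hij
      · rw [min_eq_left hij.le, Valuation.map_add_eq_of_lt_left, hev hi A hA]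
        rw [hev hi A hA, hod hj A hA]
        exact hanti hij
      · rw [min_eq_right hij.le, Valuation.map_add_eq_of_lt_right, hod hj A hA]
        rw [hev hi A hA, hod hj A hA]
        exact hanti hij

/-- Writing `x + y θ` as a power of the uniformizer times a primitive vector. -/
theorem exists_primitive {π x y : K} (hπ : OrdEq O 1 π) (h : x ≠ 0 ∨ y ≠ 0) :
    ∃ (n : ℤ) (x' y' : K), x = π ^ n * x' ∧ y = π ^ n * y' ∧ OrdGe O 0 x' ∧ OrdGe O 0 y' ∧
      (OrdEq O 0 x' ∨ OrdEq O 0 y') := by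
  have hπ0 := hπ.ne_zero
  have key : ∀ n : ℤ, OrdGe O n x → OrdGe O n y → (OrdEq O n x ∨ OrdEq O n y) →
      ∃ (n : ℤ) (x' y' : K), x = π ^ n * x' ∧ y = π ^ n * y' ∧ OrdGe O 0 x' ∧ OrdGe O 0 y' ∧
      (OrdEq O 0 x' ∨ OrdEq O 0 y') := fun n hx hy hxy => by
    have hn := hπ.zpow n
    refine ⟨n, x / π ^ n, y / π ^ n, ?_, ?_, hx.div_of_le hn (by omega),
      hy.div_of_le hn (by omega), hxy.imp (fun h => (h.div hn).congr (by omega))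
      (fun h => (h.div hn).congr (by omega))⟩ <;>
    · rw [mul_div_cancel₀]; exact hn.ne_zero
  by_cases hx : x = 0
  · obtain ⟨j, hj⟩ := exists_ordEq (O := O) (h.resolve_left (not_not.2 hx))
    exact key j (hx ▸ ordGe_zero_right _) hj.ge (Or.inr hj)
  · obtain ⟨i, hi⟩ := exists_ordEq (O := O) hx
    by_cases hi' : OrdGe O i y
    · exact key i hi.ge hi' (Or.inl hi)
    · obtain ⟨j, hji, hj⟩ := exists_ordEq_of_not_ge hi'
      exact key j (hi.ge.mono hji.le) hj.ge (Or.inr hj)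

theorem IsSqrtGenerator.valuation_eq_one {θ : L} {u : K} (h : IsSqrtGenerator θ u)
    (hu : OrdEq O 0 u) (hA : A.comap (algebraMap K L) = O) : A.valuation θ = 1 := by
  have := valuation_comap_eq_one hA hu
  rw [← h.sq, map_pow] at this
  rcases lt_trichotomy (A.valuation θ) 1 with hlt | heq | hgt
  · exact absurd this (pow_lt_one₀ zero_le hlt two_ne_zero).ne
  · exact heq
  · exact absurd this (one_lt_pow₀ hgt two_ne_zero).ne'

theorem valuation_le_one_of_integral {θ : L} (hθ : A.valuation θ ≤ 1)
    (hA : A.comap (algebraMap K L) = O) {x y : K} (hx : OrdGe O 0 x) (hy : OrdGe O 0 y) :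
    A.valuation (algebraMap K L x + algebraMap K L y * θ) ≤ 1 := by
  refine (A.valuation.map_add _ _).trans (max_le ((valuation_comap_le_one_iff hA).2 hx) ?_)
  rw [map_mul]
  exact mul_le_one' ((valuation_comap_le_one_iff hA).2 hy) hθ

/-- The norm of a primitive vector is a unit if `u` is not a square modulo the maximal ideal. -/
theorem ordEq_norm_of_inert {u x y : K} (hu : OrdEq O 0 u)
    (hns : ∀ s : K, OrdGe O 0 s → ¬ OrdGe O 1 (s ^ 2 - u)) (hx : OrdGe O 0 x) (hy : OrdGe O 0 y)
    (hxy : OrdEq O 0 x ∨ OrdEq O 0 y) : OrdEq O 0 (x ^ 2 - u * y ^ 2) := by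
  have h0 : OrdGe O 0 (x ^ 2 - u * y ^ 2) :=
    (hx.pow_of_le (by norm_num)).sub (hu.unit_mul_ge (hy.pow_of_le (by norm_num)))
  refine h0.eq_of_not fun h1 => ?_
  rcases hy.eq_or with hy0 | hy1
  · refine hns (x / y) (hx.div_of_le hy0 (by norm_num)) ?_
    have : (x / y) ^ 2 - u = (x ^ 2 - u * y ^ 2) / y ^ 2 := by
      have := hy0.ne_zero
      field_simp
    rw [this]
    exact h1.div_of_le (hy0.pow 2) (by norm_num)
  · have hx0 := hxy.resolve_right fun h => h.not_ge (by norm_num) hy1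
    have : OrdGe O 1 (x ^ 2) := by
      have : x ^ 2 = (x ^ 2 - u * y ^ 2) + u * y ^ 2 := by ring
      rw [this]
      exact h1.add (hu.unit_mul_ge (hy1.pow_of_le (by norm_num)))
    exact (hx0.pow 2).not_ge (by norm_num) this

/-- For a primitive vector both x + yθ and x - yθ are integral and their product is a unit, so x +
yθ is itself a unit. -/
theorem exists_zpow_of_inert {θ : L} {π u : K} (h : IsSqrtGenerator θ u)
    (hπ : OrdEq O 1 π) (hu : OrdEq O 0 u)
    (hns : ∀ s : K, OrdGe O 0 s → ¬ OrdGe O 1 (s ^ 2 - u)) {z : L} (hz : z ≠ 0) :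
    ∃ n : ℤ, ∀ A : ValuationSubring L, A.comap (algebraMap K L) = O →
      A.valuation z = A.valuation (algebraMap K L π) ^ n := by
  obtain ⟨x, y, rfl⟩ := h.exists_eq z
  obtain ⟨n, x, y, rfl, rfl, hx, hy, hxy⟩ := exists_primitive hπ (x := x) (y := y) (by
    by_contra! hc
    simp [hc.1, hc.2] at hz)
  refine ⟨n, fun A hA => ?_⟩
  have hθ := h.valuation_eq_one hu hA
  have h1 := valuation_le_one_of_integral hθ.le hA hx hy
  have h2 := valuation_le_one_of_integral hθ.le hA hx hy.neg
  have hN := valuation_comap_eq_one hA (ordEq_norm_of_inert hu hns hx hy hxy)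
  have hprod : algebraMap K L (x ^ 2 - u * y ^ 2) =
      (algebraMap K L x + algebraMap K L y * θ) * (algebraMap K L x + algebraMap K L (-y) * θ) := by
    simp only [map_sub, map_mul, map_pow, map_neg, ← h.sq]; ring
  rw [hprod, map_mul] at hN
  have hone : A.valuation (algebraMap K L x + algebraMap K L y * θ) = 1 := by
    refine le_antisymm h1 ?_
    calc (1 : _) = _ := hN.symm
      _ ≤ _ := mul_le_of_le_one_right' h2
  have : algebraMap K L (π ^ n * x) + algebraMap K L (π ^ n * y) * θ =
      algebraMap K L π ^ n * (algebraMap K L x + algebraMap K L y * θ) := by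
    simp only [map_mul, map_zpow₀]; ring
  rw [this, map_mul, hone, mul_one, map_zpow₀]

/-- Fixing the residue s of θ singles out one place above v. A primitive vector x + yθ reduces to x
+ ys. If this is not a unit, then the conjugate is one, and x + yθ has the same valuation as its
norm, an element of K. -/
theorem exists_zpow_of_split (h2 : OrdEq O 0 (2 : K)) {θ : L} {π u s : K}
    (h : IsSqrtGenerator θ u) (hπ : OrdEq O 1 π) (hs : OrdEq O 0 s) {z : L} (hz : z ≠ 0) :
    ∃ n : ℤ, ∀ A : ValuationSubring L, A.comap (algebraMap K L) = O →
      A.valuation (θ - algebraMap K L s) < 1 →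
      A.valuation z = A.valuation (algebraMap K L π) ^ n := by
  obtain ⟨x, y, rfl⟩ := h.exists_eq z
  obtain ⟨n, x, y, rfl, rfl, hx, hy, hxy⟩ := exists_primitive hπ (x := x) (y := y) (by
    by_contra! hc
    simp [hc.1, hc.2] at hz)
  have hfac : algebraMap K L (π ^ n * x) + algebraMap K L (π ^ n * y) * θ =
      algebraMap K L π ^ n * (algebraMap K L x + algebraMap K L y * θ) := by
    simp only [map_mul, map_zpow₀]; ring
  rw [hfac] at hz ⊢
  have hz' := right_ne_zero_of_mul hz
  have hsmall : ∀ A : ValuationSubring L, A.comap (algebraMap K L) = O →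
      A.valuation (θ - algebraMap K L s) < 1 →
      A.valuation (algebraMap K L y * (θ - algebraMap K L s)) < 1 := fun A hA hθ => by
    rw [map_mul]
    exact (mul_le_of_le_one_left' ((valuation_comap_le_one_iff hA).2 hy)).trans_lt hθ
  have hxs : OrdGe O 0 (x + y * s) := hx.add (hy.mul hs.ge)
  rcases hxs.eq_or with hunit | hmax
  · refine ⟨n, fun A hA hθ => ?_⟩
    have : algebraMap K L x + algebraMap K L y * θ =
        algebraMap K L (x + y * s) + algebraMap K L y * (θ - algebraMap K L s) := by
      simp only [map_add, map_mul]; ring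
    have e1 := valuation_comap_eq_one hA hunit
    rw [map_mul, this, Valuation.map_add_eq_of_lt_left, e1, mul_one, map_zpow₀]
    rw [e1]
    exact hsmall A hA hθ
  · have hy0 : OrdEq O 0 y := by
      rcases hxy with hx0 | hy0
      · refine hy.eq_of_not fun hy1 => ?_
        exact (hx0.add_ge (OrdGe.mul_of_le hy1 hs.ge (by norm_num))).not_ge (by norm_num) hmax
      · exact hy0
    have hconj : ∀ A : ValuationSubring L, A.comap (algebraMap K L) = O →
        A.valuation (θ - algebraMap K L s) < 1 →
        A.valuation (algebraMap K L x - algebraMap K L y * θ) = 1 := fun A hA hθ => by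
      have hlead : OrdEq O 0 (x + y * s - 2 * (y * s)) := by
        rw [sub_eq_add_neg, add_comm]
        exact ((h2.unit_mul (hy0.unit_mul hs)).neg).add_ge hmax
      have : algebraMap K L x - algebraMap K L y * θ =
          algebraMap K L (x + y * s - 2 * (y * s)) - algebraMap K L y * (θ - algebraMap K L s) := by
        simp only [map_sub, map_add, map_mul, map_ofNat]; ring
      have e1 := valuation_comap_eq_one hA hlead
      rw [this, Valuation.map_sub_eq_of_lt_left, e1]
      rw [e1]
      exact hsmall A hA hθ
    -- For norm zero no A with the required property exists, since the conjugate would be both zero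
    -- and a unit; the exponent 0 is a dummy.
    by_cases hN : x ^ 2 - u * y ^ 2 = 0
    · refine ⟨0, fun A hA hθ => ?_⟩
      have hc := hconj A hA hθ
      exfalso
      have : (algebraMap K L x + algebraMap K L y * θ) *
          (algebraMap K L x - algebraMap K L y * θ) = 0 := by
        rw [← map_zero (algebraMap K L), ← hN]
        simp only [map_sub, map_mul, map_pow, ← h.sq]; ring
      rw [(mul_eq_zero.1 this).resolve_left hz', map_zero] at hc
      exact zero_ne_one hc
    · obtain ⟨m, hm⟩ := exists_ordEq (O := O) hN
      refine ⟨n + m, fun A hA hθ => ?_⟩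
      have hprod : algebraMap K L (x ^ 2 - u * y ^ 2) = (algebraMap K L x + algebraMap K L y * θ) *
          (algebraMap K L x - algebraMap K L y * θ) := by
        simp only [map_sub, map_mul, map_pow, ← h.sq]; ring
      have e := valuation_comap_eq_zpow hA hπ hm
      rw [hprod, map_mul, hconj A hA hθ, mul_one] at e
      rw [map_mul, e, map_zpow₀, zpow_add₀]
      rw [Valuation.ne_zero_iff]
      simpa using hπ.ne_zero

end QuadraticPlaces

/-! ### Ramified, split and inert places -/

section QuadraticDecomposition

open IsLocalRing

variable {k K L : Type*} [Field k] [Field K] [Field L] [Algebra k K] [Algebra k L] [Algebra K L]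

theorem Place.LiesOver.ordGe_zero_iff {w : Place k L} {v : Place k K} (h : w.LiesOver v) {x : K} :
    OrdGe w.ring 0 (algebraMap K L x) ↔ OrdGe v.ring 0 x := by
  rw [EllTwist.ordGe_zero_iff, EllTwist.ordGe_zero_iff, ← h, ValuationSubring.mem_comap]

theorem Place.LiesOver.ordEq_zero {w : Place k L} {v : Place k K} (h : w.LiesOver v) {x : K}
    (hx : OrdEq v.ring 0 x) : OrdEq w.ring 0 (algebraMap K L x) := by
  have h1 := h.ordGe_zero_iff.2 hx.ge
  have h2 := h.ordGe_zero_iff.2 hx.inv.ge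
  rw [map_inv₀] at h2
  have h0 : algebraMap K L x ≠ 0 := (map_ne_zero _).2 hx.ne_zero
  obtain ⟨n, hn⟩ := exists_ordEq (O := w.ring) h0
  have := hn.le_of_ge h1
  have := hn.inv.le_of_ge h2
  exact hn.congr (by omega)

theorem Place.LiesOver.ordEq {w : Place k L} {v : Place k K} (h : w.LiesOver v) {π x : K} {e n : ℤ}
    (hπ : OrdEq v.ring 1 π) (he : OrdEq w.ring e (algebraMap K L π)) (hx : OrdEq v.ring n x) :
    OrdEq w.ring (n * e) (algebraMap K L x) := by
  have h0 : OrdEq v.ring 0 (x / π ^ n) := (hx.div (hπ.zpow n)).congr (by ring)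
  have hx' : x = x / π ^ n * π ^ n := (div_mul_cancel₀ _ (hπ.zpow n).ne_zero).symm
  rw [hx', map_mul, map_zpow₀]
  exact (h.ordEq_zero h0).unit_mul (he.zpow n)

theorem Place.LiesOver.ordGe_iff {w : Place k L} {v : Place k K} (h : w.LiesOver v) {π x : K}
    {e n : ℤ} (hπ : OrdEq v.ring 1 π) (he : OrdEq w.ring e (algebraMap K L π)) (hpos : 0 < e) :
    OrdGe w.ring (n * e) (algebraMap K L x) ↔ OrdGe v.ring n x := by
  by_cases h0 : x = 0
  · subst h0
    rw [map_zero]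
    exact iff_of_true (ordGe_zero_right _) (ordGe_zero_right _)
  obtain ⟨m, hm⟩ := exists_ordEq (O := v.ring) h0
  have hw := h.ordEq hπ he hm
  constructor
  · intro hn
    have := hw.le_of_ge hn
    exact hm.ge.mono (le_of_mul_le_mul_right this hpos)
  · intro hn
    exact hw.ge.mono (mul_le_mul_of_nonneg_right (hm.le_of_ge hn) hpos.le)

theorem Place.LiesOver.ramifiedOver_iff {w : Place k L} {v : Place k K} (h : w.LiesOver v) {π : K}
    {e : ℤ} (hπ : OrdEq v.ring 1 π) (he : OrdEq w.ring e (algebraMap K L π)) (hpos : 0 < e) :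
    w.RamifiedOver v ↔ 2 ≤ e := by
  have hmem : ∀ {x : K}, x ∈ v.ring → algebraMap K L x ∈ w.ring := fun {x} hx => by
    rw [← EllTwist.ordGe_zero_iff] at hx ⊢
    exact h.ordGe_zero_iff.2 hx
  have hπO : π ∈ v.ring := EllTwist.ordGe_zero_iff.1 (hπ.ge.mono zero_le_one)
  constructor
  · intro hr
    have := hr ⟨π, hπO⟩ ((mem_maximalIdeal_iff _).2 hπ.ge) ⟨_, hmem hπO⟩ rfl
    rw [mem_maximalIdeal_pow_iff] at this
    exact he.le_of_ge this
  · intro h2 x hx y hy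
    rw [mem_maximalIdeal_iff] at hx
    rw [mem_maximalIdeal_pow_iff, hy]
    exact ((h.ordGe_iff hπ he hpos).2 hx).mono (by push_cast; omega)

variable {v : Place k K}

theorem Place.ncard_of_existsUnique (h : ∃! w : Place k L, w.LiesOver v) : ¬ v.IsSplit L := by
  obtain ⟨w, hw, hu⟩ := h
  have : {w : Place k L | w.LiesOver v} = {w} := by
    ext w'
    exact ⟨fun h => hu w' h, fun h => h ▸ hw⟩
  rw [Place.IsSplit, this, Set.ncard_singleton]
  norm_num

theorem Place.not_isRamified_of_ordEq
    (h : ∀ π : K, OrdEq v.ring 1 π → ∀ w : Place k L, w.LiesOver v →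
      OrdEq w.ring 1 (algebraMap K L π)) : ¬ v.IsRamified L := by
  rintro ⟨w, hw, hr⟩
  obtain ⟨π, hπ⟩ := exists_uniformizer v.ring
  rw [hw.ramifiedOver_iff hπ (h π hπ w hw) one_pos] at hr
  omega

variable [IsScalarTower k K L]

/-- The place given by a valuation subring over that of `v`. -/
def Place.mkOver (v : Place k K) (A : ValuationSubring L)
    (hA : A.comap (algebraMap K L) = v.ring) (hdvr : IsDiscreteValuationRing A) : Place k L where
  ring := A
  algebraMap_mem c := by
    have := v.algebraMap_mem c
    rwa [← hA, ValuationSubring.mem_comap, ← IsScalarTower.algebraMap_apply] at this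
  isDVR := hdvr

/-- The places above a place at which the radicand is a uniformizer. -/
theorem Place.existsUnique_of_ramified {θ : L} {π : K} (h : IsSqrtGenerator θ π)
    (hπ : OrdEq v.ring 1 π) :
    (∃! w : Place k L, w.LiesOver v) ∧ ∀ w : Place k L, w.LiesOver v → OrdEq w.ring 1 θ := by
  have hθ0 : θ ≠ 0 := by
    rintro rfl
    have := h.sq
    simp only [ne_eq, OfNat.ofNat_ne_zero, not_false_eq_true, zero_pow] at this
    exact hπ.ne_zero (by simpa using this.symm)
  have hlt : ∀ A : ValuationSubring L, A.comap (algebraMap K L) = v.ring → A.valuation θ < 1 :=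
    fun A hA => by
      have := valuation_comap_lt_one hA hπ.ge
      rw [← h.sq, map_pow] at this
      exact lt_of_pow_lt_pow_left₀ 2 zero_le_one (by simpa using this)
  obtain ⟨A, hA⟩ := exists_comap_eq L v.ring
  have hz : ∀ z : L, z ≠ 0 → ∃ n : ℤ, ∀ A : ValuationSubring L,
      A.comap (algebraMap K L) = v.ring → A.valuation z = A.valuation θ ^ n :=
    fun z hz => exists_zpow_of_ramified h hπ hz
  refine ⟨⟨v.mkOver A hA (isDVR_of_zpow hθ0 (hlt A hA) fun z hz0 => (hz z hz0).imp fun n hn =>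
    hn A hA), hA, fun w hw => Place.ext ?_⟩, fun w hw => ordEq_one_of_zpow hθ0 (hlt _ hw)
      fun z hz0 => (hz z hz0).imp fun n hn => hn _ hw⟩
  exact valuationSubring_eq_of_zpow hθ0 (hlt _ hw) (hlt _ hA)
    fun z hz0 => (hz z hz0).imp fun n hn => ⟨hn _ hw, hn _ hA⟩

theorem Place.existsUnique_of_inert {θ : L} {u : K} (h : IsSqrtGenerator θ u)
    (hu : OrdEq v.ring 0 u) (hns : ∀ s : K, OrdGe v.ring 0 s → ¬ OrdGe v.ring 1 (s ^ 2 - u)) :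
    (∃! w : Place k L, w.LiesOver v) ∧ ∀ π : K, OrdEq v.ring 1 π →
      ∀ w : Place k L, w.LiesOver v → OrdEq w.ring 1 (algebraMap K L π) := by
  have hz : ∀ π : K, OrdEq v.ring 1 π → ∀ z : L, z ≠ 0 → ∃ n : ℤ, ∀ A : ValuationSubring L,
      A.comap (algebraMap K L) = v.ring → A.valuation z = A.valuation (algebraMap K L π) ^ n :=
    fun π hπ z hz => exists_zpow_of_inert h hπ hu hns hz
  obtain ⟨A, hA⟩ := exists_comap_eq L v.ring
  refine ⟨?_, fun π hπ w hw => ordEq_one_of_zpow ((map_ne_zero _).2 hπ.ne_zero)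
    (valuation_comap_lt_one hw hπ.ge) fun z hz0 => (hz π hπ z hz0).imp fun n hn => hn _ hw⟩
  obtain ⟨π, hπ⟩ := exists_uniformizer v.ring
  have hπ0 : algebraMap K L π ≠ 0 := (map_ne_zero _).2 hπ.ne_zero
  refine ⟨v.mkOver A hA (isDVR_of_zpow hπ0 (valuation_comap_lt_one hA hπ.ge)
    fun z hz0 => (hz π hπ z hz0).imp fun n hn => hn A hA), hA, fun w hw => Place.ext ?_⟩
  exact valuationSubring_eq_of_zpow hπ0 (valuation_comap_lt_one hw hπ.ge)
    (valuation_comap_lt_one hA hπ.ge)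
    fun z hz0 => (hz π hπ z hz0).imp fun n hn => ⟨hn _ hw, hn _ hA⟩

/-- Above v exactly one of θ - s and θ + s is small: their product is, and they differ by the unit
2s. Each choice determines the valuation ring, and conjugation exchanges the choices, so both occur.
-/
theorem Place.ncard_of_split (h2 : OrdEq v.ring 0 (2 : K)) {θ : L} {u s : K}
    (h : IsSqrtGenerator θ u) (hns : ¬ IsSquare u) (hu : OrdEq v.ring 0 u)
    (hsu : OrdGe v.ring 1 (s ^ 2 - u)) :
    {w : Place k L | w.LiesOver v}.ncard = 2 ∧ ∀ π : K, OrdEq v.ring 1 π →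
      ∀ w : Place k L, w.LiesOver v → OrdEq w.ring 1 (algebraMap K L π) := by
  have hs0 : OrdEq v.ring 0 s := by
    have : OrdEq v.ring 0 (s ^ 2) := by
      have := hu.add_ge hsu
      rwa [add_sub_cancel] at this
    obtain ⟨m, hm, hms⟩ := this.of_sq
    exact hms.congr (by omega)
  set s₁ := algebraMap K L s with hs₁
  have e₁ : s₁ = algebraMap K L s := rfl
  have e₂ : -s₁ = algebraMap K L (-s) := by rw [map_neg]
  obtain ⟨π₀, hπ₀⟩ := exists_uniformizer v.ring
  have hz₁ : ∀ π : K, OrdEq v.ring 1 π → ∀ z : L, z ≠ 0 → ∃ n : ℤ, ∀ A : ValuationSubring L,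
      A.comap (algebraMap K L) = v.ring → A.valuation (θ - s₁) < 1 →
      A.valuation z = A.valuation (algebraMap K L π) ^ n :=
    fun π hπ z hz => exists_zpow_of_split h2 h hπ hs0 hz
  have hz₂ : ∀ π : K, OrdEq v.ring 1 π → ∀ z : L, z ≠ 0 → ∃ n : ℤ, ∀ A : ValuationSubring L,
      A.comap (algebraMap K L) = v.ring → A.valuation (θ - -s₁) < 1 →
      A.valuation z = A.valuation (algebraMap K L π) ^ n := fun π hπ z hz => by
    rw [e₂]; exact exists_zpow_of_split h2 h hπ hs0.neg hz
  have hor : ∀ A : ValuationSubring L, A.comap (algebraMap K L) = v.ring →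
      A.valuation (θ - s₁) < 1 ∨ A.valuation (θ - -s₁) < 1 := fun A hA => by
    have := valuation_comap_lt_one hA hsu
    have hprod : algebraMap K L (s ^ 2 - u) = -((θ - s₁) * (θ - -s₁)) := by
      simp only [map_sub, map_pow, ← h.sq]; ring
    rw [hprod, Valuation.map_neg, map_mul] at this
    by_contra! hc
    exact absurd this (not_lt.2 (one_le_mul hc.1 hc.2))
  have hnot : ∀ A : ValuationSubring L, A.comap (algebraMap K L) = v.ring →
      A.valuation (θ - s₁) < 1 → A.valuation (θ - -s₁) < 1 → False := fun A hA h₁ h₂ => by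
    have h1 := A.valuation.map_sub_lt h₂ h₁
    have h3 := valuation_comap_eq_one hA (h2.unit_mul hs0)
    have : θ - -s₁ - (θ - s₁) = algebraMap K L (2 * s) := by
      rw [map_mul, map_ofNat]; ring
    rw [this, h3] at h1
    exact lt_irrefl _ h1
  obtain ⟨σ, hσK, hσθ⟩ := h.exists_conj hns
  have hconj : ∀ A : ValuationSubring L, A.comap (algebraMap K L) = v.ring →
      (A.comap σ).comap (algebraMap K L) = v.ring := fun A hA => by
    rw [← hA]
    ext x
    simp only [ValuationSubring.mem_comap, hσK]
  -- Smallness is rephrased through membership in the ring so that it can be carried along `comap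
  -- σ`.
  have hlt_iff : ∀ (A : ValuationSubring L) (z : L), A.valuation z < 1 ↔ z = 0 ∨ z⁻¹ ∉ A :=
    fun A z => by rw [← A.mem_nonunits_iff, A.mem_nonunits_iff_or]
  have hconj_lt : ∀ (A : ValuationSubring L) (z : L),
      (A.comap σ).valuation z < 1 ↔ A.valuation (σ z) < 1 := fun A z => by
    rw [hlt_iff, hlt_iff, ValuationSubring.mem_comap, map_inv₀, map_eq_zero]
  have hσ₁ : σ (θ - s₁) = -(θ - -s₁) := by rw [map_sub, hσθ, hs₁, hσK]; ring
  have hσ₂ : σ (θ - -s₁) = -(θ - s₁) := by rw [map_sub, map_neg, hσθ, hs₁, hσK]; ring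
  obtain ⟨A₁, hA₁, hA₁'⟩ : ∃ A : ValuationSubring L, A.comap (algebraMap K L) = v.ring ∧
      A.valuation (θ - s₁) < 1 := by
    obtain ⟨A, hA⟩ := exists_comap_eq L v.ring
    rcases hor A hA with h1 | h1
    · exact ⟨A, hA, h1⟩
    · refine ⟨A.comap σ, hconj A hA, ?_⟩
      rw [hconj_lt, hσ₁, Valuation.map_neg]; exact h1
  have hA₂ := hconj A₁ hA₁
  have hA₂' : (A₁.comap σ).valuation (θ - -s₁) < 1 := by
    rw [hconj_lt, hσ₂, Valuation.map_neg]; exact hA₁'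
  have hπ0 : ∀ π : K, OrdEq v.ring 1 π → algebraMap K L π ≠ 0 :=
    fun π hπ => (map_ne_zero _).2 hπ.ne_zero
  refine ⟨?_, fun π hπ w hw => ?_⟩
  · let w₁ : Place k L := v.mkOver A₁ hA₁ (isDVR_of_zpow (hπ0 _ hπ₀)
      (valuation_comap_lt_one hA₁ hπ₀.ge) fun z hz0 => (hz₁ π₀ hπ₀ z hz0).imp fun n hn =>
        hn _ hA₁ hA₁')
    let w₂ : Place k L := v.mkOver (A₁.comap σ) hA₂ (isDVR_of_zpow (hπ0 _ hπ₀)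
      (valuation_comap_lt_one hA₂ hπ₀.ge) fun z hz0 => (hz₂ π₀ hπ₀ z hz0).imp fun n hn =>
        hn _ hA₂ hA₂')
    have hne : w₁ ≠ w₂ := fun he => by
      have : A₁ = A₁.comap σ := congrArg Place.ring he
      exact hnot A₁ hA₁ hA₁' (by rw [this]; exact hA₂')
    have hset : {w : Place k L | w.LiesOver v} = {w₁, w₂} := by
      ext w
      simp only [Set.mem_ofPred_eq, Set.mem_insert_iff, Set.mem_singleton_iff]
      constructor
      · intro hw
        rcases hor w.ring hw with h1 | h1
        · left
          exact Place.ext (valuationSubring_eq_of_zpow (hπ0 _ hπ₀)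
            (valuation_comap_lt_one hw hπ₀.ge) (valuation_comap_lt_one hA₁ hπ₀.ge)
            fun z hz0 => (hz₁ π₀ hπ₀ z hz0).imp fun n hn => ⟨hn _ hw h1, hn _ hA₁ hA₁'⟩)
        · right
          exact Place.ext (valuationSubring_eq_of_zpow (hπ0 _ hπ₀)
            (valuation_comap_lt_one hw hπ₀.ge) (valuation_comap_lt_one hA₂ hπ₀.ge)
            fun z hz0 => (hz₂ π₀ hπ₀ z hz0).imp fun n hn => ⟨hn _ hw h1, hn _ hA₂ hA₂'⟩)
      · rintro (rfl | rfl)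
        · exact hA₁
        · exact hA₂
    rw [hset, Set.ncard_pair hne]
  · rcases hor w.ring hw with h1 | h1
    · exact ordEq_one_of_zpow (hπ0 π hπ) (valuation_comap_lt_one hw hπ.ge)
        fun z hz0 => (hz₁ π hπ z hz0).imp fun n hn => hn _ hw h1
    · exact ordEq_one_of_zpow (hπ0 π hπ) (valuation_comap_lt_one hw hπ.ge)
        fun z hz0 => (hz₂ π hπ z hz0).imp fun n hn => hn _ hw h1

/-- The decomposition of `v` in `L = K(√f)`. -/
theorem Place.decomposition (h2 : OrdEq v.ring 0 (2 : K)) {θ : L} {f : K}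
    (h : IsSqrtGenerator θ f) (hf : ¬ IsSquare f) :
    (∃ π g : K, OrdEq v.ring 1 π ∧ g ≠ 0 ∧ f = π * g ^ 2 ∧ v.IsRamified L ∧ ¬ v.IsSplit L ∧
      ¬ v.IsInert L) ∨
    ∃ (u : v.ring) (g : K), IsUnit u ∧ g ≠ 0 ∧ f = u * g ^ 2 ∧ ¬ v.IsRamified L ∧
      ((IsSquare (residue v.ring u) ∧ v.IsSplit L ∧ ¬ v.IsInert L) ∨
        (¬ IsSquare (residue v.ring u) ∧ v.IsInert L ∧ ¬ v.IsSplit L)) := by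
  have hf0 : f ≠ 0 := by rintro rfl; exact hf IsSquare.zero
  obtain ⟨n, hn⟩ := exists_ordEq (O := v.ring) hf0
  obtain ⟨ϖ, hϖ⟩ := exists_uniformizer v.ring
  have hg : ∀ m : ℤ, ϖ ^ m ≠ 0 := fun m => (hϖ.zpow m).ne_zero
  have hfac : ∀ m : ℤ, f = f / (ϖ ^ m) ^ 2 * (ϖ ^ m) ^ 2 := fun m =>
    (div_mul_cancel₀ _ (pow_ne_zero _ (hg m))).symm
  have hord : ∀ m : ℤ, OrdEq v.ring (n - 2 * m) (f / (ϖ ^ m) ^ 2) := fun m =>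
    (hn.div ((hϖ.zpow m).pow 2)).congr (by push_cast; ring)
  -- Dividing f by the square of ϖ^m leaves a unit or a uniformizer, according to the parity of its
  -- order.
  rcases Int.even_or_odd' n with ⟨m, rfl | rfl⟩
  · right
    have hu : OrdEq v.ring 0 (f / (ϖ ^ m) ^ 2) := (hord m).congr (by ring)
    set u : v.ring := ⟨f / (ϖ ^ m) ^ 2, ordGe_zero_iff.1 hu.ge⟩ with hudef
    have hsq := h.scale (hg m) (hfac m)
    have hns : ¬ IsSquare (f / (ϖ ^ m) ^ 2) := fun ⟨r, hr⟩ => hf ⟨r * ϖ ^ m, by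
      rw [hfac m, hr]; ring⟩
    by_cases hres : IsSquare (residue v.ring u)
    · obtain ⟨r, hr⟩ := hres
      obtain ⟨s, rfl⟩ := residue_surjective r
      have hsu : OrdGe v.ring 1 ((s : K) ^ 2 - f / (ϖ ^ m) ^ 2) := by
        rw [← map_mul, eq_comm, residue_eq_iff_ordGe, ← pow_two] at hr
        exact hr
      obtain ⟨hc, hunr⟩ := Place.ncard_of_split h2 hsq hns hu hsu
      refine ⟨u, _, (isUnit_iff_ordEq u).2 hu, hg m, hfac m, Place.not_isRamified_of_ordEq hunr,
        Or.inl ⟨⟨_, hr⟩, hc, fun hi => Place.ncard_of_existsUnique hi.1 hc⟩⟩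
    · obtain ⟨hc, hunr⟩ := Place.existsUnique_of_inert hsq hu fun s hs hsu => by
        refine hres ⟨residue v.ring ⟨s, ordGe_zero_iff.1 hs⟩, ?_⟩
        rw [← map_mul, eq_comm, residue_eq_iff_ordGe, ← pow_two]
        exact hsu
      have hr := Place.not_isRamified_of_ordEq hunr
      exact ⟨u, _, (isUnit_iff_ordEq u).2 hu, hg m, hfac m, hr,
        Or.inr ⟨hres, ⟨hc, hr⟩, Place.ncard_of_existsUnique hc⟩⟩
  · left
    have hu : OrdEq v.ring 1 (f / (ϖ ^ m) ^ 2) := (hord m).congr (by ring)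
    have hsq := h.scale (hg m) (hfac m)
    obtain ⟨hc, hw⟩ := Place.existsUnique_of_ramified hsq hu
    have hr : v.IsRamified L := by
      obtain ⟨w, hwv, -⟩ := hc
      refine ⟨w, hwv, (hwv.ramifiedOver_iff (e := 2) hu ?_ two_pos).2 le_rfl⟩
      rw [← hsq.sq]
      exact ((hw w hwv).pow 2).congr (by norm_num)
    exact ⟨_, _, hu, hg m, hfac m, hr, Place.ncard_of_existsUnique hc, fun hi => hi.2 hr⟩

/-- A ramified place has the same residue field as the place above it. -/
theorem Place.LiesOver.isSquare_residue_iff {θ : L} {π : K} (h : IsSqrtGenerator θ π)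
    (hπ : OrdEq v.ring 1 π) {w : Place k L} (hw : w.LiesOver v) (a : v.ring) (a' : w.ring)
    (ha : (a' : L) = algebraMap K L a) :
    IsSquare (residue w.ring a') ↔ IsSquare (residue v.ring a) := by
  have hθ := (Place.existsUnique_of_ramified h hπ).2 w hw
  have he : OrdEq w.ring 2 (algebraMap K L π) := by
    rw [← h.sq]; exact (hθ.pow 2).congr (by norm_num)
  have hres : ∀ (s : K), OrdGe w.ring 1 (algebraMap K L s) → OrdGe v.ring 1 s := fun s hs => by
    by_cases h0 : s = 0
    · subst h0; exact ordGe_zero_right _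
    obtain ⟨n, hn⟩ := exists_ordEq (O := v.ring) h0
    have := (hw.ordEq hπ he hn).le_of_ge hs
    exact hn.ge.mono (by omega)
  constructor
  · rintro ⟨r, hr⟩
    obtain ⟨z, rfl⟩ := residue_surjective r
    obtain ⟨x, y, hxy⟩ := h.exists_eq z
    have hz : OrdGe w.ring 0 (z : L) := EllTwist.ordGe_zero_iff.2 z.2
    -- the two terms have orders of different parity, so both are integral
    have hint : OrdGe v.ring 0 x ∧ OrdGe w.ring 1 (algebraMap K L y * θ) := by
      by_cases hy : y = 0
      · subst hy
        rw [map_zero, zero_mul, add_zero] at hxy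
        rw [hxy, hw.ordGe_zero_iff] at hz
        exact ⟨hz, by simpa using ordGe_zero_right _⟩
      obtain ⟨j, hj⟩ := exists_ordEq (O := v.ring) hy
      have hj' := (hw.ordEq hπ he hj).mul hθ
      by_cases hx : x = 0
      · subst hx
        rw [map_zero, zero_add] at hxy
        rw [hxy] at hz
        have := hj'.le_of_ge hz
        exact ⟨ordGe_zero_right _, hj'.ge.mono (by omega)⟩
      obtain ⟨i, hi⟩ := exists_ordEq (O := v.ring) hx
      have hi' := hw.ordEq hπ he hi
      rw [hxy] at hz
      rcases lt_or_gt_of_ne (show i * 2 ≠ j * 2 + 1 by omega) with hij | hij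
      · have := (hi'.add_ge (hj'.ge.mono (by omega))).le_of_ge hz
        exact ⟨hi.ge.mono (by omega), hj'.ge.mono (by omega)⟩
      · rw [add_comm] at hz
        have := (hj'.add_ge (hi'.ge.mono (by omega))).le_of_ge hz
        exact ⟨hi.ge.mono (by omega), hj'.ge.mono (by omega)⟩
    refine ⟨residue v.ring ⟨x, EllTwist.ordGe_zero_iff.1 hint.1⟩, ?_⟩
    rw [← map_mul, residue_eq_iff_ordGe] at hr ⊢
    refine hres _ ?_
    have hr' : OrdGe w.ring 1 ((a' : L) - z * z) := hr
    have hx0 := hw.ordGe_zero_iff.2 hint.1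
    have : algebraMap K L ((a : K) - x * x) = ((a' : L) - z * z) +
        (algebraMap K L y * θ) * (z + algebraMap K L x) := by
      rw [map_sub, map_mul, ha, hxy]; ring
    change OrdGe w.ring 1 (algebraMap K L ((a : K) - x * x))
    rw [this]
    exact hr'.add (hint.2.mul_of_le (hz.add hx0) (by norm_num))
  · rintro ⟨r, hr⟩
    obtain ⟨s, rfl⟩ := residue_surjective r
    have hs : algebraMap K L s ∈ w.ring :=
      EllTwist.ordGe_zero_iff.1 (hw.ordGe_zero_iff.2 (EllTwist.ordGe_zero_iff.2 s.2))
    refine ⟨residue w.ring ⟨algebraMap K L s, hs⟩, ?_⟩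
    rw [← map_mul, residue_eq_iff_ordGe] at hr ⊢
    have hr' : OrdGe v.ring 1 ((a : K) - s * s) := hr
    have := (hw.ordGe_iff hπ he two_pos).2 hr'
    change OrdGe w.ring 1 ((a' : L) - algebraMap K L s * algebraMap K L s)
    rw [ha, ← map_mul, ← map_sub]
    exact this.mono (by norm_num)

end QuadraticDecomposition

/-! ### The quadratic twist at a place -/

section TwistModels

open WeierstrassCurve IsLocalRing

variable {K : Type*} [Field K] {O : ValuationSubring K} [IsDiscreteValuationRing O]
  {W : WeierstrassCurve K} {c : K} {a b : O}

theorem quadraticTwist_eq_short (W : WeierstrassCurve K) (f : K) :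
    quadraticTwist W f = short (f ^ 2 * (-W.c₄ / 48)) (f ^ 3 * (-W.c₆ / 864)) := rfl

theorem ne_48 (h2 : (2 : K) ≠ 0) (h3 : (3 : K) ≠ 0) : (48 : K) ≠ 0 := by
  have : (48 : K) = 2 ^ 4 * 3 := by norm_num
  rw [this]
  exact mul_ne_zero (pow_ne_zero _ h2) h3

theorem ne_864 (h2 : (2 : K) ≠ 0) (h3 : (3 : K) ≠ 0) : (864 : K) ≠ 0 := by
  have : (864 : K) = 2 ^ 5 * 3 ^ 3 := by norm_num
  rw [this]
  exact mul_ne_zero (pow_ne_zero _ h2) (pow_ne_zero _ h3)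

theorem disc_ne_zero (h2 : (2 : K) ≠ 0) (h3 : (3 : K) ≠ 0) (W : WeierstrassCurve K)
    [W.IsElliptic] : disc (-W.c₄ / 48) (-W.c₆ / 864) ≠ 0 := by
  obtain ⟨C, hC⟩ := exists_smul_eq_short h2 h3 W
  have : (short (-W.c₄ / 48) (-W.c₆ / 864)).IsElliptic := by rw [← hC]; infer_instance
  have hΔ := (short (-W.c₄ / 48) (-W.c₆ / 864)).isUnit_Δ.ne_zero
  rw [short_Δ] at hΔ
  exact right_ne_zero_of_mul hΔ

theorem IsPrimitiveModel.disc_ne (h2 : (2 : K) ≠ 0) (h3 : (3 : K) ≠ 0) [W.IsElliptic]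
    (h : IsPrimitiveModel O W c a b) : disc (a : K) b ≠ 0 := by
  rw [h.a_eq, h.b_eq, disc_scale]
  exact mul_ne_zero (pow_ne_zero _ h.c_ne) (disc_ne_zero h2 h3 W)

theorem quadraticTwist_isElliptic (h2 : (2 : K) ≠ 0) (h3 : (3 : K) ≠ 0) [W.IsElliptic] {f : K}
    (hf : f ≠ 0) : (quadraticTwist W f).IsElliptic := by
  rw [quadraticTwist_eq_short]
  refine short_isElliptic h2 ?_
  rw [disc_twist]
  exact mul_ne_zero (pow_ne_zero _ hf) (disc_ne_zero h2 h3 W)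

theorem quadraticTwist_c₄ (h2 : (2 : K) ≠ 0) (h3 : (3 : K) ≠ 0) (f : K) :
    -(quadraticTwist W f).c₄ / 48 = f ^ 2 * (-W.c₄ / 48) := by
  have := ne_48 h2 h3
  rw [quadraticTwist_eq_short, short_c₄]
  field_simp

theorem quadraticTwist_c₆ (h2 : (2 : K) ≠ 0) (h3 : (3 : K) ≠ 0) (f : K) :
    -(quadraticTwist W f).c₆ / 864 = f ^ 3 * (-W.c₆ / 864) := by
  have := ne_864 h2 h3
  rw [quadraticTwist_eq_short, short_c₆]
  field_simp

/-- The square g² in f is absorbed by the scaling factor c / g; multiplying a and b by units does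
not affect primitivity. -/
theorem IsPrimitiveModel.twist_unit (h2 : (2 : K) ≠ 0) (h3 : (3 : K) ≠ 0)
    (h : IsPrimitiveModel O W c a b) {u : O} (hu : IsUnit u) {g f : K} (hg : g ≠ 0)
    (hf : f = u * g ^ 2) :
    IsPrimitiveModel O (quadraticTwist W f) (c / g) (u ^ 2 * a) (u ^ 3 * b) where
  c_ne := div_ne_zero h.c_ne hg
  a_eq := by
    rw [quadraticTwist_c₄ h2 h3, hf]
    push_cast
    rw [h.a_eq]
    field_simp
  b_eq := by
    rw [quadraticTwist_c₆ h2 h3, hf]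
    push_cast
    rw [h.b_eq]
    field_simp
  min := by
    rw [isUnit_iff_ordEq] at hu
    push_cast
    rw [ordGe_unit_mul_iff ((hu.pow 2).congr (by norm_num)),
      ordGe_unit_mul_iff ((hu.pow 3).congr (by norm_num))]
    exact h.min

/-- The model of the twist by `π g²` obtained by dividing out `π`. -/
theorem IsPrimitiveModel.twist_uniformizer_div (h2 : (2 : K) ≠ 0) (h3 : (3 : K) ≠ 0)
    (h : IsPrimitiveModel O W c a b) {π : K} (hπ : OrdEq O 1 π) {g f : K} (hg : g ≠ 0)
    (hf : f = π * g ^ 2) {a' b' : O} (ha : π ^ 2 * a' = (a : K)) (hb : π ^ 3 * b' = (b : K)) :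
    IsPrimitiveModel O (quadraticTwist W f) (c / (g * π)) a' b' where
  c_ne := div_ne_zero h.c_ne (mul_ne_zero hg hπ.ne_zero)
  a_eq := by
    have := hπ.ne_zero
    rw [quadraticTwist_c₄ h2 h3, hf]
    refine mul_left_cancel₀ (pow_ne_zero 2 this) ?_
    rw [ha, h.a_eq]
    field_simp
  b_eq := by
    have := hπ.ne_zero
    rw [quadraticTwist_c₆ h2 h3, hf]
    refine mul_left_cancel₀ (pow_ne_zero 3 this) ?_
    rw [hb, h.b_eq]
    field_simp
  min := fun hc => h.min ⟨by
    rw [← ha]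
    exact (hπ.pow 2).ge.mul_of_le hc.1 (by norm_num), by
    rw [← hb]
    exact (hπ.pow 3).ge.mul_of_le hc.2 (by norm_num)⟩

theorem IsPrimitiveModel.twist_uniformizer (h2 : (2 : K) ≠ 0) (h3 : (3 : K) ≠ 0)
    (h : IsPrimitiveModel O W c a b) {π : O} (hπ : OrdEq O 1 (π : K)) {g f : K} (hg : g ≠ 0)
    (hf : f = π * g ^ 2) (hab : ¬(OrdGe O 2 (a : K) ∧ OrdGe O 3 (b : K))) :
    IsPrimitiveModel O (quadraticTwist W f) (c / g) (π ^ 2 * a) (π ^ 3 * b) where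
  c_ne := div_ne_zero h.c_ne hg
  a_eq := by
    rw [quadraticTwist_c₄ h2 h3, hf]
    push_cast
    rw [h.a_eq]
    field_simp
  b_eq := by
    rw [quadraticTwist_c₆ h2 h3, hf]
    push_cast
    rw [h.b_eq]
    field_simp
  min := by
    push_cast
    exact fun hc => hab ⟨(OrdGe.of_mul_left (hπ.pow 2) hc.1).mono (by norm_num),
      (OrdGe.of_mul_left (hπ.pow 3) hc.2).mono (by norm_num)⟩

theorem exists_div_uniformizer {π : K} (hπ : OrdEq O 1 π) (n : ℕ) {a : O} (ha : OrdGe O n (a : K)) :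
    ∃ a' : O, π ^ n * a' = (a : K) :=
  ⟨⟨a / π ^ n, ordGe_zero_iff.1 (ha.div_of_le (hπ.pow n) (by omega))⟩,
    mul_div_cancel₀ _ (pow_ne_zero _ hπ.ne_zero)⟩

/-- At a ramified place, the twist has additive reduction unless `E` has reduction of type
`Iₙ*`. -/
theorem IsPrimitiveModel.additive_twist (h2 : OrdEq O 0 (2 : K)) (h3 : OrdEq O 0 (3 : K))
    [W.IsElliptic] (h : IsPrimitiveModel O W c a b) {π : K} (hπ : OrdEq O 1 π) {g f : K}
    (hg : g ≠ 0) (hf : f = π * g ^ 2) (hs : ¬ IsStarPair O (a : K) b) :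
    ((quadraticTwist W f).minimal O).HasAdditiveReduction O := by
  have := quadraticTwist_isElliptic (W := W) h2.ne_zero h3.ne_zero
    (hf ▸ mul_ne_zero hπ.ne_zero (pow_ne_zero 2 hg))
  -- If π² and π³ can be divided out, the quotients still lie in m because the pair is not of type
  -- Iₙ*. Otherwise (π²a, π³b) is already primitive.
  by_cases hab : OrdGe O 2 (a : K) ∧ OrdGe O 3 (b : K)
  · obtain ⟨a', ha⟩ := exists_div_uniformizer hπ 2 hab.1
    obtain ⟨b', hb⟩ := exists_div_uniformizer hπ 3 hab.2
    rw [(h.twist_uniformizer_div h2.ne_zero h3.ne_zero hπ hg hf ha hb).additive_iff h2 h3]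
    have h' : OrdGe O 3 (a : K) ∧ OrdGe O 4 (b : K) := by
      by_contra hmin
      exact hs ⟨hab.1, hab.2, hmin⟩
    rw [← ha, ← hb] at h'
    exact ⟨(OrdGe.of_mul_left (hπ.pow 2) h'.1).mono (by norm_num),
      (OrdGe.of_mul_left (hπ.pow 3) h'.2).mono (by norm_num)⟩
  · let π' : O := ⟨π, ordGe_zero_iff.1 (hπ.ge.mono zero_le_one)⟩
    rw [(h.twist_uniformizer h2.ne_zero h3.ne_zero (π := π') hπ hg hf hab).additive_iff h2 h3]
    push_cast
    exact ⟨(hπ.pow 2).ge.mul_of_le (ordGe_zero_iff.2 a.2) (by norm_num),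
      (hπ.pow 3).ge.mul_of_le (ordGe_zero_iff.2 b.2) (by norm_num)⟩

end TwistModels

/-! ### Primitive models over a ramified quadratic extension -/

section BaseChange

open WeierstrassCurve IsLocalRing

variable {k K L : Type*} [Field k] [Field K] [Field L] [Algebra k K] [Algebra k L] [Algebra K L]
  {v : Place k K} {w : Place k L} {W : WeierstrassCurve K} {c : K} {a b : v.ring}

theorem baseChange_a (W : WeierstrassCurve K) :
    -(W.baseChange L).c₄ / 48 = algebraMap K L (-W.c₄ / 48) := by
  rw [WeierstrassCurve.baseChange, map_c₄, map_div₀, map_neg, map_ofNat]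

theorem baseChange_b (W : WeierstrassCurve K) :
    -(W.baseChange L).c₆ / 864 = algebraMap K L (-W.c₆ / 864) := by
  rw [WeierstrassCurve.baseChange, map_c₆, map_div₀, map_neg, map_ofNat]

theorem Place.LiesOver.mem (hw : w.LiesOver v) (x : v.ring) :
    algebraMap K L x ∈ w.ring :=
  EllTwist.ordGe_zero_iff.1 (hw.ordGe_zero_iff.2 (EllTwist.ordGe_zero_iff.2 x.2))

/-- The model over a ramified quadratic extension obtained by dividing out the uniformizer. -/
theorem IsPrimitiveModel.baseChange_div (h : IsPrimitiveModel v.ring W c a b) (hw : w.LiesOver v)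
    {π : K} (hπ : OrdEq v.ring 1 π) {θ : L} (hθ : θ ^ 2 = algebraMap K L π)
    (hθ1 : OrdEq w.ring 1 θ) {a' b' : v.ring} (ha : π ^ 2 * a' = (a : K))
    (hb : π ^ 3 * b' = (b : K)) :
    IsPrimitiveModel w.ring (W.baseChange L) (algebraMap K L c / θ) ⟨_, hw.mem a'⟩
      ⟨_, hw.mem b'⟩ where
  c_ne := div_ne_zero ((map_ne_zero _).2 h.c_ne) hθ1.ne_zero
  a_eq := by
    have := hθ1.ne_zero
    have e : θ ^ 4 * algebraMap K L a' = algebraMap K L a := by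
      rw [← ha, map_mul, map_pow, ← hθ]; ring
    rw [baseChange_a, div_pow, ← map_pow, div_mul_eq_mul_div, ← map_mul, ← h.a_eq, ← e]
    field_simp
  b_eq := by
    have := hθ1.ne_zero
    have e : θ ^ 6 * algebraMap K L b' = algebraMap K L b := by
      rw [← hb, map_mul, map_pow, ← hθ]; ring
    rw [baseChange_b, div_pow, ← map_pow, div_mul_eq_mul_div, ← map_mul, ← h.b_eq, ← e]
    field_simp
  min := by
    have he : OrdEq w.ring 2 (algebraMap K L π) := by
      rw [← hθ]; exact (hθ1.pow 2).congr (by norm_num)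
    -- Orders double in the ramified extension, so the fourth and sixth powers of the maximal ideal
    -- of w pull back to the second and third powers of that of v.
    have e4 := hw.ordGe_iff (x := a') (n := 2) hπ he two_pos
    have e6 := hw.ordGe_iff (x := b') (n := 3) hπ he two_pos
    norm_num at e4 e6
    rw [e4, e6]
    rintro ⟨h4, h6⟩
    refine h.min ⟨?_, ?_⟩
    · rw [← ha]; exact (hπ.pow 2).ge.mul_of_le h4 (by norm_num)
    · rw [← hb]; exact (hπ.pow 3).ge.mul_of_le h6 (by norm_num)

theorem IsPrimitiveModel.baseChange (h : IsPrimitiveModel v.ring W c a b) (hw : w.LiesOver v)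
    {π : K} (hπ : OrdEq v.ring 1 π) {θ : L} (hθ : θ ^ 2 = algebraMap K L π)
    (hθ1 : OrdEq w.ring 1 θ) (hab : ¬(OrdGe v.ring 2 (a : K) ∧ OrdGe v.ring 3 (b : K))) :
    IsPrimitiveModel w.ring (W.baseChange L) (algebraMap K L c) ⟨_, hw.mem a⟩
      ⟨_, hw.mem b⟩ where
  c_ne := (map_ne_zero _).2 h.c_ne
  a_eq := by
    rw [baseChange_a, ← map_pow, ← map_mul, ← h.a_eq]
  b_eq := by
    rw [baseChange_b, ← map_pow, ← map_mul, ← h.b_eq]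
  min := by
    have he : OrdEq w.ring 2 (algebraMap K L π) := by
      rw [← hθ]; exact (hθ1.pow 2).congr (by norm_num)
    have e4 := hw.ordGe_iff (x := a) (n := 2) hπ he two_pos
    have e6 := hw.ordGe_iff (x := b) (n := 3) hπ he two_pos
    norm_num at e4 e6
    rw [e4, e6]
    exact hab

instance [W.IsElliptic] : (W.baseChange L).IsElliptic :=
  inferInstanceAs (W.map _).IsElliptic

/-- At a ramified place of additive reduction, the curve still has additive reduction over the
quadratic extension, unless it has reduction of type `Iₙ*`. -/
theorem IsPrimitiveModel.additive_baseChange (h2 : OrdEq v.ring 0 (2 : K))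
    (h3 : OrdEq v.ring 0 (3 : K)) [W.IsElliptic] (h : IsPrimitiveModel v.ring W c a b)
    (hadd : AdditiveAt W v) (hw : w.LiesOver v) {π : K} (hπ : OrdEq v.ring 1 π) {θ : L}
    (hθ : θ ^ 2 = algebraMap K L π) (hθ1 : OrdEq w.ring 1 θ)
    (hs : ¬ IsStarPair v.ring (a : K) b) : AdditiveAt (W.baseChange L) w := by
  have h2' : OrdEq w.ring 0 (2 : L) := by
    have := hw.ordEq_zero h2
    rwa [map_ofNat] at this
  have h3' : OrdEq w.ring 0 (3 : L) := by
    have := hw.ordEq_zero h3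
    rwa [map_ofNat] at this
  have he : OrdEq w.ring 2 (algebraMap K L π) := by
    rw [← hθ]; exact (hθ1.pow 2).congr (by norm_num)
  have hmono : ∀ {x : K}, OrdGe v.ring 1 x → OrdGe w.ring 1 (algebraMap K L x) := fun hx =>
    ((hw.ordGe_iff hπ he two_pos).2 hx).mono (by norm_num)
  rw [AdditiveAt] at hadd ⊢
  rw [h.additive_iff h2 h3] at hadd
  by_cases hab : OrdGe v.ring 2 (a : K) ∧ OrdGe v.ring 3 (b : K)
  · obtain ⟨a', ha⟩ := exists_div_uniformizer hπ 2 hab.1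
    obtain ⟨b', hb⟩ := exists_div_uniformizer hπ 3 hab.2
    rw [(h.baseChange_div hw hπ hθ hθ1 ha hb).additive_iff h2' h3']
    have h' : OrdGe v.ring 3 (a : K) ∧ OrdGe v.ring 4 (b : K) := by
      by_contra hmin
      exact hs ⟨hab.1, hab.2, hmin⟩
    rw [← ha, ← hb] at h'
    exact ⟨hmono ((OrdGe.of_mul_left (hπ.pow 2) h'.1).mono (by norm_num)),
      hmono ((OrdGe.of_mul_left (hπ.pow 3) h'.2).mono (by norm_num))⟩
  · rw [(h.baseChange hw hπ hθ hθ1 hab).additive_iff h2' h3']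
    exact ⟨hmono hadd.1, hmono hadd.2⟩

end BaseChange

/-! ### Torsion at a place -/

section Torsion

open WeierstrassCurve IsLocalRing

theorem exists_torsion_smul {F : Type*} [Field F] [DecidableEq F] {W W' : WeierstrassCurve F}
    [W.IsElliptic] {C : VariableChange F} (hC : C • W = W') (T : AddSubgroup W.toAffine.Point) :
    ∃ T' : AddSubgroup W'.toAffine.Point, Nat.card T' = Nat.card T ∧
      ∀ P ∈ T', Nat.card T • P = 0 := by
  obtain ⟨φ, hφ, -⟩ := exists_pointHom C hC
  refine ⟨T.map φ, (Nat.card_congr (T.equivMapOfInjective φ hφ).toEquiv).symm, ?_⟩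
  rintro _ ⟨P, hP, rfl⟩
  have : Nat.card T • (⟨P, hP⟩ : T) = 0 := card_nsmul_eq_zero'
  have h0 : Nat.card T • P = 0 := congrArg Subtype.val this
  rw [← map_nsmul, h0, map_zero]

variable {K : Type*} [Field K] [DecidableEq K] {O : ValuationSubring K} [IsDiscreteValuationRing O]
  {W : WeierstrassCurve K} [W.IsElliptic] {c : K} {a b : O} {T : AddSubgroup W.toAffine.Point}

theorem IsPrimitiveModel.exists_addTorsion (h2 : OrdEq O 0 (2 : K)) (h3 : OrdEq O 0 (3 : K))
    (h : IsPrimitiveModel O W c a b) (hN : OrdEq O 0 (Nat.card T : K))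
    (ha : OrdGe O 1 (a : K)) (hb : OrdGe O 1 (b : K)) :
    ∃ T' : AddSubgroup (short (a : K) (b : K)).toAffine.Point, Nat.card T' = Nat.card T ∧
      AddTorsion O T' := by
  obtain ⟨C, hC⟩ := h.exists_smul h2.ne_zero h3.ne_zero
  obtain ⟨T', hcard, hT'⟩ := exists_torsion_smul hC T
  exact ⟨T', hcard, AddTorsion.mk' T' h2 h3 ha hb (h.disc_ne h2.ne_zero h3.ne_zero) hN hT'⟩

theorem IsPrimitiveModel.classification (h2 : OrdEq O 0 (2 : K)) (h3 : OrdEq O 0 (3 : K))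
    (h : IsPrimitiveModel O W c a b) (hN : OrdEq O 0 (Nat.card T : K)) (h1 : 1 < Nat.card T)
    (ha : OrdGe O 1 (a : K)) (hb : OrdGe O 1 (b : K)) :
    (Nat.card T = 2 ∧ ((OrdEq O 1 (a : K) ∧ OrdGe O 2 (b : K)) ∨
      (OrdEq O 3 (a : K) ∧ OrdGe O 5 (b : K)) ∨ IsStarPair O (a : K) b)) ∨
    (Nat.card T = 3 ∧ ((OrdGe O 2 (a : K) ∧ OrdEq O 2 (b : K)) ∨
      (OrdGe O 3 (a : K) ∧ OrdEq O 4 (b : K)))) ∨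
    (Nat.card T = 4 ∧ IsStarPair O (a : K) b) := by
  obtain ⟨T', hcard, hT'⟩ := h.exists_addTorsion h2 h3 hN ha hb
  have := hT'.classification h.min (hcard ▸ h1)
  rwa [hcard] at this

theorem IsPrimitiveModel.card_of_star (h2 : OrdEq O 0 (2 : K)) (h3 : OrdEq O 0 (3 : K))
    (h : IsPrimitiveModel O W c a b) (hN : OrdEq O 0 (Nat.card T : K)) (h1 : 1 < Nat.card T)
    (hs : IsStarPair O (a : K) b) : Nat.card T = 2 ∨ Nat.card T = 4 := by
  rcases h.classification h2 h3 hN h1 (hs.ord_a.mono (by norm_num))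
    (hs.ord_b.mono (by norm_num)) with h | h | h
  · exact Or.inl h.1
  · exfalso
    rcases h.2 with ⟨-, hb⟩ | ⟨ha, hb⟩
    · exact hb.not_ge (by norm_num) hs.ord_b
    · exact hs.min ⟨ha, hb.ge⟩
  · exact Or.inr h.1

theorem IsPrimitiveModel.dvd_card_good (h2 : OrdEq O 0 (2 : K)) (h3 : OrdEq O 0 (3 : K))
    (h : IsPrimitiveModel O W c a b) (hN : OrdEq O 0 (Nat.card T : K))
    (hd : OrdEq O 0 (disc (a : K) b)) :
    Nat.card T ∣ Nat.card (short (residue O a) (residue O b)).toAffine.Point := by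
  obtain ⟨C, hC⟩ := h.exists_smul h2.ne_zero h3.ne_zero
  obtain ⟨T', hcard, hT'⟩ := exists_torsion_smul hC T
  have hD : IsUnit (disc a b) := by
    rw [isUnit_iff_ordEq]
    have := map_disc O.subtype a b
    change OrdEq O 0 (O.subtype (disc a b))
    rw [this]
    exact hd
  rw [← hcard]
  exact card_dvd_of_good hD ((isUnit_iff_ordEq _).2 h2) T' hN hT'

theorem IsPrimitiveModel.dvd_card_star (h2 : OrdEq O 0 (2 : K)) (h3 : OrdEq O 0 (3 : K))
    (h : IsPrimitiveModel O W c a b) (hN : OrdEq O 0 (Nat.card T : K)) (h1 : 1 < Nat.card T)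
    (hs : IsStarPair O (a : K) b) {π : K} (hπ : OrdEq O 1 π) {a' b' : O}
    (ha : π ^ 2 * a' = (a : K)) (hb : π ^ 3 * b' = (b : K))
    (hd : OrdEq O 0 (disc (a' : K) b')) :
    Nat.card T ∣ Nat.card (short (residue O a') (residue O b')).toAffine.Point := by
  classical
  obtain ⟨T', hcard, hT'⟩ := h.exists_addTorsion h2 h3 hN (hs.ord_a.mono (by norm_num))
    (hs.ord_b.mono (by norm_num))
  rw [← hcard]
  refine hT'.dvd_card hs ?_ (hcard ▸ h.card_of_star h2 h3 hN h1 hs) hπ ha hb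
  rw [← ha, ← hb, disc_twist]
  exact ((hπ.pow 6).mul hd).congr (by norm_num)

end Torsion

/-! ### Local factors as power series -/

section Series

theorem constantCoeff_lin (c : ℤ) {d : ℕ} (hd : 0 < d) :
    PowerSeries.constantCoeff (lin c d) = 1 := by
  simp [lin, hd.ne']

theorem mul_inv1 {F : PowerSeries ℤ} (hF : PowerSeries.constantCoeff F = 1) : F * inv1 F = 1 :=
  PowerSeries.mul_invOfUnit F 1 (by simpa using hF)

theorem eq_inv1 {F G : PowerSeries ℤ} (hF : PowerSeries.constantCoeff F = 1) (h : F * G = 1) :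
    G = inv1 F := by
  calc G = F * inv1 F * G := by rw [mul_inv1 hF, one_mul]
    _ = F * G * inv1 F := by ring
    _ = inv1 F := by rw [h, one_mul]

theorem inv1_one : inv1 1 = 1 := (eq_inv1 (by simp) (by simp)).symm

theorem inv1_mul {F G : PowerSeries ℤ} (hF : PowerSeries.constantCoeff F = 1)
    (hG : PowerSeries.constantCoeff G = 1) : inv1 (F * G) = inv1 F * inv1 G := by
  refine (eq_inv1 (by rw [map_mul, hF, hG, one_mul]) ?_).symm
  calc F * G * (inv1 F * inv1 G) = (F * inv1 F) * (G * inv1 G) := by ring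
    _ = 1 := by rw [mul_inv1 hF, mul_inv1 hG, one_mul]

theorem CongrMod.inv1 {N : ℕ} {F G : PowerSeries ℤ} (h : CongrMod N F G)
    (hF : PowerSeries.constantCoeff F = 1) (hG : PowerSeries.constantCoeff G = 1) :
    CongrMod N (inv1 F) (inv1 G) := by
  have e1 := congrArg (PowerSeries.map (Int.castRingHom (ZMod N))) (mul_inv1 hF)
  have e2 := congrArg (PowerSeries.map (Int.castRingHom (ZMod N))) (mul_inv1 hG)
  rw [map_mul, map_one] at e1 e2
  rw [CongrMod] at h ⊢
  rw [h] at e1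
  exact (eq_comm.1 (left_inv_eq_right_inv ((mul_comm _ _).trans e2) e1))

theorem CongrMod.refl (N : ℕ) (F : PowerSeries ℤ) : CongrMod N F F := rfl

theorem CongrMod.of_add {N : ℕ} {F G H : PowerSeries ℤ} {m : ℤ} (hm : (N : ℤ) ∣ m)
    (h : F = G + PowerSeries.C m * H) : CongrMod N F G := by
  rw [CongrMod, h, map_add, map_mul, PowerSeries.map_C]
  have : (Int.castRingHom (ZMod N)) m = 0 := by
    rw [eq_intCast, ZMod.intCast_zmod_eq_zero_iff_dvd]; exact hm
  rw [this]
  simp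

theorem rescale_lin (q c : ℤ) (d : ℕ) : PowerSeries.rescale q (lin c d) = lin (c * q ^ d) d := by
  have hC : PowerSeries.rescale q (PowerSeries.C c) = PowerSeries.C c := by
    ext n
    rw [PowerSeries.coeff_rescale, PowerSeries.coeff_C]
    split_ifs with h
    · rw [h, pow_zero, one_mul]
    · rw [mul_zero]
  rw [lin, map_add, map_one, map_mul, map_pow, PowerSeries.rescale_X, hC, lin,
    mul_pow, map_mul, map_pow]
  ring

theorem rescale_inv1 (q : ℤ) {F : PowerSeries ℤ} (hF : PowerSeries.constantCoeff F = 1) :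
    PowerSeries.rescale q (inv1 F) = inv1 (PowerSeries.rescale q F) := by
  refine eq_inv1 ?_ ?_
  · rw [← PowerSeries.coeff_zero_eq_constantCoeff_apply, PowerSeries.coeff_rescale, pow_zero,
      one_mul, PowerSeries.coeff_zero_eq_constantCoeff_apply, hF]
  · rw [← map_mul, mul_inv1 hF, map_one]

/-- The good factor is congruent to that of a curve with trace `ε (1 + Q)`. -/
theorem congrMod_good {N d : ℕ} {Q n ε : ℤ} (hε : ε ^ 2 = 1)
    (h : (N : ℤ) ∣ n - (1 + ε) * (Q + 1)) :
    CongrMod N (1 + PowerSeries.C (-(Q + 1 - n)) * PowerSeries.X ^ d +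
      PowerSeries.C Q * PowerSeries.X ^ (2 * d)) (lin ε d * lin (ε * Q) d) := by
  refine CongrMod.of_add h (H := PowerSeries.X ^ d) ?_
  have : (PowerSeries.C ε : PowerSeries ℤ) ^ 2 = 1 := by rw [← map_pow, hε, map_one]
  simp only [lin, map_sub, map_add, map_mul, map_neg, map_one, pow_mul']
  linear_combination (-(PowerSeries.C Q) * PowerSeries.X ^ d * PowerSeries.X ^ d) * this

end Series

/-! ### Euler factors by reduction type -/

section EulerFactor

open IsLocalRing

variable {k K : Type*} [Field k] [Field K] [Algebra k K] {W : WeierstrassCurve K} {v : Place k K}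

theorem eulerFactor_split (h : SplitMultAt W v) : eulerFactor W v = lin (-1) v.deg := by
  rw [eulerFactor, localPolynomial_split h]
  simp [lin, sub_eq_add_neg]

theorem eulerFactor_nonsplit (h : NonsplitMultAt W v) : eulerFactor W v = lin 1 v.deg := by
  rw [eulerFactor, localPolynomial_nonsplit h.1 h.2]
  simp [lin]

theorem eulerFactor_additive (h : AdditiveAt W v) : eulerFactor W v = 1 := by
  rw [eulerFactor, localPolynomial_additive h]
  simp

theorem eulerFactor_good [W.IsElliptic] {c : K} {a b : v.ring} (h2 : OrdEq v.ring 0 (2 : K))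
    (h3 : OrdEq v.ring 0 (3 : K)) (h : IsPrimitiveModel v.ring W c a b)
    (hd : OrdEq v.ring 0 (disc (a : K) b)) :
    eulerFactor W v = 1 + PowerSeries.C (-((Nat.card v.residueField : ℤ) + 1 -
        Nat.card (short (residue v.ring a) (residue v.ring b)).toAffine.Point)) *
          PowerSeries.X ^ v.deg +
      PowerSeries.C (Nat.card v.residueField : ℤ) * PowerSeries.X ^ (2 * v.deg) := by
  rw [eulerFactor, h.localPolynomial_good h2 h3 hd]
  simp only [map_sub, map_add, map_mul, map_pow, map_one, map_neg, Polynomial.expand_C,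
    Polynomial.expand_X, Polynomial.coe_sub, Polynomial.coe_add, Polynomial.coe_mul,
    Polynomial.coe_pow, Polynomial.coe_C, Polynomial.coe_X, Polynomial.coe_one]
  ring

theorem constantCoeff_eulerFactor [W.IsElliptic] (hd : 0 < v.deg) :
    PowerSeries.constantCoeff (eulerFactor W v) = 1 := by
  have h0 : ∀ P : Polynomial ℤ, P.coeff 0 = 1 →
      PowerSeries.constantCoeff ((Polynomial.expand ℤ v.deg P : Polynomial ℤ) : PowerSeries ℤ) = 1 :=
    fun P hP => by
      rw [← PowerSeries.coeff_zero_eq_constantCoeff_apply, Polynomial.coeff_coe,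
        Polynomial.coeff_expand hd]
      simpa using hP
  refine h0 _ ?_
  rw [WeierstrassCurve.localPolynomial]
  split_ifs <;> simp [Polynomial.coeff_one, Polynomial.coeff_X]

theorem constantCoeff_artinFactor (L : Type*) [Field L] [Algebra k L] [Algebra K L]
    (hd : 0 < v.deg) : PowerSeries.constantCoeff (artinFactor L v) = 1 := by
  rw [artinFactor]
  split_ifs
  · exact constantCoeff_lin _ hd
  · exact constantCoeff_lin _ hd
  · simp

end EulerFactor

/-! ### The contribution of a single place to the correction terms -/

section LocalFactors

variable {k K : Type*} [Field k] [Field K] [Algebra k K] (L : Type*) [Field L] [Algebra k L]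
  [Algebra K L] (W : WeierstrassCurve K) (v : Place k K)

/-- The factor of `R(T)` at `v` coming from multiplicative reduction. -/
def RmultAt : PowerSeries ℤ :=
  (MspUnr k L W).mulIndicator (fun v => lin (sgn L v * (Nat.card k : ℤ) ^ v.deg) v.deg) v *
  (MnsUnr k L W).mulIndicator (fun v => lin (sgn L v) v.deg *
    lin (sgn L v * (Nat.card k : ℤ) ^ v.deg) v.deg * inv1 (lin (-sgn L v) v.deg)) v

/-- The factor of `R(T)` at `v` coming from additive reduction. -/
def RaddAt : PowerSeries ℤ :=
  (AUnr k L W).mulIndicator (fun v => lin (sgn L v) v.deg *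
    lin (sgn L v * (Nat.card k : ℤ) ^ v.deg) v.deg) v

/-- The factor of `γ_ram` at `v`. -/
def gammaAt : PowerSeries ℤ :=
  (ARamSp k L W).mulIndicator (fun v => inv1 (lin (-1) v.deg)) v *
  (ARamNs k L W).mulIndicator (fun v => inv1 (lin 1 v.deg)) v *
  (ARamGd k L W).mulIndicator (fun v => inv1 (lin (-1) v.deg) *
    inv1 (lin (-(Nat.card k : ℤ) ^ v.deg) v.deg)) v

/-- The factor of `R(T) γ_ram` at `v`. -/
def correctionAt (N : ℕ) : PowerSeries ℤ :=
  if 5 ≤ N then RmultAt L W v else RmultAt L W v * RaddAt L W v * gammaAt L W v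

variable {L W v}

theorem SplitMultAt.not_nonsplitMultAt (h : SplitMultAt W v) : ¬ NonsplitMultAt W v :=
  fun h' => h'.2 h

theorem SplitMultAt.not_additiveAt (h : SplitMultAt W v) : ¬ AdditiveAt W v :=
  h.toHasMultiplicativeReduction.not_hasAdditiveReduction

theorem SplitMultAt.not_goodAt (h : SplitMultAt W v) : ¬ GoodAt W v :=
  h.toHasMultiplicativeReduction.not_hasGoodReduction

theorem NonsplitMultAt.not_additiveAt (h : NonsplitMultAt W v) : ¬ AdditiveAt W v :=
  h.1.not_hasAdditiveReduction

theorem NonsplitMultAt.not_goodAt (h : NonsplitMultAt W v) : ¬ GoodAt W v :=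
  h.1.not_hasGoodReduction

theorem AdditiveAt.not_goodAt (h : AdditiveAt W v) : ¬ GoodAt W v :=
  h.not_hasGoodReduction

theorem reduction_cases (W : WeierstrassCurve K) (v : Place k K) :
    GoodAt W v ∨ SplitMultAt W v ∨ NonsplitMultAt W v ∨ AdditiveAt W v := by
  rcases WeierstrassCurve.hasGoodReduction_or_hasMultiplicativeReduction_or_hasAdditiveReduction
    v.ring (W := W.minimal v.ring) with h | h | h
  · exact Or.inl h
  · by_cases hs : SplitMultAt W v
    · exact Or.inr (Or.inl hs)
    · exact Or.inr (Or.inr (Or.inl ⟨h, hs⟩))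
  · exact Or.inr (Or.inr (Or.inr h))

theorem RmultAt_eq_one (h : (¬ SplitMultAt W v ∧ ¬ NonsplitMultAt W v) ∨ ¬ v.IsUnramified L) :
    RmultAt L W v = 1 := by
  rw [RmultAt, Set.mulIndicator_of_notMem, Set.mulIndicator_of_notMem, one_mul]
  · exact fun hv => h.elim (fun h => h.2 hv.1) fun h => h hv.2
  · exact fun hv => h.elim (fun h => h.1 hv.1) fun h => h hv.2

theorem RaddAt_eq_one (h : ¬ AdditiveAt W v ∨ ¬ v.IsUnramified L) : RaddAt L W v = 1 := by
  rw [RaddAt, Set.mulIndicator_of_notMem]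
  exact fun hv => h.elim (fun h => h hv.1) fun h => h hv.2

theorem gammaAt_eq_one (h : ¬ AdditiveAt W v ∨ ¬ v.IsRamified L ∨
    ∀ w : Place k L, w.LiesOver v → AdditiveAt (W.baseChange L) w) : gammaAt L W v = 1 := by
  have key : ∀ p : Place k L → Prop, (∀ w, AdditiveAt (W.baseChange L) w → ¬ p w) →
      ¬(AdditiveAt W v ∧ v.IsRamified L ∧ ∃ w : Place k L, w.LiesOver v ∧ p w) := by
    rintro p hp ⟨h1, h2, w, hw, hpw⟩
    rcases h with h | h | h
    · exact h h1
    · exact h h2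
    · exact hp w (h w hw) hpw
  rw [gammaAt, Set.mulIndicator_of_notMem, Set.mulIndicator_of_notMem, Set.mulIndicator_of_notMem,
    one_mul, one_mul]
  · exact key _ fun w h h' => h.not_goodAt h'
  · exact key _ fun w h h' => h'.not_additiveAt h
  · exact key _ fun w h h' => h'.not_additiveAt h

end LocalFactors

/-! ### The local congruence at unramified places -/

section LocalIdentity

open IsLocalRing

variable {k K L : Type*} [Field k] [Field K] [Field L] [Algebra k K] [Algebra k L] [Algebra K L]
  {v : Place k K}

theorem Place.ordEq_natCast (v : Place k K) {n : ℕ} (hn : (n : k) ≠ 0) :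
    OrdEq v.ring 0 (n : K) := by
  have := v.ordEq_algebraMap hn
  rwa [map_natCast] at this

/-- The right hand side of the congruence at `v`. -/
theorem rhs_eq_of_unramified (hd : 0 < v.deg) (hart : artinFactor L v = lin (sgn L v) v.deg) :
    inv1 (artinFactor L v) * PowerSeries.rescale (Nat.card k : ℤ) (inv1 (artinFactor L v)) =
      inv1 (lin (sgn L v) v.deg) * inv1 (lin (sgn L v * (Nat.card k : ℤ) ^ v.deg) v.deg) := by
  rw [hart, rescale_inv1 _ (constantCoeff_lin _ hd), rescale_lin]

theorem isSquare_mul_iff_of_finite {F : Type*} [Field F] [Finite F] {x y : F} (hx : x ≠ 0)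
    (hy : y ≠ 0) : IsSquare (x * y) ↔ (IsSquare x ↔ IsSquare y) := by
  classical
  have := Fintype.ofFinite F
  rw [← quadraticChar_one_iff_isSquare hx, ← quadraticChar_one_iff_isSquare hy,
    ← quadraticChar_one_iff_isSquare (mul_ne_zero hx hy), map_mul]
  rcases quadraticChar_dichotomy hx with h | h <;> rcases quadraticChar_dichotomy hy with h' | h' <;>
    simp [h, h']

/-- With a a unit and 4a³ + 27b² in m, b cannot lie in m. So multiplying by a nonsquare unit really
changes the square class that decides splitness. -/
theorem residue_ne_zero_of_multiplicative {O : ValuationSubring K} [IsDiscreteValuationRing O]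
    {a b : O} (h2 : OrdEq O 0 (2 : K)) (hd : OrdGe O 1 (disc (a : K) b))
    (ha : OrdEq O 0 (a : K)) : residue O (-2 * a * b) ≠ 0 := by
  rw [ne_eq, residue_eq_zero_iff_ordGe]
  intro hab
  have hb : OrdGe O 1 (b : K) := by
    have h' : OrdEq O 0 (-2 * (a : K)) := h2.neg.unit_mul ha
    exact (OrdGe.of_mul_left h' hab).mono (by norm_num)
  have h4 : OrdEq O 0 (4 * (a : K) ^ 3) := by
    have : (4 : K) = 2 ^ 2 := by norm_num
    rw [this]
    exact ((h2.pow 2).mul (ha.pow 3)).congr (by norm_num)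
  have h27 : OrdGe O 0 (27 : K) := ordGe_zero_iff.2 (27 : O).2
  refine h4.not_ge (m := 1) (by norm_num) ?_
  have : 4 * (a : K) ^ 3 = disc (a : K) b - 27 * (b : K) ^ 2 := by simp only [disc]; ring
  rw [this]
  exact hd.sub (h27.mul_of_le (hb.pow_of_le (l := 1) (by norm_num)) (by norm_num))

variable [Finite k] [DecidableEq K]
  {W : WeierstrassCurve K} [W.IsElliptic] {T : AddSubgroup W.toAffine.Point} {f : K}

/-- The local congruence at an unramified place. -/
theorem congrMod_of_unramified (hK : IsCurveFunctionField k K)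
    (h2 : OrdEq v.ring 0 (2 : K)) (h3 : OrdEq v.ring 0 (3 : K))
    (hN : OrdEq v.ring 0 (Nat.card T : K)) (h1 : 1 < Nat.card T)
    {u : v.ring} {g : K} (hu : IsUnit u) (hg : g ≠ 0) (hf : f = u * g ^ 2)
    (hunr : v.IsUnramified L) (hram : ¬ v.IsRamified L)
    (hart : artinFactor L v = lin (sgn L v) v.deg)
    (hs : (IsSquare (residue v.ring u) ∧ sgn L v = -1) ∨
      (¬ IsSquare (residue v.ring u) ∧ sgn L v = 1)) :
    CongrMod (Nat.card T) (inv1 (eulerFactor (quadraticTwist W f) v))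
      (inv1 (artinFactor L v) * PowerSeries.rescale (Nat.card k : ℤ) (inv1 (artinFactor L v)) *
        correctionAt L W v (Nat.card T)) := by
  have hd := hK.deg_pos v
  have hfin := hK.finite v
  obtain ⟨c, a, b, h⟩ := exists_isPrimitiveModel v.ring h2 h3 W
  have hu0 : OrdEq v.ring 0 (u : K) := (isUnit_iff_ordEq u).1 hu
  have hur : residue v.ring u ≠ 0 := (hu.map (residue v.ring)).ne_zero
  have htw := h.twist_unit h2.ne_zero h3.ne_zero hu hg hf
  have hell := quadraticTwist_isElliptic (W := W) h2.ne_zero h3.ne_zero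
    (hf ▸ mul_ne_zero hu0.ne_zero (pow_ne_zero 2 hg))
  have hdisc : disc ((u ^ 2 * a : v.ring) : K) ((u ^ 3 * b : v.ring) : K) =
      (u : K) ^ 6 * disc (a : K) b := by
    push_cast; exact disc_twist _ _ _
  have hu6 : OrdEq v.ring 0 ((u : K) ^ 6) := (hu0.pow 6).congr (by norm_num)
  have hu2 : OrdEq v.ring 0 ((u : K) ^ 2) := (hu0.pow 2).congr (by norm_num)
  have hu3 : OrdEq v.ring 0 ((u : K) ^ 3) := (hu0.pow 3).congr (by norm_num)
  have hmult : (((quadraticTwist W f).minimal v.ring).HasMultiplicativeReduction v.ring ↔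
      (W.minimal v.ring).HasMultiplicativeReduction v.ring) := by
    rw [htw.multiplicative_iff h2 h3, h.multiplicative_iff h2 h3, hdisc, ordGe_unit_mul_iff hu6]
    push_cast
    rw [ordEq_unit_mul_iff hu2]
  -- the residue whose squareness decides whether the twist splits
  have hsq : IsSquare (residue v.ring (-2 * (u ^ 2 * a) * (u ^ 3 * b))) ↔
      IsSquare (residue v.ring u * residue v.ring (-2 * a * b)) := by
    have : residue v.ring (-2 * (u ^ 2 * a) * (u ^ 3 * b)) =
        (residue v.ring u ^ 2) ^ 2 * (residue v.ring u * residue v.ring (-2 * a * b)) := by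
      simp only [← map_pow, ← map_mul]
      ring_nf
    rw [this, isSquare_sq_mul_iff (pow_ne_zero _ hur)]
  have hq : (Nat.card v.residueField : ℤ) = (Nat.card k : ℤ) ^ v.deg := by
    rw [hK.card_residueField v]; push_cast; rfl
  have hγ : gammaAt L W v = 1 := gammaAt_eq_one (Or.inr (Or.inl hram))
  rw [rhs_eq_of_unramified hd hart, correctionAt, hγ, mul_one]
  set s := sgn L v with hsdef
  set q := (Nat.card k : ℤ) ^ v.deg with hqdef
  have cs : ∀ c : ℤ, PowerSeries.constantCoeff (lin c v.deg) = 1 :=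
    fun c => constantCoeff_lin c hd
  have hcancel : ∀ c : ℤ, lin c v.deg * inv1 (lin c v.deg) = 1 := fun c => mul_inv1 (cs c)
  rcases reduction_cases W v with hred | hred | hred | hred
  · -- good reduction
    have hR : RmultAt L W v = 1 := RmultAt_eq_one (Or.inl
      ⟨fun h' => h'.not_goodAt hred, fun h' => h'.not_goodAt hred⟩)
    have hA : RaddAt L W v = 1 := RaddAt_eq_one (Or.inl fun h' => h'.not_goodAt hred)
    rw [hR, hA, mul_one, ite_self, mul_one, ← inv1_mul (cs _) (cs _)]
    rw [GoodAt, h.good_iff h2 h3] at hred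
    have hdf : OrdEq v.ring 0 (disc ((u ^ 2 * a : v.ring) : K) ((u ^ 3 * b : v.ring) : K)) := by
      rw [hdisc]; exact hu6.unit_mul hred
    have hef := eulerFactor_good h2 h3 htw hdf
    -- The only place in this proof where a genuine congruence is needed; in the other three cases
    -- the two sides are equal.
    have hdvd := h.dvd_card_good h2 h3 hN hred
    have hdvd' : (Nat.card T : ℤ) ∣
        Nat.card (short (residue v.ring a) (residue v.ring b)).toAffine.Point := by
      exact_mod_cast hdvd
    have hdr : disc (residue v.ring a) (residue v.ring b) ≠ 0 := by
      rw [← map_disc, ne_eq, residue_eq_zero_iff_ordGe]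
      have := map_disc v.ring.subtype a b
      change ¬ OrdGe v.ring 1 (v.ring.subtype (disc a b))
      rw [this]
      exact hred.not_ge (by norm_num)
    refine CongrMod.inv1 ?_ (constantCoeff_eulerFactor hd) (by rw [map_mul, cs, cs, one_mul])
    rw [hef, hq]
    -- For a square unit the twist has the same number n of points, and n ≡ 0. For a nonsquare it
    -- has 2(q^d + 1) - n ≡ 2(q^d + 1). Both fit `congrMod_good` with ε the sign of v.
    rcases hs with ⟨husq, hs⟩ | ⟨husq, hs⟩
    · refine congrMod_good (by rw [hs]; norm_num) ?_
      rw [map_mul, map_mul, map_pow, map_pow,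
        card_twist_of_isSquare (residue_two_ne h2) hdr hur husq, hs]
      simpa using hdvd'
    · refine congrMod_good (by rw [hs]; norm_num) ?_
      rw [map_mul, map_mul, map_pow, map_pow,
        card_twist_of_not_isSquare (residue_two_ne h2) hdr husq, hs, hq]
      have : 2 * (q + 1) - (Nat.card (short (residue v.ring a) (residue v.ring b)).toAffine.Point : ℤ)
          - (1 + 1) * (q + 1) =
          -(Nat.card (short (residue v.ring a) (residue v.ring b)).toAffine.Point : ℤ) := by ring
      rw [this]
      exact hdvd'.neg_right
  · -- split multiplicative reduction
    have hA : RaddAt L W v = 1 := RaddAt_eq_one (Or.inl hred.not_additiveAt)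
    have hR : RmultAt L W v = lin (s * q) v.deg := by
      rw [RmultAt, Set.mulIndicator_of_mem, Set.mulIndicator_of_notMem, mul_one]
      · exact fun h' => hred.not_nonsplitMultAt h'.1
      · exact ⟨hred, hunr⟩
    -- The correction removes the factor in qT, leaving the Euler factor of a twist that is split
    -- exactly when v is.
    rw [hA, mul_one, ite_self, hR, mul_assoc, mul_comm (inv1 _) (lin (s * q) v.deg), hcancel,
      mul_one]
    have hm := hmult.2 hred.toHasMultiplicativeReduction
    obtain ⟨hm', hsp⟩ := (h.split_iff h2 h3).1 hred
    have hne := residue_ne_zero_of_multiplicative h2 hm'.1 hm'.2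
    rcases hs with ⟨husq, hs⟩ | ⟨husq, hs⟩
    · have : SplitMultAt (quadraticTwist W f) v := by
        rw [SplitMultAt, htw.split_iff h2 h3, hsq, ← htw.multiplicative_iff h2 h3]
        exact ⟨hm, husq.mul hsp⟩
      rw [eulerFactor_split this, hs]
      exact CongrMod.refl _ _
    · have : NonsplitMultAt (quadraticTwist W f) v := by
        refine ⟨hm, ?_⟩
        rw [htw.split_iff h2 h3, hsq,
          isSquare_mul_iff_of_finite hur hne]
        exact fun h' => husq (h'.2.2 hsp)
      rw [eulerFactor_nonsplit this, hs]
      exact CongrMod.refl _ _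
  · -- nonsplit multiplicative reduction
    have hA : RaddAt L W v = 1 := RaddAt_eq_one (Or.inl hred.not_additiveAt)
    have hR : RmultAt L W v = lin s v.deg * lin (s * q) v.deg * inv1 (lin (-s) v.deg) := by
      rw [RmultAt, Set.mulIndicator_of_notMem, Set.mulIndicator_of_mem, one_mul]
      · exact ⟨hred, hunr⟩
      · exact fun h' => h'.1.not_nonsplitMultAt hred
    have hrhs : inv1 (lin s v.deg) * inv1 (lin (s * q) v.deg) *
        (lin s v.deg * lin (s * q) v.deg * inv1 (lin (-s) v.deg)) = inv1 (lin (-s) v.deg) := by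
      linear_combination (lin (s * q) v.deg * inv1 (lin (s * q) v.deg) * inv1 (lin (-s) v.deg)) *
        hcancel s + inv1 (lin (-s) v.deg) * hcancel (s * q)
    rw [hA, mul_one, ite_self, hR, hrhs]
    have hm := hmult.2 hred.1
    have hm' := (h.multiplicative_iff h2 h3).1 hred.1
    have hne := residue_ne_zero_of_multiplicative h2 hm'.1 hm'.2
    have hsp : ¬ IsSquare (residue v.ring (-2 * a * b)) := fun hc =>
      hred.2 ((h.split_iff h2 h3).2 ⟨hm', hc⟩)
    rcases hs with ⟨husq, hs⟩ | ⟨husq, hs⟩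
    · have : NonsplitMultAt (quadraticTwist W f) v := by
        refine ⟨hm, ?_⟩
        rw [htw.split_iff h2 h3, hsq, isSquare_mul_iff_of_finite hur hne]
        exact fun h' => hsp (h'.2.1 husq)
      rw [eulerFactor_nonsplit this, hs, neg_neg]
      exact CongrMod.refl _ _
    · have : SplitMultAt (quadraticTwist W f) v := by
        rw [SplitMultAt, htw.split_iff h2 h3, hsq, ← htw.multiplicative_iff h2 h3,
          isSquare_mul_iff_of_finite hur hne]
        exact ⟨hm, iff_of_false husq hsp⟩
      rw [eulerFactor_split this, hs]
      exact CongrMod.refl _ _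
  · -- additive reduction
    have hR : RmultAt L W v = 1 := RmultAt_eq_one (Or.inl
      ⟨fun h' => h'.not_additiveAt hred, fun h' => h'.not_additiveAt hred⟩)
    have hA : RaddAt L W v = lin s v.deg * lin (s * q) v.deg := by
      rw [RaddAt, Set.mulIndicator_of_mem]
      exact ⟨hred, hunr⟩
    have hab := (h.additive_iff h2 h3).1 hred
    -- Torsion of order at least 5 excludes additive reduction, which is why the additive factors
    -- may be dropped for N ≥ 5.
    have hle : ¬ 5 ≤ Nat.card T := by
      rcases h.classification h2 h3 hN h1 hab.1 hab.2 with h' | h' | h' <;> omega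
    have hrhs : inv1 (lin s v.deg) * inv1 (lin (s * q) v.deg) *
        (lin s v.deg * lin (s * q) v.deg) = 1 := by
      linear_combination (lin (s * q) v.deg * inv1 (lin (s * q) v.deg)) *
        hcancel s + hcancel (s * q)
    rw [if_neg hle, hR, hA, one_mul, hrhs]
    have : AdditiveAt (quadraticTwist W f) v := by
      rw [AdditiveAt, htw.additive_iff h2 h3]
      push_cast
      exact ⟨hu2.unit_mul_ge hab.1, hu3.unit_mul_ge hab.2⟩
    rw [eulerFactor_additive this, inv1_one]
    exact CongrMod.refl _ _

end LocalIdentity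

/-! ### The local congruence at ramified places -/

section RamifiedIdentity

open IsLocalRing

variable {k K L : Type*} [Field k] [Field K] [Field L] [Algebra k K] [Algebra k L] [Algebra K L]
  {v : Place k K} {w : Place k L}

theorem Place.LiesOver.ordGe_one_iff (hw : w.LiesOver v) {π x : K} {e : ℤ}
    (hπ : OrdEq v.ring 1 π) (he : OrdEq w.ring e (algebraMap K L π)) (hpos : 0 < e) :
    OrdGe w.ring 1 (algebraMap K L x) ↔ OrdGe v.ring 1 x := by
  constructor
  · intro h
    have h0 := hw.ordGe_zero_iff.1 (h.mono zero_le_one)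
    rcases h0.eq_or with h' | h'
    · exact absurd h ((hw.ordEq_zero h').not_ge one_pos)
    · exact h'
  · intro h
    exact ((hw.ordGe_iff (n := 1) hπ he hpos).2 h).mono (by omega)

theorem Place.LiesOver.ordEq_zero_iff (hw : w.LiesOver v) {π x : K} {e : ℤ}
    (hπ : OrdEq v.ring 1 π) (he : OrdEq w.ring e (algebraMap K L π)) (hpos : 0 < e) :
    OrdEq w.ring 0 (algebraMap K L x) ↔ OrdEq v.ring 0 x :=
  ⟨fun h => (hw.ordGe_zero_iff.1 h.ge).eq_of_not fun h' =>
    h.not_ge one_pos ((hw.ordGe_one_iff hπ he hpos).2 h'), hw.ordEq_zero⟩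

variable [IsScalarTower k K L] {W : WeierstrassCurve K} [W.IsElliptic] {c : K} {a b : v.ring}
  {f g π : K} {θ : L}

/-- At a ramified place of type `Iₙ*`, the twist and the base change to the quadratic extension have
the same type of reduction. -/
theorem IsPrimitiveModel.reduction_iff (h2 : OrdEq v.ring 0 (2 : K)) (h3 : OrdEq v.ring 0 (3 : K))
    (h : IsPrimitiveModel v.ring W c a b) (hθ : IsSqrtGenerator θ π) (hπ : OrdEq v.ring 1 π)
    (hg : g ≠ 0) (hf : f = π * g ^ 2) (hs : IsStarPair v.ring (a : K) b) (hw : w.LiesOver v) :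
    (GoodAt (W.baseChange L) w ↔ GoodAt (quadraticTwist W f) v) ∧
    (SplitMultAt (W.baseChange L) w ↔ SplitMultAt (quadraticTwist W f) v) ∧
    (NonsplitMultAt (W.baseChange L) w ↔ NonsplitMultAt (quadraticTwist W f) v) ∧
    (AdditiveAt (W.baseChange L) w ↔ AdditiveAt (quadraticTwist W f) v) := by
  have h2' : OrdEq w.ring 0 (2 : L) := by
    have := hw.ordEq_zero h2
    rwa [map_ofNat] at this
  have h3' : OrdEq w.ring 0 (3 : L) := by
    have := hw.ordEq_zero h3
    rwa [map_ofNat] at this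
  have hθ1 := (Place.existsUnique_of_ramified hθ hπ).2 w hw
  have he : OrdEq w.ring 2 (algebraMap K L π) := by
    rw [← hθ.sq]; exact (hθ1.pow 2).congr (by norm_num)
  obtain ⟨a', ha⟩ := exists_div_uniformizer hπ 2 hs.ord_a
  obtain ⟨b', hb⟩ := exists_div_uniformizer hπ 3 hs.ord_b
  have htw := h.twist_uniformizer_div h2.ne_zero h3.ne_zero hπ hg hf ha hb
  have hbc := h.baseChange_div hw hπ hθ.sq hθ1 ha hb
  have hell := quadraticTwist_isElliptic (W := W) h2.ne_zero h3.ne_zero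
    (hf ▸ mul_ne_zero hπ.ne_zero (pow_ne_zero 2 hg))
  have hdisc : disc (algebraMap K L a') (algebraMap K L b') =
      algebraMap K L (disc (a' : K) b') := (map_disc _ _ _).symm
  have hgood : GoodAt (W.baseChange L) w ↔ GoodAt (quadraticTwist W f) v := by
    rw [GoodAt, GoodAt, htw.good_iff h2 h3, hbc.good_iff h2' h3', hdisc,
      hw.ordEq_zero_iff hπ he two_pos]
  have hmult : ((W.baseChange L).minimal w.ring).HasMultiplicativeReduction w.ring ↔
      ((quadraticTwist W f).minimal v.ring).HasMultiplicativeReduction v.ring := by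
    rw [htw.multiplicative_iff h2 h3, hbc.multiplicative_iff h2' h3', hdisc,
      hw.ordEq_zero_iff hπ he two_pos, hw.ordGe_one_iff hπ he two_pos]
  have hsplit : SplitMultAt (W.baseChange L) w ↔ SplitMultAt (quadraticTwist W f) v := by
    rw [SplitMultAt, SplitMultAt, htw.split_iff h2 h3, hbc.split_iff h2' h3',
      ← htw.multiplicative_iff h2 h3, ← hbc.multiplicative_iff h2' h3', hmult]
    refine and_congr_right fun _ => ?_
    refine Place.LiesOver.isSquare_residue_iff hθ hπ hw _ _ ?_
    have e2 : ((2 : w.ring) : L) = algebraMap K L ((2 : v.ring) : K) := (map_ofNat _ 2).symm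
    simp only [MulMemClass.coe_mul, NegMemClass.coe_neg, map_mul, map_neg, e2]
  refine ⟨hgood, hsplit, and_congr hmult (not_congr hsplit), ?_⟩
  rw [AdditiveAt, AdditiveAt, htw.additive_iff h2 h3, hbc.additive_iff h2' h3',
    hw.ordGe_one_iff hπ he two_pos, hw.ordGe_one_iff hπ he two_pos]

/-- The curve has reduction of type `Iₙ*` at the ramified places where it has additive reduction
that improves over the quadratic extension. -/
theorem IsPrimitiveModel.isStarPair_of_mem (h2 : OrdEq v.ring 0 (2 : K))
    (h3 : OrdEq v.ring 0 (3 : K)) (h : IsPrimitiveModel v.ring W c a b) (hθ : IsSqrtGenerator θ π)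
    (hπ : OrdEq v.ring 1 π) (hv : v ∈ ARamSp k L W ∪ ARamNs k L W ∪ ARamGd k L W) :
    IsStarPair v.ring (a : K) b := by
  by_contra hs
  have hadd : AdditiveAt W v → ∀ w : Place k L, w.LiesOver v → AdditiveAt (W.baseChange L) w :=
    fun hv w hw => h.additive_baseChange h2 h3 hv hw hπ hθ.sq
      ((Place.existsUnique_of_ramified hθ hπ).2 w hw) hs
  rcases hv with (⟨h1, -, w, hw, hr⟩ | ⟨h1, -, w, hw, hr⟩) | ⟨h1, -, w, hw, hr⟩
  · exact hr.not_additiveAt (hadd h1 w hw)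
  · exact hr.not_additiveAt (hadd h1 w hw)
  · exact (hadd h1 w hw).not_goodAt hr

variable [Finite k] [DecidableEq K] {T : AddSubgroup W.toAffine.Point}

/-- The local congruence at a ramified place. -/
theorem congrMod_of_ramified (hK : IsCurveFunctionField k K)
    (h2 : OrdEq v.ring 0 (2 : K)) (h3 : OrdEq v.ring 0 (3 : K))
    (hN : OrdEq v.ring 0 (Nat.card T : K)) (h1 : 1 < Nat.card T)
    (hθ : IsSqrtGenerator θ π) (hπ : OrdEq v.ring 1 π) (hg : g ≠ 0) (hf : f = π * g ^ 2)
    (hram : v.IsRamified L) (hunr : ¬ v.IsUnramified L) (hart : artinFactor L v = 1) :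
    CongrMod (Nat.card T) (inv1 (eulerFactor (quadraticTwist W f) v))
      (inv1 (artinFactor L v) * PowerSeries.rescale (Nat.card k : ℤ) (inv1 (artinFactor L v)) *
        correctionAt L W v (Nat.card T)) := by
  have hd := hK.deg_pos v
  obtain ⟨c, a, b, h⟩ := exists_isPrimitiveModel v.ring h2 h3 W
  have hell := quadraticTwist_isElliptic (W := W) h2.ne_zero h3.ne_zero
    (hf ▸ mul_ne_zero hπ.ne_zero (pow_ne_zero 2 hg))
  rw [hart, inv1_one, map_one, one_mul, one_mul, correctionAt, RmultAt_eq_one (Or.inr hunr),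
    RaddAt_eq_one (Or.inr hunr), one_mul, one_mul]
  -- Only type Iₙ* allows the twist to be non-additive. For every other type, including good and
  -- multiplicative reduction of E, the Euler factor of the twist and the correction are both 1.
  by_cases hs : IsStarPair v.ring (a : K) b
  · have hle : ¬ 5 ≤ Nat.card T := by
      rcases h.card_of_star h2 h3 hN h1 hs with h' | h' <;> omega
    rw [if_neg hle]
    have hadd : AdditiveAt W v := (h.additive_iff h2 h3).2
      ⟨hs.ord_a.mono (by norm_num), hs.ord_b.mono (by norm_num)⟩
    have hiff := fun (w : Place k L) (hw : w.LiesOver v) =>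
      h.reduction_iff h2 h3 hθ hπ hg hf hs hw
    obtain ⟨w, hw, -⟩ := (Place.existsUnique_of_ramified hθ hπ).1
    -- membership in the three sets is determined by the reduction of the twist
    have hSp : v ∈ ARamSp k L W ↔ SplitMultAt (quadraticTwist W f) v :=
      ⟨fun ⟨_, _, w, hw, hr⟩ => (hiff w hw).2.1.1 hr,
        fun hr => ⟨hadd, hram, w, hw, (hiff w hw).2.1.2 hr⟩⟩
    have hNs : v ∈ ARamNs k L W ↔ NonsplitMultAt (quadraticTwist W f) v :=
      ⟨fun ⟨_, _, w, hw, hr⟩ => (hiff w hw).2.2.1.1 hr,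
        fun hr => ⟨hadd, hram, w, hw, (hiff w hw).2.2.1.2 hr⟩⟩
    have hGd : v ∈ ARamGd k L W ↔ GoodAt (quadraticTwist W f) v :=
      ⟨fun ⟨_, _, w, hw, hr⟩ => (hiff w hw).1.1 hr,
        fun hr => ⟨hadd, hram, w, hw, (hiff w hw).1.2 hr⟩⟩
    rw [gammaAt]
    rcases reduction_cases (quadraticTwist W f) v with hred | hred | hred | hred
    · rw [Set.mulIndicator_of_notMem fun h' => (hSp.1 h').not_goodAt hred,
        Set.mulIndicator_of_notMem fun h' => (hNs.1 h').not_goodAt hred,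
        Set.mulIndicator_of_mem (hGd.2 hred), one_mul, one_mul,
        ← inv1_mul (constantCoeff_lin _ hd) (constantCoeff_lin _ hd)]
      obtain ⟨a', ha⟩ := exists_div_uniformizer hπ 2 hs.ord_a
      obtain ⟨b', hb⟩ := exists_div_uniformizer hπ 3 hs.ord_b
      have htw := h.twist_uniformizer_div h2.ne_zero h3.ne_zero hπ hg hf ha hb
      rw [GoodAt, htw.good_iff h2 h3] at hred
      -- Good reduction of the twist means type I₀* for E. Here the divisibility comes from the
      -- 2-torsion of the reduced twist, not from reducing points of E.
      have hdvd : (Nat.card T : ℤ) ∣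
          Nat.card (short (residue v.ring a') (residue v.ring b')).toAffine.Point := by
        exact_mod_cast h.dvd_card_star h2 h3 hN h1 hs hπ ha hb hred
      refine CongrMod.inv1 ?_ (constantCoeff_eulerFactor hd)
        (by rw [map_mul, constantCoeff_lin _ hd, constantCoeff_lin _ hd, one_mul])
      rw [eulerFactor_good h2 h3 htw hred]
      have hq : (Nat.card v.residueField : ℤ) = (Nat.card k : ℤ) ^ v.deg := by
        rw [hK.card_residueField v]; push_cast; rfl
      rw [hq, ← neg_one_mul ((Nat.card k : ℤ) ^ v.deg)]
      exact congrMod_good (by norm_num) (by simpa using hdvd)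
    · rw [Set.mulIndicator_of_mem (hSp.2 hred),
        Set.mulIndicator_of_notMem fun h' => (hNs.1 h').2 hred,
        Set.mulIndicator_of_notMem fun h' => hred.not_goodAt (hGd.1 h'), mul_one, mul_one,
        eulerFactor_split hred]
      exact CongrMod.refl _ _
    · rw [Set.mulIndicator_of_notMem fun h' => (hSp.1 h').not_nonsplitMultAt hred,
        Set.mulIndicator_of_mem (hNs.2 hred),
        Set.mulIndicator_of_notMem fun h' => hred.not_goodAt (hGd.1 h'), mul_one, one_mul,
        eulerFactor_nonsplit hred]
      exact CongrMod.refl _ _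
    · rw [Set.mulIndicator_of_notMem fun h' => (hSp.1 h').not_additiveAt hred,
        Set.mulIndicator_of_notMem fun h' => (hNs.1 h').not_additiveAt hred,
        Set.mulIndicator_of_notMem fun h' => hred.not_goodAt (hGd.1 h'), mul_one, one_mul,
        eulerFactor_additive hred, inv1_one]
      exact CongrMod.refl _ _
  · have hγ : gammaAt L W v = 1 := by
      by_cases hadd : AdditiveAt W v
      · exact gammaAt_eq_one (Or.inr (Or.inr fun w hw => h.additive_baseChange h2 h3 hadd hw hπ
          hθ.sq ((Place.existsUnique_of_ramified hθ hπ).2 w hw) hs))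
      · exact gammaAt_eq_one (Or.inl hadd)
    have : AdditiveAt (quadraticTwist W f) v := h.additive_twist h2 h3 hπ hg hf hs
    rw [hγ, ite_self, eulerFactor_additive this, inv1_one]
    exact CongrMod.refl _ _

end RamifiedIdentity

theorem ordGe_natCast {K : Type*} [Field K] (O : ValuationSubring K) [IsDiscreteValuationRing O]
    (m : ℕ) : OrdGe O 0 (m : K) :=
  ordGe_zero_iff.2 (natCast_mem O m)

/-! ### Infinite products of power series -/

section Products

open PowerSeries

/-- Expand the product of 1 + (Fᵢ - 1) over finite sets of indices. The coefficient of Xⁿ receives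
contributions only from subsets of the finite set of i with Fᵢ ≢ 1 modulo X^(n+1). -/
theorem multipliable_of_X_pow_dvd {ι R : Type*} [CommRing R] [TopologicalSpace R] {F : ι → R⟦X⟧}
    (h : ∀ n : ℕ, {i | ¬ (X : R⟦X⟧) ^ (n + 1) ∣ F i - 1}.Finite) : Multipliable F := by
  have : Summable fun s : Finset ι => ∏ i ∈ s, (F i - 1) := by
    refine (WithPiTopology.summable_iff_summable_coeff _).2 fun n =>
      summable_of_hasFiniteSupport ?_
    refine (h n).toFinset.powerset.finite_toSet.subset fun s hs => ?_
    rw [Finset.mem_coe, Finset.mem_powerset]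
    intro i hi
    rw [Set.Finite.mem_toFinset]
    intro hd
    exact hs (X_pow_dvd_iff.1 (hd.trans (Finset.dvd_prod_of_mem (fun i => F i - 1) hi)) n
      n.lt_succ_self)
  simpa using multipliable_one_add_of_summable_prod this

theorem continuous_rescale (q : ℤ) : Continuous (rescale q) := by
  refine continuous_iff_continuousAt.2 fun F =>
    (WithPiTopology.tendsto_iff_coeff_tendsto _ _ _ _).2 fun d => ?_
  simp only [coeff_rescale]
  exact ((WithPiTopology.continuous_coeff ℤ d).const_smul (q ^ d)).tendsto F

theorem continuous_map {R S : Type*} [CommRing R] [CommRing S] [TopologicalSpace R]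
    [TopologicalSpace S] {f : R →+* S} (hf : Continuous f) : Continuous (PowerSeries.map f) := by
  refine continuous_iff_continuousAt.2 fun F =>
    (WithPiTopology.tendsto_iff_coeff_tendsto _ _ _ _).2 fun d => ?_
  simp only [coeff_map]
  exact (hf.comp (WithPiTopology.continuous_coeff R d)).tendsto F

/-- Congruences modulo `N` can be multiplied in convergent infinite products. -/
theorem CongrMod.tprod {ι : Type*} {N : ℕ} {F G : ι → ℤ⟦X⟧} (hF : Multipliable F)
    (hG : Multipliable G) (h : ∀ i, CongrMod N (F i) (G i)) :
    CongrMod N (∏' i, F i) (∏' i, G i) := by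
  -- With the discrete topology on `ZMod N`, coefficientwise reduction is continuous and commutes
  -- with convergent products.
  let : TopologicalSpace (ZMod N) := ⊥
  have : DiscreteTopology (ZMod N) := ⟨rfl⟩
  have hc := continuous_map (f := Int.castRingHom (ZMod N)) continuous_of_discreteTopology
  rw [CongrMod, hF.map_tprod _ hc, hG.map_tprod _ hc]
  exact tprod_congr h

theorem dvd_inv1_sub_one {F A : ℤ⟦X⟧} (hF : constantCoeff F = 1) (h : A ∣ F - 1) :
    A ∣ inv1 F - 1 := by
  have : inv1 F - 1 = -(inv1 F) * (F - 1) := by linear_combination mul_inv1 hF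
  exact this ▸ h.mul_left _

end Products

/-! ### Finiteness of bad reduction and convergence of the Euler products -/

section GlobalProducts

variable {k K : Type*} [Field k] [Field K] [Algebra k K]

/-- An elliptic curve has good reduction at almost all places. -/
theorem IsCurveFunctionField.finite_bad (hK : IsCurveFunctionField k K) (h2 : (2 : k) ≠ 0)
    (h3 : (3 : k) ≠ 0) (W : WeierstrassCurve K) [W.IsElliptic] :
    {v : Place k K | ¬ GoodAt W v}.Finite := by
  have hord2 (v : Place k K) : OrdEq v.ring 0 (2 : K) := by
    simpa only [map_ofNat] using v.ordEq_algebraMap h2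
  have hord3 (v : Place k K) : OrdEq v.ring 0 (3 : K) := by
    simpa only [map_ofNat] using v.ordEq_algebraMap h3
  have hint (x : K) : {v : Place k K | ¬ OrdGe v.ring 0 x}.Finite := by
    by_cases hx : x = 0
    · refine Set.finite_empty.subset fun v hv => hv ?_
      rw [hx]; exact ordGe_zero_right _
    · exact (hK.finite_not_unit hx).subset fun v hv h => hv h.ge
  -- A place is used only to see that 2 and 3 are nonzero in K.
  rcases isEmpty_or_nonempty (Place k K) with he | ⟨⟨v₀⟩⟩
  · exact Set.toFinite _
  have hd := disc_ne_zero (hord2 v₀).ne_zero (hord3 v₀).ne_zero W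
  refine (((hint (-W.c₄ / 48)).union (hint (-W.c₆ / 864))).union (hK.finite_not_unit hd)).subset
    fun v hv => ?_
  by_contra hgood
  simp only [Set.mem_union, Set.mem_ofPred_eq, not_or, not_not] at hgood
  obtain ⟨⟨ha, hb⟩, hdisc⟩ := hgood
  refine hv ?_
  -- Where the coefficients of the global short equation are integral and its discriminant is a
  -- unit, that equation is itself primitive, so c = 1 works.
  have h : IsPrimitiveModel v.ring W 1 ⟨_, ordGe_zero_iff.1 ha⟩ ⟨_, ordGe_zero_iff.1 hb⟩ :=
    ⟨one_ne_zero, by simp, by simp, fun ⟨h4, h6⟩ => hdisc.not_ge one_pos <|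
      ((ordGe_natCast v.ring 4).mul_of_le (h4.pow 3) (by norm_num)).add
        ((ordGe_natCast v.ring 27).mul_of_le (h6.pow 2) (by norm_num))⟩
  exact (h.good_iff (hord2 v) (hord3 v)).2 hdisc

variable [Finite k]

/-- Each factor is 1 up to terms of degree at least d_v, and only finitely many places have d_v ≤ n.
-/
theorem IsCurveFunctionField.multipliable (hK : IsCurveFunctionField k K)
    {F : Place k K → PowerSeries ℤ} (hF : ∀ v, PowerSeries.constantCoeff (F v) = 1)
    (h : ∀ v, (PowerSeries.X : PowerSeries ℤ) ^ v.deg ∣ F v - 1) :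
    Multipliable fun v => inv1 (F v) := by
  refine multipliable_of_X_pow_dvd fun n => (hK.finite_deg_le n).subset fun v hv => ?_
  by_contra hd
  rw [Set.mem_ofPred_eq, not_le] at hd
  exact hv ((pow_dvd_pow _ hd).trans (dvd_inv1_sub_one (hF v) (h v)))

theorem IsCurveFunctionField.multipliable_eulerFactor (hK : IsCurveFunctionField k K)
    (W : WeierstrassCurve K) [W.IsElliptic] :
    Multipliable fun v : Place k K => inv1 (eulerFactor W v) := by
  refine hK.multipliable (fun v => constantCoeff_eulerFactor (hK.deg_pos v)) fun v => ?_
  have h0 := constantCoeff_eulerFactor (W := W) (hK.deg_pos v)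
  rw [← PowerSeries.coeff_zero_eq_constantCoeff_apply] at h0
  rw [PowerSeries.X_pow_dvd_iff]
  intro m hm
  rw [map_sub, PowerSeries.coeff_one]
  split_ifs with h
  · rw [h, h0, sub_self]
  · rw [sub_zero, eulerFactor, Polynomial.coeff_coe, Polynomial.coeff_expand (hK.deg_pos v),
      if_neg fun hd => hm.not_ge (Nat.le_of_dvd (Nat.pos_of_ne_zero h) hd)]

theorem IsCurveFunctionField.multipliable_artinFactor (hK : IsCurveFunctionField k K)
    (L : Type*) [Field L] [Algebra k L] [Algebra K L] :
    Multipliable fun v : Place k K => inv1 (artinFactor L v) := by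
  refine hK.multipliable (fun v => constantCoeff_artinFactor L (hK.deg_pos v)) fun v => ?_
  rw [artinFactor]
  split_ifs
  · simp [lin]
  · simp [lin]
  · simp

end GlobalProducts

/-! ### The correction terms as one product over all places -/

section FiniteProducts

variable {k K L : Type*} [Field k] [Field K] [Field L] [Algebra k K] [Algebra k L] [Algebra K L]
  {W : WeierstrassCurve K}

/-- All the index sets consist of places of bad reduction of E, so the finite products can be
rewritten over all places and merged with the Euler products. -/
theorem hasFiniteMulSupport_correctionAt (hbad : {v : Place k K | ¬ GoodAt W v}.Finite) (N : ℕ) :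
    Function.HasFiniteMulSupport (fun v : Place k K => correctionAt L W v N) ∧
    ∏ᶠ v : Place k K, correctionAt L W v N = Rfactor k L W N * gammaRam k L W N := by
  have hf {S : Set (Place k K)} (hS : ∀ v ∈ S, ¬ GoodAt W v) (F : Place k K → PowerSeries ℤ) :
      Function.HasFiniteMulSupport (S.mulIndicator F) :=
    hbad.subset fun v hv => hS v (Set.mulSupport_mulIndicator_subset hv)
  have hMsp := hf (S := MspUnr k L W) fun v hv => hv.1.not_goodAt
  have hMns := hf (S := MnsUnr k L W) fun v hv => hv.1.not_goodAt
  have hA := hf (S := AUnr k L W) fun v hv => hv.1.not_goodAt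
  have hSp := hf (S := ARamSp k L W) fun v hv => hv.1.not_goodAt
  have hNs := hf (S := ARamNs k L W) fun v hv => hv.1.not_goodAt
  have hGd := hf (S := ARamGd k L W) fun v hv => hv.1.not_goodAt
  have e1 : Function.HasFiniteMulSupport (fun v : Place k K => RmultAt L W v) ∧
      ∏ᶠ v : Place k K, RmultAt L W v = Rmult k L W := by
    refine ⟨(hMsp _).mul (hMns _), ?_⟩
    rw [Rmult, finprod_mem_def, finprod_mem_def, ← finprod_mul_distrib (hMsp _) (hMns _)]
    rfl
  have e2 : Function.HasFiniteMulSupport (fun v : Place k K => RaddAt L W v) ∧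
      ∏ᶠ v : Place k K, RaddAt L W v = Radd k L W := by
    refine ⟨hA _, ?_⟩
    rw [Radd, finprod_mem_def]
    rfl
  have e3 : Function.HasFiniteMulSupport (fun v : Place k K => gammaAt L W v) ∧
      ∏ᶠ v : Place k K, gammaAt L W v =
        (∏ᶠ v ∈ ARamSp k L W, inv1 (lin (-1) v.deg)) *
        (∏ᶠ v ∈ ARamNs k L W, inv1 (lin 1 v.deg)) *
        ∏ᶠ v ∈ ARamGd k L W,
          inv1 (lin (-1) v.deg) * inv1 (lin (-(Nat.card k : ℤ) ^ v.deg) v.deg) := by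
    refine ⟨((hSp _).mul (hNs _)).mul (hGd _), ?_⟩
    rw [finprod_mem_def, finprod_mem_def, finprod_mem_def, ← finprod_mul_distrib (hSp _) (hNs _),
      ← finprod_mul_distrib ((hSp _).fun_mul (hNs _)) (hGd _)]
    rfl
  simp only [correctionAt, Rfactor, gammaRam]
  split_ifs
  · rw [mul_one]; exact e1
  · refine ⟨(e1.1.mul e2.1).mul e3.1, ?_⟩
    rw [finprod_mul_distrib (e1.1.fun_mul e2.1) e3.1, finprod_mul_distrib e1.1 e2.1, e1.2, e2.2, e3.2]

end FiniteProducts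

/-! ### Kodaira symbols at the contributing additive places -/

section Symbols

variable {k K : Type*} [Field k] [Field K] [Algebra k K] {v : Place k K} {W : WeierstrassCurve K}
  [W.IsElliptic]

theorem exists_hasKodairaSymbol_of_additiveAt [DecidableEq K] {T : AddSubgroup W.toAffine.Point}
    (h2 : OrdEq v.ring 0 (2 : K))
    (h3 : OrdEq v.ring 0 (3 : K)) (hN : OrdEq v.ring 0 (Nat.card T : K)) (h1 : 1 < Nat.card T)
    (hv : AdditiveAt W v) : ∃ s ∈ unrSymbols (Nat.card T), HasKodairaSymbol W v s := by
  obtain ⟨c, a, b, h⟩ := exists_isPrimitiveModel v.ring h2 h3 W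
  obtain ⟨C, hC⟩ := h.exists_smul h2.ne_zero h3.ne_zero
  obtain ⟨ha, hb⟩ := (h.additive_iff h2 h3).1 hv
  have hd := h.disc_ne h2.ne_zero h3.ne_zero
  rcases h.classification h2 h3 hN h1 ha hb with
    ⟨e, h | h | h⟩ | ⟨e, h | h⟩ | ⟨e, h⟩
  · exact ⟨_, Or.inl ⟨e, Or.inl rfl⟩, hasKodairaSymbol_III hC h.1 h.2⟩
  · exact ⟨_, Or.inl ⟨e, Or.inr (Or.inl rfl)⟩, hasKodairaSymbol_IIIstar hC h.1 h.2⟩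
  · obtain ⟨n, hn⟩ := hasKodairaSymbol_Istar hC h2 h3 hd h
    exact ⟨_, Or.inl ⟨e, Or.inr (Or.inr ⟨n, rfl⟩)⟩, hn⟩
  · exact ⟨_, Or.inr (Or.inl ⟨e, Or.inl rfl⟩), hasKodairaSymbol_IV hC h2 h.1 h.2⟩
  · exact ⟨_, Or.inr (Or.inl ⟨e, Or.inr rfl⟩), hasKodairaSymbol_IVstar hC h2 h.1 h.2⟩
  · obtain ⟨n, hn⟩ := hasKodairaSymbol_Istar hC h2 h3 hd h
    exact ⟨_, Or.inr (Or.inr ⟨e, n, rfl⟩), hn⟩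

theorem exists_hasKodairaSymbol_of_ramified {L : Type*} [Field L] [Algebra k L] [Algebra K L]
    [IsScalarTower k K L] {f : K} {θ : L} (h2 : OrdEq v.ring 0 (2 : K))
    (h3 : OrdEq v.ring 0 (3 : K)) (hθ : IsSqrtGenerator θ f) (hf : ¬ IsSquare f)
    (hv : v ∈ ARamSp k L W ∪ ARamNs k L W ∪ ARamGd k L W) :
    ∃ s ∈ ramSymbols, HasKodairaSymbol W v s := by
  have hram : v.IsRamified L := by
    rcases hv with (hv | hv) | hv <;> exact hv.2.1
  rcases Place.decomposition h2 hθ hf with ⟨π, g, hπ, hg, hfe, -⟩ | ⟨u, g, -, -, -, hnr, -⟩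
  · obtain ⟨c, a, b, h⟩ := exists_isPrimitiveModel v.ring h2 h3 W
    obtain ⟨C, hC⟩ := h.exists_smul h2.ne_zero h3.ne_zero
    obtain ⟨n, hn⟩ := hasKodairaSymbol_Istar hC h2 h3 (h.disc_ne h2.ne_zero h3.ne_zero)
      (h.isStarPair_of_mem h2 h3 (hθ.scale hg hfe) hπ hv)
    exact ⟨_, ⟨n, rfl⟩, hn⟩
  · exact absurd hram hnr

end Symbols

/-! ### The local congruence at an arbitrary place -/

section LocalCongruence

open IsLocalRing

variable {k K L : Type*} [Field k] [Finite k] [Field K] [DecidableEq K] [Field L] [Algebra k K]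
  [Algebra k L] [Algebra K L] [IsScalarTower k K L] {W : WeierstrassCurve K} [W.IsElliptic]
  {T : AddSubgroup W.toAffine.Point} {f : K} {θ : L}

/-- The congruence between the local factors at any place. -/
theorem congrMod_local (hK : IsCurveFunctionField k K) (v : Place k K)
    (h2 : OrdEq v.ring 0 (2 : K)) (h3 : OrdEq v.ring 0 (3 : K))
    (hN : OrdEq v.ring 0 (Nat.card T : K)) (h1 : 1 < Nat.card T)
    (hθ : IsSqrtGenerator θ f) (hf : ¬ IsSquare f) :
    CongrMod (Nat.card T) (inv1 (eulerFactor (quadraticTwist W f) v))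
      (inv1 (artinFactor L v) * PowerSeries.rescale (Nat.card k : ℤ) (inv1 (artinFactor L v)) *
        correctionAt L W v (Nat.card T)) := by
  rcases Place.decomposition h2 hθ hf with ⟨π, g, hπ, hg, hfe, hram, hns, hni⟩ |
    ⟨u, g, hu, hg, hfe, hnr, ⟨hsq, hs, hni⟩ | ⟨hsq, hi, hns⟩⟩
  · exact congrMod_of_ramified hK h2 h3 hN h1 (hθ.scale hg hfe) hπ hg hfe hram
      (not_or.2 ⟨hns, hni⟩) (by rw [artinFactor, if_neg hns, if_neg hni])
  · have hsgn : sgn L v = -1 := if_neg hni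
    exact congrMod_of_unramified hK h2 h3 hN h1 hu hg hfe (Or.inl hs) hnr
      (by rw [artinFactor, if_pos hs, hsgn]) (Or.inl ⟨hsq, hsgn⟩)
  · have hsgn : sgn L v = 1 := if_pos hi
    exact congrMod_of_unramified hK h2 h3 hN h1 hu hg hfe (Or.inr hi) hnr
      (by rw [artinFactor, if_neg hns, if_pos hi, hsgn]) (Or.inr ⟨hsq, hsgn⟩)

end LocalCongruence

end EllTwist

end

/-! ### The theorem -/

theorem theorem3p6 {k K Kf : Type*} [Field k] [Finite k] (p : ℕ) [CharP k p] (hp : 5 ≤ p)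
    [Field K] [DecidableEq K] [Algebra k K] (hK : EllTwist.IsCurveFunctionField k K)
    (W : WeierstrassCurve K) [W.IsElliptic] (hj : W.j ∉ (algebraMap k K).range)
    (f : K) (hf : ¬ IsSquare f)
    [Field Kf] [Algebra k Kf] [Algebra K Kf] [IsScalarTower k K Kf]
    (θ : Kf) (hθ : θ ^ 2 = algebraMap K Kf f) (hgen : IntermediateField.adjoin K {θ} = ⊤)
    (N : ℕ) (hN : 2 ≤ N) (hNq : N.Coprime (Nat.card k))
    (T : AddSubgroup W.toAffine.Point) (hT : Nat.card T = N) :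
    -- all products that occur are well defined
    {v : EllTwist.Place k K | ¬ EllTwist.GoodAt W v}.Finite ∧
    Multipliable (fun v : EllTwist.Place k K =>
      EllTwist.inv1 (EllTwist.eulerFactor (EllTwist.quadraticTwist W f) v)) ∧
    Multipliable (fun v : EllTwist.Place k K => EllTwist.inv1 (EllTwist.artinFactor Kf v)) ∧
    -- the congruence
    EllTwist.CongrMod N (EllTwist.ellL k (EllTwist.quadraticTwist W f))
      (EllTwist.artinL k K Kf *
        PowerSeries.rescale (Nat.card k : ℤ) (EllTwist.artinL k K Kf) *
        EllTwist.Rfactor k Kf W N * EllTwist.gammaRam k Kf W N) ∧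
    -- the Kodaira symbols of the contributing additive places
    (N ≤ 4 →
      (∀ v ∈ EllTwist.AUnr k Kf W,
        ∃ s ∈ EllTwist.unrSymbols N, EllTwist.HasKodairaSymbol W v s) ∧
      (∀ v ∈ EllTwist.ARamSp k Kf W ∪ EllTwist.ARamNs k Kf W ∪ EllTwist.ARamGd k Kf W,
        ∃ s ∈ EllTwist.ramSymbols, EllTwist.HasKodairaSymbol W v s)) := by
  subst hT
  have hcast {n : ℕ} (hn : n.Coprime p) : (n : k) ≠ 0 := by
    rw [Ne, CharP.cast_eq_zero_iff k p]
    intro hd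
    have := Nat.eq_one_of_dvd_coprimes hn hd dvd_rfl
    omega
  -- Since p divides q, an N coprime to q is nonzero in k, hence a unit at every place.
  have hpq : p ∣ Nat.card k := by
    have := Fintype.ofFinite k
    rw [Nat.card_eq_fintype_card, ← CharP.cast_eq_zero_iff k p]
    exact Nat.cast_card_eq_zero k
  have hN0 : (Nat.card T : k) ≠ 0 := hcast (hNq.coprime_dvd_right hpq)
  have hsmall {n : ℕ} (h0 : 0 < n) (hn : n < p) : (n : k) ≠ 0 := by
    rw [Ne, CharP.cast_eq_zero_iff k p]
    exact fun hd => hn.not_ge (Nat.le_of_dvd h0 hd)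
  have h2k : ((2 : ℕ) : k) ≠ 0 := hsmall two_pos (by omega)
  have h3k : ((3 : ℕ) : k) ≠ 0 := hsmall three_pos (by omega)
  have h2 (v : EllTwist.Place k K) : EllTwist.OrdEq v.ring 0 (2 : K) :=
    mod_cast v.ordEq_natCast h2k
  have h3 (v : EllTwist.Place k K) : EllTwist.OrdEq v.ring 0 (3 : K) :=
    mod_cast v.ordEq_natCast h3k
  have hNv (v : EllTwist.Place k K) := v.ordEq_natCast hN0
  have hgenr : EllTwist.IsSqrtGenerator θ f := .of_adjoin hθ hgen
  have h2K : (2 : K) ≠ 0 := by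
    simpa only [Nat.cast_ofNat, map_ofNat] using (map_ne_zero (algebraMap k K)).2 h2k
  have h3K : (3 : K) ≠ 0 := by
    simpa only [Nat.cast_ofNat, map_ofNat] using (map_ne_zero (algebraMap k K)).2 h3k
  have hell := EllTwist.quadraticTwist_isElliptic (W := W) h2K h3K
    (f := f) (by rintro rfl; exact hf (IsSquare.zero))
  have hbad := hK.finite_bad (by exact_mod_cast h2k) (by exact_mod_cast h3k) W
  have hE := hK.multipliable_eulerFactor (EllTwist.quadraticTwist W f)
  have hA := hK.multipliable_artinFactor Kf
  refine ⟨hbad, hE, hA, ?_, fun _ => ⟨fun v hv => ?_, fun v hv => ?_⟩⟩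
  · obtain ⟨hfin, hprod⟩ := EllTwist.hasFiniteMulSupport_correctionAt (L := Kf) hbad (Nat.card T)
    have hC := multipliable_of_hasFiniteMulSupport (L := .unconditional _) hfin
    have hR : Multipliable fun v : EllTwist.Place k K => PowerSeries.rescale (Nat.card k : ℤ)
        (EllTwist.inv1 (EllTwist.artinFactor Kf v)) := hA.map (PowerSeries.rescale (Nat.card k : ℤ)) (EllTwist.continuous_rescale _)
    -- The right side becomes a single convergent product: T ↦ qT is continuous and passes inside,
    -- and the finite corrections are unconditional products of finite support.
    rw [mul_assoc _ (EllTwist.Rfactor k Kf W _), ← hprod, ← tprod_eq_finprod (L := .unconditional _) hfin, EllTwist.artinL,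
      hA.map_tprod _ (EllTwist.continuous_rescale _), ← hA.tprod_mul hR, ← (hA.mul hR).tprod_mul hC]
    exact EllTwist.CongrMod.tprod hE ((hA.mul hR).mul hC) fun v =>
      EllTwist.congrMod_local hK v (h2 v) (h3 v) (hNv v) hN hgenr hf
  · exact EllTwist.exists_hasKodairaSymbol_of_additiveAt (h2 v) (h3 v) (hNv v) hN hv.1
  · exact EllTwist.exists_hasKodairaSymbol_of_ramified (h2 v) (h3 v) hgenr hf hv
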